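/- **Setting.** Let $k$ be an algebraically closed field with a fixed linear order $\prec$ (not assumed compatible with the operations). Write $[M_{ij}]$ for an $n\times n$ matrix partitioned into $\underline n\times\underline n$ blocks, $\underline n=(n_1,\dots,n_t)$, $n_i\ge 0$, $n=n_1+\dots+n_t$; the horizontal and vertical *strips* of $M$ are numbered by $T=\{1,\dots,t\}$. A *reduced $\underline n\times\underline n$ algebra* is an algebra $\Lambda\subset k^{n\times n}$ (containing $I$) for which there are an equivalence relation $\sim$ on $T$ (with $n_i=n_j$ if $i\sim j$) and, for all classes $\mathcal I,\mathcal J\in T/\!\sim$, finitely many equations $\sum_{\mathcal I\ni i<j\in\mathcal J}c^{(l)}_{ij}x_{ij}=0$ over $k$, such that $\Lambda$ consists of all upper block-triangular matrices $S=[S_{ij}]$ with $S_{ii}=S_{jj}$ whenever $i\sim j$ whose blocks $S_{ij}$, $i<j$, satisfy these equations. $\Lambda^*$ is the set of nonsingular matrices of $\Lambda$. A *Weyr matrix* is $W=W_{\{\lambda_1\}}\oplus\dots\oplus W_{\{\lambda_r\}}$, $\lambda_1\prec\dots\prec\lambda_r$, where $W_{\{\lambda_i\}}$ has the diagonal blocks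 $\lambda_iI_{m_{i1}},\dots,\lambda_iI_{m_{ik_i}}$, $m_{i1}\ge\dots\ge m_{ik_i}>0$, the blocks $\left[\begin{smallmatrix}I\\0\end{smallmatrix}\right]$ directly above the diagonal, and zeros elsewhere. By $\left[\begin{smallmatrix}0&I\\0&0\end{smallmatrix}\right]$ we mean any rectangular matrix of this form, with $I$ of any size $\ge 0$. **Algorithm and structured canonical matrices.** Order the blocks by $M_{t1}<M_{t2}<\dots<M_{tt}<M_{t-1,1}<\cdots$. A block $M_{ij}$ is *stable* if $(S^{-1}MS)_{ij}=M_{ij}$ for all $S\in\Lambda^*$. If not all blocks are stable, let $M_{lr}$ be the first nonstable block, and let $M'=S^{-1}MS$ with $S\in\Lambda^*$ such that - Case I: if $\sum_{j<r}M_{lj}S'_{jr}=\sum_{i>l}S'_{li}M_{ir}$ fails for some $S'\in\Lambda$, then $S$ has identity diagonal blocks and $M'_{lr}=0$; - Case II: if this equality holds for all $S'\in\Lambda$ and $l\not\sim r$, then $M'_{lr}=\left[\begin{smallmatrix}0&I\\0&0\end{smallmatrix}\right]$; - Case III: if it holds for all $S'\in\Lambda$ and $l\sim r$, then $M'_{lr}$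 is a Weyr matrix. Put $\Lambda'=\{S\in\Lambda\mid (SM')_{lr}=(M'S)_{lr}\}$. It is again a reduced algebra, in general with a finer partition. Replace $(M,\Lambda)$ by $(M',\Lambda')$ and repeat until all blocks are stable. The last matrix is the *$\Lambda$-canonical form* of the initial one; a matrix obtained in this way is *$\Lambda$-canonical*. Its *boxes* are collected along the process: at every step, all nonempty blocks (with respect to the current partition) that precede the current $M_{lr}$ and are not contained in earlier boxes become boxes, and then $M_{lr}$ itself becomes a box; at the end, all remaining nonempty blocks become boxes. The boxes falling into Case I (they are zero) are marked by $\emptyset$. A *structured $\Lambda$-canonical matrix* is a $\Lambda$-canonical matrix together with its boxes and marks. **Parts and strips.** Let $M$ be an $n\times n$ matrix partitioned into disjoint nonempty rectangular parts $M_1<M_2<\dots<M_m$, where $B<B'$ means that the last row of $B$ is below the last row of $B'$, or their last rows coincide and $B$ begins in an earlier column. Let each $M_i$ be $\emptyset$ (a marked zero part), or an unmarked part of the form $\left[\begin{smallmatrix}0&I\\0&0\end{smallmatrix}\right]$ or a Weyr matrix. For $0\le q\le m$, the *$q$-strips* are given by the most coarse subdivision of the strips into substrips, the same for rows and columns and the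 same in $i$th and $j$th strips if $i\sim j$, such that each of $M_1,\dots,M_q$ is partitioned into cells of the form $0$ or $\lambda I$. Two $q$-strips are *linked* if they are related by the smallest equivalence relation for which (i) the $\alpha$th $q$-strips of the $i$th and the $j$th strips are related if $i\sim j$, and (ii) a horizontal and a vertical $q$-strip are related if they intersect in a cell $I$ of one of $M_1,\dots,M_q$ (horizontal and vertical $q$-strips with the same number are identified). **Theorem 1.4.** Let $\Lambda$ be a reduced $\underline n\times\underline n$ algebra and let $M$ be as above. Then $M$ is a structured $\Lambda$-canonical matrix with boxes $M_1,\dots,M_m$ if and only if each $M_q$ $(1\le q\le m)$ satisfies the following conditions: (a) $M_q$ is the intersection of two $(q-1)$-strips. (b) Suppose there exists $M'=S^{-1}MS$ (partitioned conformally to $M$), where $S\in\Lambda^*$ has identity diagonal blocks with respect to the partition into $(q-1)$-strips, such that $M'_1=M_1,\dots,M'_{q-1}=M_{q-1}$, but $M'_q\ne M_q$. Then $M_q=\emptyset$. (c) Suppose $M'$ from (b) does not exist. Then $M_q$ is an (unmarked) Weyr matrix if the horizontal and the vertical $(q-1)$-strips of $M_q$ are linked, and $M_q$ is an (unmarked)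 matrix $\left[\begin{smallmatrix}0&I\\0&0\end{smallmatrix}\right]$ otherwise. -/

import Mathlib

namespace Belitskii

variable {k : Type*} {n : ℕ}

/-! ### Submatrices -/

/-- The submatrix of `M` in the rows `X` and the columns `Y`, both taken in increasing order. -/
def sub (M : Matrix (Fin n) (Fin n) k) (X Y : Finset (Fin n)) :
    Matrix (Fin X.card) (Fin Y.card) k :=
  M.submatrix (X.orderEmbOfFin rfl) (Y.orderEmbOfFin rfl)

/-- The `(a, c)` entry (counted from zero) of the submatrix `sub M X Y`; it is put equal to `0`
outside of the size of the submatrix. -/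
def subEntry [Zero k] (M : Matrix (Fin n) (Fin n) k) (X Y : Finset (Fin n)) (a c : ℕ) : k :=
  if h : a < X.card ∧ c < Y.card then sub M X Y ⟨a, h.1⟩ ⟨c, h.2⟩ else 0

/-- The matrix `A` is the scalar matrix with the scalar `lam`: it is square and equals
`lam • I`. -/
def IsScalarMatrix [Zero k] {h w : ℕ} (lam : k) (A : Matrix (Fin h) (Fin w) k) : Prop :=
  h = w ∧ ∀ i j, A i j = if (i : ℕ) = (j : ℕ) then lam else 0

/-- The matrix `A` is `[0 I; 0 0]`, where `I` is an identity matrix of some size `ρ ≥ 0`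
standing in the upper right corner. -/
def IsRankForm [Zero k] [One k] {h w : ℕ} (A : Matrix (Fin h) (Fin w) k) : Prop :=
  ∃ ρ : ℕ, ρ ≤ h ∧ ρ ≤ w ∧
    ∀ i j, A i j = if (i : ℕ) < ρ ∧ (j : ℕ) = w - ρ + (i : ℕ) then 1 else 0

/-- Indices of rows and columns of a Weyr matrix: triples `(i, j, a)`, where `i` numbers the
eigenvalues, `j < κ i` numbers the diagonal blocks `λ_i I_{m i j}` of `W_{λ_i}`, and `a < m i j`
numbers the rows of such a block; the triples are ordered lexicographically. -/
abbrev WeyrIndex {r : ℕ} (κ : Fin r → ℕ) (m : ∀ i, Fin (κ i) → ℕ) : Type :=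
  Σₗ i : Fin r, Σₗ j : Fin (κ i), Fin (m i j)

/-- The matrix `A` is a Weyr matrix `W_{λ_1} ⊕ … ⊕ W_{λ_r}` with `λ_1 ≺ … ≺ λ_r`. The block
`W_{λ_i}` has the diagonal blocks `λ_i I_{m i 0}, λ_i I_{m i 1}, …` with `m i 0 ≥ m i 1 ≥ …`, the
blocks `[I; 0]` directly above them, and zeros elsewhere. -/
def IsWeyr [Field k] [LinearOrder k] {h w : ℕ} (A : Matrix (Fin h) (Fin w) k) : Prop :=
  ∃ (r : ℕ) (lam : Fin r → k) (κ : Fin r → ℕ) (m : ∀ i, Fin (κ i) → ℕ)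
    (e : Fin h ≃o WeyrIndex κ m) (f : Fin w ≃o WeyrIndex κ m),
    StrictMono lam ∧ (∀ i, 0 < κ i) ∧ (∀ i j, 0 < m i j) ∧ (∀ i, Antitone (m i)) ∧
    ∀ x y, A x y =
      (if e x = f y then lam (ofLex (e x)).1
       else if (ofLex (e x)).1 = (ofLex (f y)).1 ∧
          ((ofLex (ofLex (e x)).2).1 : ℕ) + 1 = ((ofLex (ofLex (f y)).2).1 : ℕ) ∧
          ((ofLex (ofLex (e x)).2).2 : ℕ) = ((ofLex (ofLex (f y)).2).2 : ℕ)
        then 1 else 0)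

/-! ### Reduced matrix algebras

A partition of the rows and columns into `t` successive strips of sizes `n_1, …, n_t ≥ 0` is given
by a monotone map `b : Fin n → Fin t` sending an index to the number of its strip. -/

/-- The `i`-th strip. -/
def strip {t : ℕ} (b : Fin n → Fin t) (i : Fin t) : Finset (Fin n) :=
  Finset.univ.filter fun x => b x = i

/-- `Λ` is a reduced `(n_1, …, n_t) × (n_1, …, n_t)` algebra with the equivalence relation `rel`
on the set of strips. -/
def IsReducedAlgebra [Field k] {t : ℕ} (b : Fin n → Fin t) (rel : Setoid (Fin t))
    (Λ : Subalgebra k (Matrix (Fin n) (Fin n) k)) : Prop :=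
  Monotone b ∧
  (∀ i j, rel i j → (strip b i).card = (strip b j).card) ∧
  open Classical in
  ∃ (e : Quotient rel → Quotient rel → ℕ)
    (c : ∀ I J : Quotient rel, Fin (e I J) → Fin t → Fin t → k),
    ∀ S : Matrix (Fin n) (Fin n) k, S ∈ Λ ↔
      (∀ x y, b y < b x → S x y = 0) ∧
      (∀ i j, rel i j → ∀ a a' : ℕ,
        subEntry S (strip b i) (strip b i) a a' = subEntry S (strip b j) (strip b j) a a') ∧
      (∀ (I J : Quotient rel) (l : Fin (e I J)) (a a' : ℕ),
        ∑ i : Fin t, ∑ j : Fin t,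
          (if Quotient.mk rel i = I ∧ Quotient.mk rel j = J ∧ i < j then
            c I J l i j * subEntry S (strip b i) (strip b j) a a' else 0) = 0)

/-! ### Rectangular parts -/

/-- A (nonempty) rectangular part of an `n × n` matrix. -/
@[ext]
structure Part (n : ℕ) where
  top : Fin n
  bottom : Fin n
  left : Fin n
  right : Fin n
  top_le : top ≤ bottom
  left_le : left ≤ right

/-- The numbers of rows of a rectangular part. -/
def Part.rows (B : Part n) : Finset (Fin n) := Finset.Icc B.top B.bottom

/-- The numbers of columns of a rectangular part. -/
def Part.cols (B : Part n) : Finset (Fin n) := Finset.Icc B.left B.right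

/-- The entry with indices `(x, y)` belongs to the rectangular part. -/
def Part.Has (B : Part n) (x y : Fin n) : Prop := x ∈ B.rows ∧ y ∈ B.cols

/-- The order on rectangular parts. -/
def Part.Before (B B' : Part n) : Prop :=
  (B.bottom = B'.bottom ∧ B.left < B'.left) ∨ B'.bottom < B.bottom

/-- `B` is the `(i, j)` block of the partition into strips. -/
def Part.IsBlock {t : ℕ} (B : Part n) (b : Fin n → Fin t) (i j : Fin t) : Prop :=
  ∀ x y, B.Has x y ↔ b x = i ∧ b y = j

/-- The part of `M` with the place `B`, as a matrix. -/
def Part.of (B : Part n) (M : Matrix (Fin n) (Fin n) k) :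
    Matrix (Fin B.rows.card) (Fin B.cols.card) k :=
  sub M B.rows B.cols

/-! ### Belitskii's algorithm -/

section Algorithm

variable [Field k] {t : ℕ}

/-- The ordering of blocks: `M_{t1} < M_{t2} < … < M_{tt} < M_{t-1,1} < M_{t-1,2} < …`. -/
def BlockBefore (i j i' j' : Fin t) : Prop := i' < i ∨ (i = i' ∧ j < j')

/-- The block `M_{ij}` is stable: it is invariant under `Λ`-similarity transformations. -/
def Stable (Λ : Subalgebra k (Matrix (Fin n) (Fin n) k)) (b : Fin n → Fin t)
    (M : Matrix (Fin n) (Fin n) k) (i j : Fin t) : Prop :=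
  ∀ S ∈ Λ, IsUnit S → ∀ x y, b x = i → b y = j → (S⁻¹ * M * S) x y = M x y

/-- `M_{lr}` is the first nonstable block of `M`. -/
def FirstNonstable (Λ : Subalgebra k (Matrix (Fin n) (Fin n) k)) (b : Fin n → Fin t)
    (M : Matrix (Fin n) (Fin n) k) (l r : Fin t) : Prop :=
  ¬ Stable Λ b M l r ∧ ∀ i j, BlockBefore i j l r → Stable Λ b M i j

/-- There is no nonzero admissible addition to the block `M_{lr}` from other blocks:
`M_{l1} S_{1r} + … + M_{l,r-1} S_{r-1,r} = S_{l,l+1} M_{l+1,r} + … + S_{lt} M_{tr}`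
for all `S ∈ Λ`. -/
def NoAdditions (Λ : Subalgebra k (Matrix (Fin n) (Fin n) k)) (b : Fin n → Fin t)
    (M : Matrix (Fin n) (Fin n) k) (l r : Fin t) : Prop :=
  ∀ S ∈ Λ, ∀ x y, b x = l → b y = r →
    (∑ z, if b z < r then M x z * S z y else 0) = ∑ z, if l < b z then S x z * M z y else 0

/-- One step of the algorithm: a transformation `M' = S⁻¹ M S` with `S ∈ Λ^*` that reduces the
first nonstable block `M_{lr}`. In the first case (some addition to `M_{lr}` is nonzero) the block
is made zero by additions and is marked. Otherwise it is reduced to `[0 I; 0 0]` if `l ≁ r`, and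
to a Weyr matrix if `l ∼ r`; it is not marked. -/
def ReducesBlock [LinearOrder k] (Λ : Subalgebra k (Matrix (Fin n) (Fin n) k))
    (b : Fin n → Fin t) (rel : Setoid (Fin t)) (l r : Fin t)
    (M M' : Matrix (Fin n) (Fin n) k) (mark : Bool) : Prop :=
  ∃ S ∈ Λ, IsUnit S ∧ M' = S⁻¹ * M * S ∧
    ((¬ NoAdditions Λ b M l r ∧ mark = true ∧
        (∀ x y, b x = b y → S x y = if x = y then 1 else 0) ∧
        sub M' (strip b l) (strip b r) = 0) ∨
     (NoAdditions Λ b M l r ∧ ¬ rel l r ∧ mark = false ∧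
        IsRankForm (sub M' (strip b l) (strip b r))) ∨
     (NoAdditions Λ b M l r ∧ rel l r ∧ mark = false ∧
        IsWeyr (sub M' (strip b l) (strip b r))))

/-- The blocks satisfying `C` that are not contained in the boxes found before; they become new
(unmarked) boxes. -/
def newBoxes (b : Fin n → Fin t) (C : Fin t → Fin t → Prop) (done : Set (Part n × Bool)) :
    Set (Part n × Bool) :=
  {p | p.2 = false ∧ (∃ i j, p.1.IsBlock b i j ∧ C i j) ∧
    ¬ ∃ p' ∈ done, ∀ x y, p.1.Has x y → p'.1.Has x y}

end Algorithm

/-- `Run Λ done M M∞ boxes`: Belitskii's algorithm, applied to the matrix `M` and the algebra `Λ`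
when the boxes `done` are already found, terminates at the matrix `M∞`, and `boxes` is the set of all
boxes of `M∞`, each supplied with `true` or `false` depending on whether it is marked. -/
inductive Run [Field k] [LinearOrder k] : Subalgebra k (Matrix (Fin n) (Fin n) k) →
    Set (Part n × Bool) → Matrix (Fin n) (Fin n) k → Matrix (Fin n) (Fin n) k →
    Set (Part n × Bool) → Prop
  /-- All blocks are stable. -/
  | finish (Λ : Subalgebra k (Matrix (Fin n) (Fin n) k)) (done : Set (Part n × Bool))
      (M : Matrix (Fin n) (Fin n) k) (t : ℕ) (b : Fin n → Fin t) (rel : Setoid (Fin t))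
      (hΛ : IsReducedAlgebra b rel Λ) (hM : ∀ i j, Stable Λ b M i j) :
      Run Λ done M M (done ∪ newBoxes b (fun _ _ => True) done)
  /-- The first nonstable block `M_{lr}`, located at `B`, is reduced, and the algorithm is
  continued with `Λ' = {S ∈ Λ | S M' and M' S coincide at the place of M_{lr}}`. -/
  | step (Λ Λ' : Subalgebra k (Matrix (Fin n) (Fin n) k)) (done boxes : Set (Part n × Bool))
      (M M' Minf : Matrix (Fin n) (Fin n) k) (t : ℕ) (b : Fin n → Fin t) (rel : Setoid (Fin t))
      (l r : Fin t) (B : Part n) (mark : Bool)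
      (hΛ : IsReducedAlgebra b rel Λ) (hlr : FirstNonstable Λ b M l r) (hB : B.IsBlock b l r)
      (hM' : ReducesBlock Λ b rel l r M M' mark)
      (hΛ' : ∀ S, S ∈ Λ' ↔ S ∈ Λ ∧ ∀ x y, b x = l → b y = r → (S * M') x y = (M' * S) x y)
      (hrun : Run Λ' (done ∪ newBoxes b (fun i j => BlockBefore i j l r) done ∪ {(B, mark)})
        M' Minf boxes) :
      Run Λ done M Minf boxes

/-- `M` with the boxes at the places `parts 0, parts 1, …`, marked as `mark` tells, is a structured
`Λ`-canonical matrix: `M` is the `Λ`-canonical form of some matrix, and these are its boxes. -/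
def IsStructuredCanonical [Field k] [LinearOrder k] (Λ : Subalgebra k (Matrix (Fin n) (Fin n) k))
    (M : Matrix (Fin n) (Fin n) k) {m : ℕ} (parts : Fin m → Part n) (mark : Fin m → Bool) : Prop :=
  ∃ N, Run Λ ∅ N M (Set.range fun q => (parts q, mark q))

/-! ### Subdivisions of strips

Subdivisions of the rows and columns into substrips (the same for the rows and the columns) are
given by equivalence relations on the set of indices. -/

section Strips

variable [Field k] {t m : ℕ}

/-- The number of the index `x` inside of its strip, counted from zero. -/
def place (b : Fin n → Fin t) (x : Fin n) : ℕ :=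
  (Finset.univ.filter fun z => b z = b x ∧ z < x).card

open Classical in
/-- The indices from `X` that lie in the same substrip as `x`. -/
noncomputable def cellSide (P : Setoid (Fin n)) (X : Finset (Fin n)) (x : Fin n) :
    Finset (Fin n) :=
  X.filter fun z => P x z

/-- The cell of the part `B` of `M` that is cut out by the horizontal substrip of `x` and the
vertical substrip of `y`. -/
noncomputable def cell (M : Matrix (Fin n) (Fin n) k) (B : Part n) (P : Setoid (Fin n))
    (x y : Fin n) :
    Matrix (Fin (cellSide P B.rows x).card) (Fin (cellSide P B.cols y).card) k :=
  sub M (cellSide P B.rows x) (cellSide P B.cols y)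

/-- `P` is a subdivision of the strips into substrips such that `∼`-equivalent strips are
subdivided alike and each of the parts preceding the `q`-th one is partitioned into cells of the
form `0` or `λ I`. -/
structure IsSubdivision (b : Fin n → Fin t) (rel : Setoid (Fin t)) (M : Matrix (Fin n) (Fin n) k)
    (parts : Fin m → Part n) (q : Fin m) (P : Setoid (Fin n)) : Prop where
  convex : ∀ x y z, x ≤ y → y ≤ z → P x z → P x y
  refines : ∀ x y, P x y → b x = b y
  alike : ∀ x x' y y', b x = b x' → b y = b y' → rel (b x) (b y) →
    place b x = place b y → place b x' = place b y' → (P x x' ↔ P y y')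
  cells : ∀ p < q, ∀ x y, (parts p).Has x y →
    cell M (parts p) P x y = 0 ∨ ∃ lam : k, IsScalarMatrix lam (cell M (parts p) P x y)

/-- The subdivision into the substrips determined by the parts preceding the `q`-th one: the most
coarse subdivision satisfying `IsSubdivision`. -/
def strips (b : Fin n → Fin t) (rel : Setoid (Fin t)) (M : Matrix (Fin n) (Fin n) k)
    (parts : Fin m → Part n) (q : Fin m) : Setoid (Fin n) :=
  sSup {P | IsSubdivision b rel M parts q P}

/-- The substrips containing the indices `x` and `y` are linked. -/
inductive Linked (b : Fin n → Fin t) (rel : Setoid (Fin t)) (M : Matrix (Fin n) (Fin n) k)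
    (parts : Fin m → Part n) (q : Fin m) : Fin n → Fin n → Prop
  | same (x y : Fin n) : strips b rel M parts q x y → Linked b rel M parts q x y
  | equiv (x y : Fin n) : rel (b x) (b y) → place b x = place b y → Linked b rel M parts q x y
  | cell (p : Fin m) (x y : Fin n) : p < q → (parts p).Has x y →
      IsScalarMatrix 1 (cell M (parts p) (strips b rel M parts q) x y) →
      Linked b rel M parts q x y
  | symm (x y : Fin n) : Linked b rel M parts q x y → Linked b rel M parts q y x
  | trans (x y z : Fin n) : Linked b rel M parts q x y → Linked b rel M parts q y z →
      Linked b rel M parts q x z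

/-- The `q`-th part of `M` can be changed by additions preserving all preceding parts: there is
`M' = S⁻¹ M S`, where `S ∈ Λ^*` has identity diagonal blocks with respect to the substrips
determined by the preceding parts, that coincides with `M` on all preceding parts, but not on the
`q`-th part. -/
def CanBeChanged (b : Fin n → Fin t) (rel : Setoid (Fin t))
    (Λ : Subalgebra k (Matrix (Fin n) (Fin n) k)) (M : Matrix (Fin n) (Fin n) k)
    (parts : Fin m → Part n) (q : Fin m) : Prop :=
  ∃ S ∈ Λ, IsUnit S ∧
    (∀ x y, strips b rel M parts q x y → S x y = if x = y then 1 else 0) ∧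
    (∀ p < q, (parts p).of (S⁻¹ * M * S) = (parts p).of M) ∧
    (parts q).of (S⁻¹ * M * S) ≠ (parts q).of M

end Strips

end Belitskii

/-! The algorithm carries an algebra from step to step, while the conditions mention only `Λ`, `M`
and the parts. The bridge is the algebra of all `S` in `Λ` for which `S * M` and `M * S` agree on
the first `q` parts. The structure `Stage` records that this algebra is block upper triangular for
the coarsest admissible subdivision `P`, that its diagonal blocks are tied together exactly by the
links, and that it contains every block-diagonal matrix respecting these ties. Since such `S` are
triangular and the parts are ordered from the bottom up and from left to right, the entries of `S *
M` and `M * S` in a part involve only this part and earlier ones (`Stage.left_mul_apply`,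
`Stage.right_mul_apply`). Hence the units of the algebra are exactly the units of `Λ` whose
conjugation preserves the first `q` parts.

At a stage every notion in the conditions can be read off the algebra: the strips are the classes of
`P` (`Stage.strips_eq`), linked strips are those with tied diagonal blocks (`Stage.linked_iff`), and
a part can be changed exactly when some `R` in the algebra with zero diagonal blocks fails to
commute with `M` there (`Stage.canBeChanged_iff`). Conversely, the algebra determines its partition
and its ties, because it contains enough matrix units and idempotents
(`IsBlockAlgebra.eq_partition`, `IsBlockAlgebra.eq_rel`). So the strips used by the algorithm are
those of the stage, and the conditions on a part that is a block become its three cases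
(`Stage.partCondition_iff`).

A part satisfying the conditions leads to the next stage (`Stage.exists_succ`). A marked part is
zero and cuts nothing. For an unmarked part `A` the diagonal blocks satisfy `X A = A Y`; for `A` of
the form `[0 I; 0 0]` or a Weyr matrix this relation forces exactly the triangularity and the
equalities prescribed by the finer strips (`isPattern_rank`, `WeyrShape.isPattern`,
`Stage.succ_of_pattern`). A stable part commutes with the whole algebra, since the field is
infinite, and is therefore zero or scalar, as the conditions require
(`Stage.partCondition_of_fixed`).

If all conditions hold, the algorithm can run on `M` with identity transformations (`Stage.run`). If
`M` is the end of some run, then all transformations after a given moment lie in the algebra of that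
moment, so the intermediate matrices agree with `M` on the parts already treated, and the case
chosen by the algorithm is the condition for `M` (`Run.partCondition`). -/

namespace Belitskii

/-! ### Ranks in finite sets of indices -/

/-- The number of elements of `X` that are smaller than `x`. -/
def rk {n : ℕ} (X : Finset (Fin n)) (x : Fin n) : ℕ := (X.filter (· < x)).card

section Rank

variable {n : ℕ} {X Y : Finset (Fin n)}

theorem rk_lt_card {x : Fin n} (hx : x ∈ X) : rk X x < X.card :=
  Finset.card_lt_card (Finset.filter_ssubset.2 ⟨x, hx, lt_irrefl x⟩)

theorem rk_lt_rk {x y : Fin n} (hx : x ∈ X) (h : x < y) : rk X x < rk X y := by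
  apply Finset.card_lt_card
  refine (Finset.ssubset_iff_of_subset ?_).2 ⟨x, by simp [hx, h], by simp⟩
  intro z hz
  simp only [Finset.mem_filter] at hz ⊢
  exact ⟨hz.1, hz.2.trans h⟩

theorem rk_lt_rk_iff {x y : Fin n} (hx : x ∈ X) (hy : y ∈ X) : rk X x < rk X y ↔ x < y := by
  refine ⟨fun h => ?_, rk_lt_rk hx⟩
  by_contra hxy
  rcases (not_lt.1 hxy).eq_or_lt with rfl | h'
  · exact lt_irrefl _ h
  · exact lt_asymm h (rk_lt_rk hy h')

theorem rk_inj {x y : Fin n} (hx : x ∈ X) (hy : y ∈ X) (h : rk X x = rk X y) : x = y := by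
  rcases lt_trichotomy x y with h' | h' | h'
  · exact absurd h (rk_lt_rk hx h').ne
  · exact h'
  · exact absurd h (rk_lt_rk hy h').ne'

theorem rk_orderEmbOfFin (a : Fin X.card) : rk X (X.orderEmbOfFin rfl a) = a := by
  have : X.filter (· < X.orderEmbOfFin rfl a) =
      (Finset.univ.filter (· < a)).map (X.orderEmbOfFin rfl).toEmbedding := by
    ext z
    simp only [Finset.mem_filter, Finset.mem_map, Finset.mem_univ, true_and]
    constructor
    · rintro ⟨hz, hlt⟩
      have : z ∈ Set.range (X.orderEmbOfFin rfl) := by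
        rw [Finset.range_orderEmbOfFin]; exact hz
      obtain ⟨c, rfl⟩ := this
      exact ⟨c, by simpa using hlt, rfl⟩
    · rintro ⟨c, hc, rfl⟩
      exact ⟨Finset.orderEmbOfFin_mem _ _ _, by simpa using hc⟩
  rw [rk, this, Finset.card_map]
  rw [show (Finset.univ.filter (· < a)) = Finset.Iio a by ext; simp, Fin.card_Iio]

theorem orderEmbOfFin_rk {x : Fin n} (hx : x ∈ X) :
    X.orderEmbOfFin rfl ⟨rk X x, rk_lt_card hx⟩ = x :=
  rk_inj (Finset.orderEmbOfFin_mem _ _ _) hx (rk_orderEmbOfFin _)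

theorem exists_rk_eq {a : ℕ} (ha : a < X.card) : ∃ x ∈ X, rk X x = a :=
  ⟨_, Finset.orderEmbOfFin_mem X rfl ⟨a, ha⟩, rk_orderEmbOfFin _⟩

/-- Preservation and reflection of the order make `R` single-valued in both directions, so a choice
of partners is a bijection. -/
theorem card_eq_of_rel (R : Fin n → Fin n → Prop)
    (h₁ : ∀ x ∈ X, ∃ y ∈ Y, R x y) (h₂ : ∀ y ∈ Y, ∃ x ∈ X, R x y)
    (h₃ : ∀ x ∈ X, ∀ x' ∈ X, ∀ y ∈ Y, ∀ y' ∈ Y, R x y → R x' y' → (x < x' ↔ y < y')) :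
    X.card = Y.card := by
  choose f hf hR using h₁
  refine Finset.card_bij f hf ?_ ?_
  · intro a ha c hc h
    have h1 := h₃ a ha c hc _ (hf a ha) _ (hf c hc) (hR a ha) (hR c hc)
    have h2 := h₃ c hc a ha _ (hf c hc) _ (hf a ha) (hR c hc) (hR a ha)
    rw [h] at h1 h2
    exact le_antisymm (not_lt.1 fun h' => lt_irrefl _ (h2.1 h'))
      (not_lt.1 fun h' => lt_irrefl _ (h1.1 h'))
  · intro y hy
    obtain ⟨x, hx, hxy⟩ := h₂ y hy
    refine ⟨x, hx, ?_⟩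
    have h1 := h₃ x hx x hx _ (hf x hx) _ hy (hR x hx) hxy
    have h2 := h₃ x hx x hx _ hy _ (hf x hx) hxy (hR x hx)
    simp only [lt_self_iff_false, false_iff, not_lt] at h1 h2
    exact le_antisymm h2 h1

/-- A relation that is an order isomorphism between two sets of indices is the equality of
ranks. -/
theorem rk_eq_iff_of_rel (R : Fin n → Fin n → Prop)
    (h₁ : ∀ x ∈ X, ∃ y ∈ Y, R x y) (h₂ : ∀ y ∈ Y, ∃ x ∈ X, R x y)
    (h₃ : ∀ x ∈ X, ∀ x' ∈ X, ∀ y ∈ Y, ∀ y' ∈ Y, R x y → R x' y' → (x < x' ↔ y < y'))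
    {x y : Fin n} (hx : x ∈ X) (hy : y ∈ Y) : rk X x = rk Y y ↔ R x y := by
  have key : ∀ x ∈ X, ∀ y ∈ Y, R x y → rk X x = rk Y y := by
    intro x hx y hy hxy
    -- Both ranks count initial segments, and `R` restricts to an order isomorphism between these
    -- segments.
    refine card_eq_of_rel R ?_ ?_ ?_
    · intro z hz
      simp only [Finset.mem_filter] at hz
      obtain ⟨w, hw, hzw⟩ := h₁ z hz.1
      exact ⟨w, Finset.mem_filter.2 ⟨hw, (h₃ z hz.1 x hx w hw y hy hzw hxy).1 hz.2⟩, hzw⟩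
    · intro w hw
      simp only [Finset.mem_filter] at hw
      obtain ⟨z, hz, hzw⟩ := h₂ w hw.1
      exact ⟨z, Finset.mem_filter.2 ⟨hz, (h₃ z hz x hx w hw.1 y hy hzw hxy).2 hw.2⟩, hzw⟩
    · intro z hz z' hz' w hw w' hw'
      exact h₃ z (Finset.mem_filter.1 hz).1 z' (Finset.mem_filter.1 hz').1 w
        (Finset.mem_filter.1 hw).1 w' (Finset.mem_filter.1 hw').1
  refine ⟨fun h => ?_, key x hx y hy⟩
  obtain ⟨y', hy', hxy'⟩ := h₁ x hx
  rwa [rk_inj hy hy' (h ▸ key x hx y' hy' hxy')]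

variable {k : Type*}

theorem sub_apply (M : Matrix (Fin n) (Fin n) k) {x y : Fin n} (hx : x ∈ X) (hy : y ∈ Y) :
    sub M X Y ⟨rk X x, rk_lt_card hx⟩ ⟨rk Y y, rk_lt_card hy⟩ = M x y := by
  simp [sub, orderEmbOfFin_rk hx, orderEmbOfFin_rk hy]

theorem subEntry_rk [Zero k] (M : Matrix (Fin n) (Fin n) k) {x y : Fin n} (hx : x ∈ X)
    (hy : y ∈ Y) : subEntry M X Y (rk X x) (rk Y y) = M x y := by
  rw [subEntry, dif_pos ⟨rk_lt_card hx, rk_lt_card hy⟩, sub_apply M hx hy]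

theorem subEntry_eq_zero [Zero k] (M : Matrix (Fin n) (Fin n) k) {a c : ℕ}
    (h : ¬ (a < X.card ∧ c < Y.card)) : subEntry M X Y a c = 0 := dif_neg h

theorem sub_eq_iff (M N : Matrix (Fin n) (Fin n) k) :
    sub M X Y = sub N X Y ↔ ∀ x ∈ X, ∀ y ∈ Y, M x y = N x y := by
  constructor
  · intro h x hx y hy
    rw [← sub_apply M hx hy, h, sub_apply N hx hy]
  · intro h
    ext a c
    exact h _ (Finset.orderEmbOfFin_mem _ _ _) _ (Finset.orderEmbOfFin_mem _ _ _)

theorem sub_eq_zero_iff [Zero k] (M : Matrix (Fin n) (Fin n) k) :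
    sub M X Y = 0 ↔ ∀ x ∈ X, ∀ y ∈ Y, M x y = 0 :=
  sub_eq_iff M 0

theorem isScalarMatrix_sub_iff [Zero k] (M : Matrix (Fin n) (Fin n) k) (lam : k) :
    IsScalarMatrix lam (sub M X Y) ↔ X.card = Y.card ∧
      ∀ x ∈ X, ∀ y ∈ Y, M x y = if rk X x = rk Y y then lam else 0 := by
  refine and_congr_right fun _ => ⟨fun h x hx y hy => ?_, fun h a c => ?_⟩
  · rw [← sub_apply M hx hy, h]
  · have := h _ (Finset.orderEmbOfFin_mem X rfl a) _ (Finset.orderEmbOfFin_mem Y rfl c)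
    rw [rk_orderEmbOfFin, rk_orderEmbOfFin] at this
    exact this

end Rank

/-! ### Classes of a subdivision -/

section Classes

variable {n : ℕ}

open Classical in
/-- The class of `x`. -/
noncomputable def cls (P : Setoid (Fin n)) (x : Fin n) : Finset (Fin n) :=
  Finset.univ.filter fun z => P x z

/-- The number of `x` inside of its class, counted from zero. -/
noncomputable def pl (P : Setoid (Fin n)) (x : Fin n) : ℕ := rk (cls P x) x

/-- The size of the class of `x`. -/
noncomputable def cd (P : Setoid (Fin n)) (x : Fin n) : ℕ := (cls P x).card

variable {P : Setoid (Fin n)} {x y : Fin n}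

@[simp] theorem mem_cls : y ∈ cls P x ↔ P x y := by simp [cls]

theorem cls_eq (h : P x y) : cls P x = cls P y := by
  ext z
  simp only [mem_cls]
  exact ⟨fun h' => P.trans (P.symm h) h', fun h' => P.trans h h'⟩

theorem cd_eq (h : P x y) : cd P x = cd P y := by rw [cd, cd, cls_eq h]

theorem pl_eq_rk (h : P x y) : pl P y = rk (cls P x) y := by rw [pl, cls_eq h]

theorem pl_lt_cd (P : Setoid (Fin n)) (x : Fin n) : pl P x < cd P x :=
  rk_lt_card (mem_cls.2 (P.refl x))

theorem pl_inj (h : P x y) (h' : pl P x = pl P y) : x = y := by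
  rw [pl_eq_rk h] at h'
  exact rk_inj (mem_cls.2 (P.refl x)) (mem_cls.2 h) h'

theorem pl_lt_pl_iff (h : P x y) : pl P x < pl P y ↔ x < y := by
  rw [pl_eq_rk h]
  exact rk_lt_rk_iff (mem_cls.2 (P.refl x)) (mem_cls.2 h)

theorem exists_pl_eq {a : ℕ} (h : a < cd P x) : ∃ y, P x y ∧ pl P y = a := by
  obtain ⟨y, hy, rfl⟩ := exists_rk_eq h
  exact ⟨y, mem_cls.1 hy, pl_eq_rk (mem_cls.1 hy)⟩

/-- Relations between classes that are order isomorphisms of classes. -/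
def Compat (P : Setoid (Fin n)) (R : Fin n → Fin n → Prop) : Prop :=
  ∀ x y, R x y → cd P x = cd P y ∧ pl P x = pl P y ∧
    ∀ x' y', P x x' → P y y' → pl P x' = pl P y' → R x' y'

theorem class_iso (R : Fin n → Fin n → Prop)
    (h₁ : ∀ x', P x x' → ∃ y', P y y' ∧ R x' y') (h₂ : ∀ y', P y y' → ∃ x', P x x' ∧ R x' y')
    (h₃ : ∀ z z' w w', P x z → P x z' → P y w → P y w' → R z w → R z' w' → (z < z' ↔ w < w')) :
    cd P x = cd P y ∧ ∀ z w, P x z → P y w → (pl P z = pl P w ↔ R z w) := by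
  have h₁' : ∀ z ∈ cls P x, ∃ w ∈ cls P y, R z w := fun z hz => by simpa using h₁ z (by simpa using hz)
  have h₂' : ∀ w ∈ cls P y, ∃ z ∈ cls P x, R z w := fun z hz => by simpa using h₂ z (by simpa using hz)
  have h₃' : ∀ z ∈ cls P x, ∀ z' ∈ cls P x, ∀ w ∈ cls P y, ∀ w' ∈ cls P y, R z w → R z' w' →
      (z < z' ↔ w < w') := fun z hz z' hz' w hw w' hw' =>
    h₃ z z' w w' (mem_cls.1 hz) (mem_cls.1 hz') (mem_cls.1 hw) (mem_cls.1 hw')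
  refine ⟨card_eq_of_rel R h₁' h₂' h₃', fun z w hz hw => ?_⟩
  rw [pl_eq_rk hz, pl_eq_rk hw]
  exact rk_eq_iff_of_rel R h₁' h₂' h₃' (mem_cls.2 hz) (mem_cls.2 hw)

theorem Compat.exists {R : Fin n → Fin n → Prop} (h : Compat P R) {x y x' : Fin n} (hxy : R x y)
    (hx : P x x') : ∃ y', P y y' ∧ pl P x' = pl P y' ∧ R x' y' := by
  obtain ⟨h1, -, h3⟩ := h x y hxy
  obtain ⟨y', hy, hp⟩ := exists_pl_eq (P := P) (x := y) (a := pl P x')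
    (by rw [← h1, cd_eq hx]; exact pl_lt_cd P x')
  exact ⟨y', hy, hp.symm, h3 x' y' hx hy hp.symm⟩

/-- Inverses and composites of order isomorphisms of classes are again of this kind, so only
generators have to be tested. -/
theorem Compat.eqvGen {R : Fin n → Fin n → Prop} (h : Compat P R) :
    Compat P (Relation.EqvGen R) := by
  intro x y hxy
  induction hxy with
  | rel x y hxy =>
    obtain ⟨h1, h2, h3⟩ := h x y hxy
    exact ⟨h1, h2, fun x' y' hx hy hp => .rel _ _ (h3 x' y' hx hy hp)⟩
  | refl x =>
    refine ⟨rfl, rfl, fun x' y' hx hy hp => ?_⟩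
    rw [pl_inj (P.trans (P.symm hx) hy) hp]
    exact .refl _
  | symm x y _ ih =>
    exact ⟨ih.1.symm, ih.2.1.symm, fun x' y' hx hy hp => (ih.2.2 y' x' hy hx hp.symm).symm⟩
  | trans x y z _ _ ih ih' =>
    refine ⟨ih.1.trans ih'.1, ih.2.1.trans ih'.2.1, fun x' z' hx hz hp => ?_⟩
    obtain ⟨y', hy, hp'⟩ := exists_pl_eq (P := P) (x := y) (a := pl P x')
      (by rw [← ih.1, cd_eq hx]; exact pl_lt_cd P x')
    exact (ih.2.2 x' y' hx hy hp'.symm).trans _ _ _ (ih'.2.2 y' z' hy hz (hp'.trans hp))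

/-- The classes are intervals. -/
def Convex (P : Setoid (Fin n)) : Prop := ∀ x y z, x ≤ y → y ≤ z → P x z → P x y

theorem Convex.lt_of_lt (hP : Convex P) {x y x' y' : Fin n} (hxy : ¬ P x y) (h : x < y)
    (hx : P x x') (hy : P y y') : x' < y' := by
  by_contra hlt
  rw [not_lt] at hlt
  apply hxy
  rcases le_total x y' with h1 | h1
  · exact P.trans (hP x y' x' h1 hlt hx) (P.symm hy)
  · exact P.symm (P.trans hy (hP y' x y h1 h.le (P.symm hy)))

end Classes

end Belitskii

namespace Belitskii

/-! ### Block triangular algebras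

The equations in the definition of a reduced algebra hold automatically as soon as the algebra
contains all block-diagonal matrices with the prescribed equalities of diagonal blocks. -/

section BlockAlgebra

variable {k : Type*} [Field k] {n : ℕ}

/-- `Λ` consists of block upper triangular matrices with respect to the partition `P`; the
relation `E` describes which entries of the diagonal blocks are equal, and `Λ` contains all
block-diagonal matrices satisfying these equalities. -/
structure IsBlockAlgebra (P E : Setoid (Fin n)) (Λ : Subalgebra k (Matrix (Fin n) (Fin n) k)) :
    Prop where
  convex : Convex P
  compat : Compat P E
  tri : ∀ S ∈ Λ, ∀ x y, y < x → ¬ P x y → S x y = 0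
  diag : ∀ S ∈ Λ, ∀ x x' y y', E x x' → E y y' → P x y → P x' y' → S x y = S x' y'
  full : ∀ S : Matrix (Fin n) (Fin n) k, (∀ x y, ¬ P x y → S x y = 0) →
    (∀ x x' y y', E x x' → E y y' → P x y → P x' y' → S x y = S x' y') → S ∈ Λ

open Classical in
/-- The matrix whose diagonal blocks are matrix units at the place `(a, c)`. -/
noncomputable def placeUnit (k : Type*) [Field k] (P : Setoid (Fin n)) (a c : ℕ) :
    Matrix (Fin n) (Fin n) k :=
  fun x y => if P x y ∧ pl P x = a ∧ pl P y = c then 1 else 0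

open Classical in
/-- The block-diagonal part of a matrix. -/
noncomputable def blockDiag (P : Setoid (Fin n)) (S : Matrix (Fin n) (Fin n) k) :
    Matrix (Fin n) (Fin n) k := fun x y => if P x y then S x y else 0

variable {P E P' E' : Setoid (Fin n)} {Λ : Subalgebra k (Matrix (Fin n) (Fin n) k)}

theorem IsBlockAlgebra.placeUnit_mem (h : IsBlockAlgebra P E Λ) (a c : ℕ) :
    placeUnit k P a c ∈ Λ := by
  refine h.full _ (fun x y hxy => ?_) (fun x x' y y' hx hy hxy hxy' => ?_)
  · simp [placeUnit, hxy]
  · simp [placeUnit, hxy, hxy', (h.compat x x' hx).2.1, (h.compat y y' hy).2.1]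

theorem IsBlockAlgebra.blockDiag_mem (h : IsBlockAlgebra P E Λ) {S : Matrix (Fin n) (Fin n) k}
    (hS : S ∈ Λ) : blockDiag P S ∈ Λ := by
  refine h.full _ (fun x y hxy => ?_) (fun x x' y y' hx hy hxy hxy' => ?_)
  · simp [blockDiag, hxy]
  · simp [blockDiag, hxy, hxy', h.diag S hS x x' y y' hx hy hxy hxy']

theorem placeUnit_mul (S : Matrix (Fin n) (Fin n) k) (a c : ℕ) (x y : Fin n) :
    (pl P x = a → ∀ z, P x z → pl P z = c → (placeUnit k P a c * S) x y = S z y) ∧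
    ((pl P x ≠ a ∨ cd P x ≤ c) → (placeUnit k P a c * S) x y = 0) := by
  rw [Matrix.mul_apply]
  constructor
  · intro hx z hz hzc
    rw [Finset.sum_eq_single z]
    · simp [placeUnit, hx, hz, hzc]
    · intro w _ hw
      have : ¬ (P x w ∧ pl P x = a ∧ pl P w = c) := fun h =>
        hw (pl_inj (P.trans (P.symm h.1) hz) (h.2.2.trans hzc.symm))
      simp [placeUnit, this]
    · simp
  · intro h
    refine Finset.sum_eq_zero fun w _ => ?_
    have : ¬ (P x w ∧ pl P x = a ∧ pl P w = c) := by
      rintro ⟨h1, h2, h3⟩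
      rcases h with h | h
      · exact h h2
      · rw [cd_eq h1, ← h3] at h
        exact (pl_lt_cd P w).not_ge h
    simp [placeUnit, this]

theorem mul_placeUnit (S : Matrix (Fin n) (Fin n) k) (a c : ℕ) (x y : Fin n) :
    (pl P y = c → ∀ z, P y z → pl P z = a → (S * placeUnit k P a c) x y = S x z) ∧
    ((pl P y ≠ c ∨ cd P y ≤ a) → (S * placeUnit k P a c) x y = 0) := by
  have hT : (S * placeUnit k P a c) x y = (placeUnit k P c a * S.transpose) y x := by
    simp only [Matrix.mul_apply, Matrix.transpose_apply]
    refine Finset.sum_congr rfl fun z _ => ?_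
    rw [mul_comm]
    congr 1
    simp only [placeUnit]
    congr 1
    exact propext ⟨fun h => ⟨P.symm h.1, h.2.2, h.2.1⟩, fun h => ⟨P.symm h.1, h.2.2, h.2.1⟩⟩
  rw [hT]
  exact placeUnit_mul S.transpose c a y x

/-- If `P` joined two indices separated by `P'`, a `placeUnit` for `P` would lie in `Λ` and have an
entry `1` below the diagonal blocks of `P'`. -/
theorem IsBlockAlgebra.le_of_le (h : IsBlockAlgebra P E Λ) (h' : IsBlockAlgebra P' E' Λ) :
    P ≤ P' := by
  have key : ∀ x y, P x y → y < x → P' x y := by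
    intro x y hxy hlt
    by_contra hn
    have := h'.tri _ (h.placeUnit_mem (pl P x) (pl P y)) x y hlt hn
    simp [placeUnit, hxy] at this
  intro x y hxy
  rcases lt_trichotomy x y with h1 | h1 | h1
  · exact P'.symm (key y x (P.symm hxy) h1)
  · exact h1 ▸ P'.refl x
  · exact key x y hxy h1

theorem IsBlockAlgebra.eq_partition (h : IsBlockAlgebra P E Λ) (h' : IsBlockAlgebra P' E' Λ) :
    P = P' :=
  le_antisymm (h.le_of_le h') (h'.le_of_le h)

theorem IsBlockAlgebra.rel_of_rel (h : IsBlockAlgebra P E Λ) (h' : IsBlockAlgebra P E' Λ)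
    {x y : Fin n} (hxy : E x y) : E' x y := by
  classical
  -- The diagonal idempotent of the `P`-classes that meet the `E'`-class of `x`. It is in `Λ` by the
  -- fullness in `h'`, while the ties in `h` force equal entries at `x` and `y`.
  let U : Matrix (Fin n) (Fin n) k := fun z w => if z = w ∧ ∃ v, P z v ∧ E' x v then 1 else 0
  have hU : U ∈ Λ := by
    refine h'.full U (fun z w hzw => ?_) (fun z z' w w' hz hw hzw hzw' => ?_)
    · have : z ≠ w := fun h => hzw (h ▸ P.refl z)
      simp [U, this]
    · have h1 : z = w ↔ z' = w' := by
        constructor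
        · rintro rfl
          exact pl_inj hzw' ((h'.compat _ _ hz).2.1.symm.trans (h'.compat _ _ hw).2.1)
        · rintro rfl
          exact pl_inj hzw ((h'.compat _ _ hz).2.1.trans (h'.compat _ _ hw).2.1.symm)
      have h2 : ∀ z z', E' z z' → (∃ v, P z v ∧ E' x v) → ∃ v, P z' v ∧ E' x v := by
        rintro z z' hz ⟨v, hv, hxv⟩
        obtain ⟨v', hv', -, hvv'⟩ := h'.compat.exists hz hv
        exact ⟨v', hv', E'.trans hxv hvv'⟩
      have h3 : (∃ v, P z v ∧ E' x v) ↔ ∃ v, P z' v ∧ E' x v :=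
        ⟨h2 z z' hz, h2 z' z (E'.symm hz)⟩
      simp only [U, h1, h3]
  have h1 := h.diag U hU x y x y hxy hxy (P.refl _) (P.refl _)
  have h2 : ∃ v, P x v ∧ E' x v := ⟨x, P.refl x, E'.refl x⟩
  simp only [U, h2, and_self, if_true] at h1
  have h3 : ∃ v, P y v ∧ E' x v := by
    by_contra hn
    simp [hn] at h1
  obtain ⟨v, hv, hxv⟩ := h3
  -- Both relations preserve the position inside a class, so the element `v` found in the class of
  -- `y` is `y` itself.
  have : y = v := pl_inj hv ((h.compat _ _ hxy).2.1.symm.trans (h'.compat _ _ hxv).2.1)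
  exact this ▸ hxv

theorem IsBlockAlgebra.eq_rel (h : IsBlockAlgebra P E Λ) (h' : IsBlockAlgebra P E' Λ) :
    E = E' :=
  Setoid.ext fun _ _ => ⟨h.rel_of_rel h', h'.rel_of_rel h⟩

/-! ### Reduced algebras as block triangular algebras -/

theorem place_eq_rk {t : ℕ} (b : Fin n → Fin t) (x : Fin n) :
    place b x = rk (strip b (b x)) x := by
  rw [place, rk, strip, Finset.filter_filter]

theorem mem_strip {t : ℕ} {b : Fin n → Fin t} {i : Fin t} {x : Fin n} :
    x ∈ strip b i ↔ b x = i := by simp [strip]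

theorem cls_ker {t : ℕ} (b : Fin n → Fin t) (x : Fin n) :
    cls (Setoid.ker b) x = strip b (b x) := by
  ext z
  simp [mem_strip, Setoid.ker_def, eq_comm]

theorem pl_ker {t : ℕ} (b : Fin n → Fin t) (x : Fin n) : pl (Setoid.ker b) x = place b x := by
  rw [pl, cls_ker, place_eq_rk]

/-- Indices with equal numbers in equivalent strips. -/
def placeRel {t : ℕ} (b : Fin n → Fin t) (rel : Setoid (Fin t)) : Setoid (Fin n) where
  r x y := rel (b x) (b y) ∧ place b x = place b y
  iseqv := ⟨fun _ => ⟨rel.refl _, rfl⟩, fun h => ⟨rel.symm h.1, h.2.symm⟩,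
    fun h h' => ⟨rel.trans h.1 h'.1, h.2.trans h'.2⟩⟩

theorem placeRel_iff {t : ℕ} {b : Fin n → Fin t} {rel : Setoid (Fin t)} {x y : Fin n} :
    placeRel b rel x y ↔ rel (b x) (b y) ∧ place b x = place b y := Iff.rfl

/-- The linear equations involve only blocks strictly above the diagonal, so block-diagonal matrices
satisfy them trivially; this gives `full`. -/
theorem IsReducedAlgebra.isBlockAlgebra {t : ℕ} {b : Fin n → Fin t} {rel : Setoid (Fin t)}
    (h : IsReducedAlgebra b rel Λ) : IsBlockAlgebra (Setoid.ker b) (placeRel b rel) Λ := by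
  obtain ⟨hb, hcard, e, c, hΛ⟩ := h
  have hcd : ∀ x, cd (Setoid.ker b) x = (strip b (b x)).card := fun x => by rw [cd, cls_ker]
  refine ⟨?_, ?_, ?_, ?_, ?_⟩
  · intro x y z hxy hyz hxz
    exact le_antisymm (hb hxy) ((hb hyz).trans_eq (Eq.symm hxz))
  · intro x y hxy
    refine ⟨by rw [hcd, hcd, hcard _ _ hxy.1], by rw [pl_ker, pl_ker, hxy.2], ?_⟩
    intro x' y' hx hy hp
    rw [pl_ker, pl_ker] at hp
    refine ⟨?_, hp⟩
    rw [← show b x = b x' from hx, ← show b y = b y' from hy]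
    exact hxy.1
  · intro S hS x y hxy hn
    exact ((hΛ S).1 hS).1 x y ((hb hxy.le).lt_of_ne fun h => hn (Eq.symm h))
  · intro S hS x x' y y' hx hy hxy hxy'
    have := ((hΛ S).1 hS).2.1 _ _ hx.1 (place b x) (place b y)
    have hxy : b x = b y := hxy
    have hxy' : b x' = b y' := hxy'
    rw [place_eq_rk b x, place_eq_rk b y, ← hxy,
      subEntry_rk S (mem_strip.2 rfl) (mem_strip.2 hxy.symm), hxy, ← place_eq_rk b y, hy.2, ← hxy,
      ← place_eq_rk b x, hx.2, place_eq_rk b x', place_eq_rk b y', ← hxy',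
      subEntry_rk S (mem_strip.2 rfl) (mem_strip.2 hxy'.symm)] at this
    exact this
  · intro S h1 h2
    refine (hΛ S).2 ⟨fun x y hxy => h1 x y fun h => hxy.ne (Eq.symm h), ?_, ?_⟩
    · intro i j hij a a'
      by_cases ha : a < (strip b i).card ∧ a' < (strip b i).card
      · obtain ⟨x, hx, rfl⟩ := exists_rk_eq ha.1
        obtain ⟨y, hy, rfl⟩ := exists_rk_eq ha.2
        rw [hcard i j hij] at ha
        obtain ⟨x', hx', hrx⟩ := exists_rk_eq ha.1
        obtain ⟨y', hy', hry⟩ := exists_rk_eq ha.2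
        rw [subEntry_rk S hx hy, ← hrx, ← hry, subEntry_rk S hx' hy']
        rw [mem_strip] at hx hy hx' hy'
        subst hx hx'
        refine h2 x x' y y' ⟨hij, ?_⟩ ⟨?_, ?_⟩ hy.symm hy'.symm
        · rw [place_eq_rk, place_eq_rk, hrx]
        · rw [hy, hy']; exact hij
        · rw [place_eq_rk, place_eq_rk, hy, hy', hry]
      · rw [subEntry_eq_zero S ha, subEntry_eq_zero S (by rwa [hcard i j hij] at ha)]
    · intro I J l a a'
      refine Finset.sum_eq_zero fun i _ => Finset.sum_eq_zero fun j _ => ?_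
      split_ifs with hij
      · by_cases ha : a < (strip b i).card ∧ a' < (strip b j).card
        · obtain ⟨x, hx, rfl⟩ := exists_rk_eq ha.1
          obtain ⟨y, hy, rfl⟩ := exists_rk_eq ha.2
          rw [subEntry_rk S hx hy, h1 x y, mul_zero]
          rw [mem_strip] at hx hy
          intro h
          have h : b x = b y := h
          rw [hx, hy] at h
          exact hij.2.2.ne h
        · rw [subEntry_eq_zero S ha, mul_zero]
      · rfl

end BlockAlgebra

end Belitskii

namespace Belitskii

/-! ### Strips, equations and idempotents of a block triangular algebra -/

section BlockAlgebraReduced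

variable {k : Type*} [Field k] {n : ℕ} {P E : Setoid (Fin n)}
  {Λ : Subalgebra k (Matrix (Fin n) (Fin n) k)}

theorem exists_first (P : Setoid (Fin n)) (x : Fin n) : ∃ y, P x y ∧ pl P y = 0 :=
  exists_pl_eq ((Nat.zero_le _).trans_lt (pl_lt_cd P x))

/-- The first element of the class of `x`. -/
noncomputable def first (P : Setoid (Fin n)) (x : Fin n) : Fin n := (exists_first P x).choose

theorem rel_first (P : Setoid (Fin n)) (x : Fin n) : P x (first P x) :=
  (exists_first P x).choose_spec.1

theorem pl_first (P : Setoid (Fin n)) (x : Fin n) : pl P (first P x) = 0 :=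
  (exists_first P x).choose_spec.2

theorem eq_first {x y : Fin n} (h : P x y) (hy : pl P y = 0) : first P x = y :=
  pl_inj (P.trans (P.symm (rel_first P x)) h) ((pl_first P x).trans hy.symm)

theorem first_eq_first_iff {x y : Fin n} : first P x = first P y ↔ P x y := by
  refine ⟨fun h => P.trans (rel_first P x) (h ▸ P.symm (rel_first P y)), fun h => ?_⟩
  exact eq_first (P.trans h (rel_first P y)) (pl_first P y)

theorem ker_first : Setoid.ker (first P) = P := by
  ext x y
  rw [Setoid.ker_def, first_eq_first_iff]

theorem Convex.monotone_first (hP : Convex P) : Monotone (first P) := by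
  intro x y hxy
  by_cases h : P x y
  · exact (first_eq_first_iff.2 h).le
  · exact (hP.lt_of_lt h (hxy.lt_of_ne fun e => h (e ▸ P.refl x)) (rel_first P x)
      (rel_first P y)).le

/-- The map `first P` numbers strips by all of `Fin n`: the number of a first element carries its
class, every other number carries an empty strip. -/
theorem strip_first_of_pl {i : Fin n} (hi : pl P i = 0) : strip (first P) i = cls P i := by
  ext z
  rw [mem_strip, mem_cls]
  refine ⟨fun h => h ▸ P.symm (rel_first P z), fun h => eq_first (P.symm h) hi⟩

theorem strip_first_of_ne {i : Fin n} (hi : pl P i ≠ 0) : strip (first P) i = ∅ := by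
  ext z
  simp only [mem_strip, Finset.notMem_empty, iff_false]
  rintro rfl
  exact hi (pl_first P z)

/-- The equivalence of the strips of `first P` that corresponds to `E`. -/
def firstRel (P E : Setoid (Fin n)) (h : ∀ x y, E x y → pl P x = pl P y) : Setoid (Fin n) where
  r i j := i = j ∨ pl P i = 0 ∧ E i j
  iseqv := by
    refine ⟨fun _ => Or.inl rfl, ?_, ?_⟩
    · rintro i j (rfl | ⟨h1, h2⟩)
      · exact Or.inl rfl
      · exact Or.inr ⟨by rw [← h _ _ h2, h1], E.symm h2⟩
    · rintro i j l (rfl | ⟨h1, h2⟩) (rfl | ⟨h3, h4⟩)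
      · exact Or.inl rfl
      · exact Or.inr ⟨h3, h4⟩
      · exact Or.inr ⟨h1, h2⟩
      · exact Or.inr ⟨h1, E.trans h2 h4⟩

/-- The equations are the coordinates of the image of `v` in the quotient by `V`. -/
theorem exists_equations {ι : Type*} [Fintype ι] (V : Submodule k (ι → k)) :
    ∃ (N : ℕ) (c : Fin N → ι → k), ∀ v, v ∈ V ↔ ∀ l, ∑ p, c l p * v p = 0 := by
  classical
  let e := (Module.finBasis k ((ι → k) ⧸ V)).equivFun
  refine ⟨_, fun l p => e (V.mkQ (Pi.single p 1)) l, fun v => ?_⟩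
  have h : ∀ l, ∑ p, e (V.mkQ (Pi.single p 1)) l * v p = e (V.mkQ v) l := by
    intro l
    conv_rhs => rw [← Finset.univ_sum_single v]
    rw [map_sum, map_sum, Finset.sum_apply]
    refine Finset.sum_congr rfl fun p _ => ?_
    have : (Pi.single p (v p) : ι → k) = v p • Pi.single p 1 := by
      rw [← Pi.single_smul, smul_eq_mul, mul_one]
    rw [this, map_smul, map_smul, Pi.smul_apply, smul_eq_mul, mul_comm]
  simp only [h]
  rw [← Submodule.Quotient.mk_eq_zero, ← Submodule.mkQ_apply, ← e.map_eq_zero_iff]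
  exact ⟨fun h l => by rw [h]; rfl, fun h => funext h⟩

theorem subEntry_first (S : Matrix (Fin n) (Fin n) k) (x y : Fin n) :
    subEntry S (strip (first P) (first P x)) (strip (first P) (first P y)) (pl P x) (pl P y) =
      S x y := by
  rw [strip_first_of_pl (pl_first P x), strip_first_of_pl (pl_first P y),
    ← cls_eq (rel_first P x), ← cls_eq (rel_first P y)]
  exact subEntry_rk S (mem_cls.2 (P.refl x)) (mem_cls.2 (P.refl y))

/-- Multiplication inside the algebra moves position `(a, c)` of every block to its first position.
This is why one system of equations serves all positions. -/
theorem placeUnit_mul_mul_placeUnit (S : Matrix (Fin n) (Fin n) k) (a c : ℕ) {i j : Fin n}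
    (hi : pl P i = 0) (hj : pl P j = 0) :
    (placeUnit k P 0 a * S * placeUnit k P c 0) i j =
      subEntry S (strip (first P) i) (strip (first P) j) a c := by
  rw [strip_first_of_pl hi, strip_first_of_pl hj]
  by_cases hc : c < cd P j
  · obtain ⟨w, hw, hwc⟩ := exists_pl_eq hc
    rw [(mul_placeUnit _ c 0 i j).1 hj w hw hwc]
    by_cases ha : a < cd P i
    · obtain ⟨z, hz, hza⟩ := exists_pl_eq ha
      rw [(placeUnit_mul _ 0 a i w).1 hi z hz hza, ← hza, ← hwc, pl_eq_rk hz, pl_eq_rk hw,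
        subEntry_rk S (mem_cls.2 hz) (mem_cls.2 hw)]
    · rw [(placeUnit_mul _ 0 a i w).2 (Or.inr (not_lt.1 ha)), subEntry_eq_zero S fun h => ha h.1]
  · rw [(mul_placeUnit _ c 0 i j).2 (Or.inr (not_lt.1 hc)), subEntry_eq_zero S fun h => hc h.2]

/-- The idempotent of a class of entries. -/
noncomputable def relUnit (k : Type*) [Field k] (E : Setoid (Fin n)) (I : Quotient E) :
    Matrix (Fin n) (Fin n) k :=
  open Classical in Matrix.diagonal fun x => if Quotient.mk E x = I then 1 else 0

theorem relUnit_mul_mul_relUnit (S : Matrix (Fin n) (Fin n) k) (I J : Quotient E) (x y : Fin n)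
    [Decidable (Quotient.mk E x = I ∧ Quotient.mk E y = J)] :
    (relUnit k E I * S * relUnit k E J) x y =
      if Quotient.mk E x = I ∧ Quotient.mk E y = J then S x y else 0 := by
  classical
  rw [relUnit, relUnit, Matrix.mul_diagonal, Matrix.diagonal_mul]
  by_cases h1 : Quotient.mk E x = I <;> by_cases h2 : Quotient.mk E y = J <;> simp [h1, h2]

open Classical in
theorem sum_relUnit : ∑ I : Quotient E, relUnit k E I = 1 := by
  ext x y
  rw [Matrix.sum_apply]
  by_cases h : x = y
  · subst h
    simp [relUnit]
  · simp [relUnit, h]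

theorem IsBlockAlgebra.relUnit_mem (h : IsBlockAlgebra P E Λ) (I : Quotient E) :
    relUnit k E I ∈ Λ := by
  classical
  refine h.full _ (fun x y hxy => ?_) (fun x x' y y' hx hy hxy hxy' => ?_)
  · have : x ≠ y := fun h => hxy (h ▸ P.refl x)
    simp [relUnit, this]
  · have h1 : x = y ↔ x' = y' := by
      constructor
      · rintro rfl
        exact pl_inj hxy' ((h.compat _ _ hx).2.1.symm.trans (h.compat _ _ hy).2.1)
      · rintro rfl
        exact pl_inj hxy ((h.compat _ _ hx).2.1.trans (h.compat _ _ hy).2.1.symm)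
    have h2 : Quotient.mk E x = Quotient.mk E x' := Quotient.sound hx
    simp only [relUnit, Matrix.diagonal_apply, h1, h2]

open Classical in
-- The Peirce decomposition for the idempotents `relUnit k E I`, whose sum is `1`.
theorem mem_of_relUnit (S : Matrix (Fin n) (Fin n) k)
    (h : ∀ I J, relUnit k E I * S * relUnit k E J ∈ Λ) : S ∈ Λ := by
  have : S = ∑ J : Quotient E, ∑ I : Quotient E, relUnit k E I * S * relUnit k E J := by
    simp_rw [← Finset.sum_mul, ← Finset.mul_sum, sum_relUnit, one_mul, mul_one]
  rw [this]
  exact Subalgebra.sum_mem _ fun J _ => Subalgebra.sum_mem _ fun I _ => h I J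

end BlockAlgebraReduced

end Belitskii

namespace Belitskii

/-! ### Block triangular algebras are reduced -/

section ReducedOfBlock

variable {k : Type*} [Field k] {n : ℕ} {P E : Setoid (Fin n)}
  {Λ : Subalgebra k (Matrix (Fin n) (Fin n) k)}

theorem subEntry_add (S T : Matrix (Fin n) (Fin n) k) (X Y : Finset (Fin n)) (a c : ℕ) :
    subEntry (S + T) X Y a c = subEntry S X Y a c + subEntry T X Y a c := by
  unfold subEntry
  split_ifs
  · rfl
  · rw [add_zero]

theorem subEntry_smul (r : k) (S : Matrix (Fin n) (Fin n) k) (X Y : Finset (Fin n)) (a c : ℕ) :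
    subEntry (r • S) X Y a c = r * subEntry S X Y a c := by
  unfold subEntry
  split_ifs
  · rfl
  · rw [mul_zero]

open Classical in
/-- The entries of `S` at the place `(a, c)` of the blocks above the diagonal whose numbers belong
to the classes `I` and `J`. -/
noncomputable def upperEntries {t : ℕ} (b : Fin n → Fin t) {rel : Setoid (Fin t)}
    (I J : Quotient rel) (a c : ℕ) :
    Matrix (Fin n) (Fin n) k →ₗ[k] (Fin t × Fin t → k) where
  toFun S p := if Quotient.mk rel p.1 = I ∧ Quotient.mk rel p.2 = J ∧ p.1 < p.2 then
    subEntry S (strip b p.1) (strip b p.2) a c else 0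
  map_add' S T := by
    ext p
    simp only [subEntry_add, Pi.add_apply]
    split_ifs <;> simp
  map_smul' r S := by
    ext p
    simp only [subEntry_smul, Pi.smul_apply, RingHom.id_apply, smul_eq_mul]
    split_ifs <;> simp

theorem subEntry_first_zero (S : Matrix (Fin n) (Fin n) k) {i j : Fin n} (hi : pl P i = 0)
    (hj : pl P j = 0) : subEntry S (strip (first P) i) (strip (first P) j) 0 0 = S i j := by
  have := subEntry_first (P := P) S i j
  rwa [eq_first (P.refl i) hi, eq_first (P.refl j) hj, hi, hj] at this

/-- The equations for two classes cut out the space of vectors of first entries of the upper blocks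
of members of `Λ`; `placeUnit` transports them to all positions. Conversely, a matrix obeying all
requirements is the sum of its block-diagonal part, in `Λ` by fullness, and an upper part whose
Peirce components are rebuilt from members of `Λ`. -/
theorem IsBlockAlgebra.isReducedAlgebra (h : IsBlockAlgebra P E Λ) :
    IsReducedAlgebra (first P) (firstRel P E fun x y hxy => (h.compat x y hxy).2.1) Λ := by
  classical
  set rel := firstRel P E fun x y hxy => (h.compat x y hxy).2.1 with hrel
  have hcard : ∀ i j, rel i j → (strip (first P) i).card = (strip (first P) j).card := by
    rintro i j (rfl | ⟨hi, hij⟩)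
    · rfl
    · rw [strip_first_of_pl hi, strip_first_of_pl ((h.compat i j hij).2.1 ▸ hi)]
      exact (h.compat i j hij).1
  refine ⟨h.convex.monotone_first, hcard, ?_⟩
  have hV := fun I J : Quotient rel => exists_equations
    (Submodule.map (upperEntries (k := k) (first P) I J 0 0) (Subalgebra.toSubmodule Λ))
  choose N c hc using hV
  refine ⟨N, fun I J l i j => c I J l (i, j), fun S => ?_⟩
  have heq : ∀ (I J : Quotient rel) (a a' : ℕ),
      (upperEntries (first P) I J a a' S ∈
        Submodule.map (upperEntries (k := k) (first P) I J 0 0) (Subalgebra.toSubmodule Λ)) ↔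
      ∀ l, ∑ i : Fin n, ∑ j : Fin n,
          (if Quotient.mk rel i = I ∧ Quotient.mk rel j = J ∧ i < j then
            c I J l (i, j) * subEntry S (strip (first P) i) (strip (first P) j) a a' else 0) = 0 := by
    intro I J a a'
    rw [hc]
    refine forall_congr' fun l => ?_
    rw [Fintype.sum_prod_type]
    simp only [upperEntries, LinearMap.coe_mk, AddHom.coe_mk, mul_ite, mul_zero]
  have hrelE : ∀ x y, E x y → rel (first P x) (first P y) := by
    intro x y hxy
    refine Or.inr ⟨pl_first P x, ?_⟩
    exact (h.compat x y hxy).2.2 _ _ (rel_first P x) (rel_first P y)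
      ((pl_first P x).trans (pl_first P y).symm)
  constructor
  · intro hS
    refine ⟨fun x y hxy => ?_, fun i j hij a a' => ?_, fun I J l a a' => ?_⟩
    · refine h.tri S hS x y ?_ fun hn => hxy.ne' (first_eq_first_iff.2 hn)
      by_contra hle
      exact hxy.not_ge (h.convex.monotone_first (not_lt.1 hle))
    · rcases hij with rfl | ⟨hi, hij⟩
      · rfl
      · have hj : pl P j = 0 := (h.compat i j hij).2.1 ▸ hi
        rw [← placeUnit_mul_mul_placeUnit S a a' hi hi, ← placeUnit_mul_mul_placeUnit S a a' hj hj]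
        refine h.diag _ ?_ i j i j hij hij (P.refl _) (P.refl _)
        exact mul_mem (mul_mem (h.placeUnit_mem _ _) hS) (h.placeUnit_mem _ _)
    · convert (heq I J a a').1 ?_ l
      refine ⟨placeUnit k P 0 a * S * placeUnit k P a' 0, ?_, ?_⟩
      · exact Λ.mul_mem (Λ.mul_mem (h.placeUnit_mem _ _) hS) (h.placeUnit_mem _ _)
      · ext p
        simp only [upperEntries, LinearMap.coe_mk, AddHom.coe_mk]
        split_ifs with hp
        · by_cases h1 : pl P p.1 = 0 ∧ pl P p.2 = 0
          · rw [subEntry_first_zero _ h1.1 h1.2, placeUnit_mul_mul_placeUnit S a a' h1.1 h1.2]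
          -- One of the two strips is empty, so both sides are the default value `0`.
          · have h2 : ∀ r s : ℕ, ¬ (r < (strip (first P) p.1).card ∧
                s < (strip (first P) p.2).card) := by
              intro r s hrs
              apply h1
              constructor
              · by_contra hne
                rw [strip_first_of_ne hne] at hrs
                simp at hrs
              · by_contra hne
                rw [strip_first_of_ne hne] at hrs
                simp at hrs
            rw [subEntry_eq_zero _ (h2 _ _), subEntry_eq_zero _ (h2 _ _)]
        · rfl
  · rintro ⟨h1, h2, h3⟩
    have hD : blockDiag P S ∈ Λ := by
      refine h.full _ (fun x y hxy => ?_) (fun x x' y y' hx hy hxy hxy' => ?_)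
      · simp [blockDiag, hxy]
      · simp only [blockDiag, hxy, hxy', if_true]
        have := h2 _ _ (hrelE x x' hx) (pl P x) (pl P y)
        rw [first_eq_first_iff.2 hxy, ← first_eq_first_iff.2 hxy] at this
        have e1 := subEntry_first (P := P) S x y
        have e2 := subEntry_first (P := P) S x' y'
        rw [← first_eq_first_iff.2 hxy] at e1
        rw [← first_eq_first_iff.2 hxy', ← (h.compat _ _ hx).2.1, ← (h.compat _ _ hy).2.1] at e2
        rw [← e1, ← e2]
        exact this
    have hR : S - blockDiag P S ∈ Λ := by
      apply mem_of_relUnit (E := E)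
      intro α β
      obtain ⟨x₀, rfl⟩ := Quotient.exists_rep α
      obtain ⟨y₀, rfl⟩ := Quotient.exists_rep β
      -- In the upper blocks of this pair of classes, the first entries of `T` are the entries of
      -- `S` at the positions of `x₀` and `y₀`.
      obtain ⟨T, hT, hTe⟩ := (heq (Quotient.mk rel (first P x₀)) (Quotient.mk rel (first P y₀))
        (pl P x₀) (pl P y₀)).2 (fun l => by convert h3 _ _ l _ _)
      have hT' : T - blockDiag P T ∈ Λ := sub_mem hT (h.blockDiag_mem hT)
      have : relUnit k E (Quotient.mk E x₀) * (S - blockDiag P S) * relUnit k E (Quotient.mk E y₀) =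
          relUnit k E (Quotient.mk E x₀) * (placeUnit k P (pl P x₀) 0 * (T - blockDiag P T) *
            placeUnit k P 0 (pl P y₀)) * relUnit k E (Quotient.mk E y₀) := by
        ext x y
        rw [relUnit_mul_mul_relUnit, relUnit_mul_mul_relUnit]
        split_ifs with hxy
        · have hx : E x x₀ := Quotient.exact hxy.1
          have hy : E y y₀ := Quotient.exact hxy.2
          have hpx := (h.compat _ _ hx).2.1
          have hpy := (h.compat _ _ hy).2.1
          rw [(mul_placeUnit _ _ _ _ _).1 hpy _ (rel_first P y) (pl_first P y),
            (placeUnit_mul _ _ _ _ _).1 hpx _ (rel_first P x) (pl_first P x)]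
          by_cases hP : P x y
          · have hP' : P (first P x) (first P y) :=
              P.trans (P.symm (rel_first P x)) (P.trans hP (rel_first P y))
            simp [blockDiag, hP, hP']
          · have hP' : ¬ P (first P x) (first P y) := fun hn =>
              hP (P.trans (rel_first P x) (P.trans hn (P.symm (rel_first P y))))
            have hne : x ≠ y := fun e => hP (e ▸ P.refl x)
            simp only [Matrix.sub_apply, blockDiag, hP, hP', if_false, sub_zero]
            rcases lt_or_gt_of_ne hne with hlt | hlt
            · have hlt' := h.convex.lt_of_lt hP hlt (rel_first P x) (rel_first P y)
              have hTe' := congrFun hTe (first P x, first P y)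
              have hc1 : Quotient.mk rel (first P x) = Quotient.mk rel (first P x₀) :=
                Quotient.sound (hrelE _ _ hx)
              have hc2 : Quotient.mk rel (first P y) = Quotient.mk rel (first P y₀) :=
                Quotient.sound (hrelE _ _ hy)
              simp only [upperEntries, LinearMap.coe_mk, AddHom.coe_mk, hc1, hc2, hlt', and_self,
                if_true] at hTe'
              rw [← hpx, ← hpy, subEntry_first,
                subEntry_first_zero T (pl_first P x) (pl_first P y)] at hTe'
              exact hTe'.symm
            · rw [h.tri T hT _ _ (h.convex.lt_of_lt (fun e => hP (P.symm e)) hlt (rel_first P y)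
                (rel_first P x)) hP', h1 x y]
              exact (h.convex.monotone_first hlt.le).lt_of_ne fun e =>
                hP (P.symm (first_eq_first_iff.1 e))
        · rfl
      rw [this]
      exact mul_mem (mul_mem (h.relUnit_mem _) (mul_mem (mul_mem (h.placeUnit_mem _ _) hT')
        (h.placeUnit_mem _ _))) (h.relUnit_mem _)
    have : S = (S - blockDiag P S) + blockDiag P S := by abel
    rw [this]
    exact add_mem hR hD

end ReducedOfBlock

end Belitskii

namespace Belitskii

/-! ### Rectangular parts and cells -/

section Parts

variable {k : Type*} {n m : ℕ}

theorem Part.has_iff {B : Part n} {x y : Fin n} :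
    B.Has x y ↔ (B.top ≤ x ∧ x ≤ B.bottom) ∧ B.left ≤ y ∧ y ≤ B.right := by
  simp [Part.Has, Part.rows, Part.cols]

theorem Part.has_bottom {B : Part n} {x y : Fin n} (h : B.Has x y) : B.Has B.bottom y := by
  rw [Part.has_iff] at *
  exact ⟨⟨B.top_le, le_rfl⟩, h.2⟩

theorem Part.has_top_left (B : Part n) : B.Has B.top B.left :=
  Part.has_iff.2 ⟨⟨le_rfl, B.top_le⟩, le_rfl, B.left_le⟩

theorem Part.has_bottom_left (B : Part n) : B.Has B.bottom B.left :=
  Part.has_bottom B.has_top_left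

theorem Part.has_bottom_right (B : Part n) : B.Has B.bottom B.right :=
  Part.has_iff.2 ⟨⟨B.top_le, le_rfl⟩, B.left_le, le_rfl⟩

theorem Part.eq_of_has {B B' : Part n} (h : ∀ x y, B.Has x y ↔ B'.Has x y) : B = B' := by
  have h1 := Part.has_iff.1 ((h _ _).1 B.has_top_left)
  have h2 := Part.has_iff.1 ((h _ _).2 B'.has_top_left)
  have h3 := Part.has_iff.1 ((h _ _).1 B.has_bottom_right)
  have h4 := Part.has_iff.1 ((h _ _).2 B'.has_bottom_right)
  ext1
  · exact le_antisymm h2.1.1 h1.1.1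
  · exact le_antisymm h3.1.2 h4.1.2
  · exact le_antisymm h2.2.1 h1.2.1
  · exact le_antisymm h3.2.2 h4.2.2

theorem Part.of_eq_iff {B : Part n} {M N : Matrix (Fin n) (Fin n) k} :
    B.of M = B.of N ↔ ∀ x y, B.Has x y → M x y = N x y := by
  rw [Part.of, Part.of, sub_eq_iff]
  exact ⟨fun h x y hxy => h x hxy.1 y hxy.2, fun h x hx y hy => h x y ⟨hx, hy⟩⟩

theorem Part.of_eq_zero_iff [Zero k] {B : Part n} {M : Matrix (Fin n) (Fin n) k} :
    B.of M = 0 ↔ ∀ x y, B.Has x y → M x y = 0 :=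
  Part.of_eq_iff (N := 0)

variable {parts : Fin m → Part n}

theorem index_lt_of_bottom_lt (ho : ∀ p q, p < q → (parts p).Before (parts q)) {p q : Fin m}
    {z w : Fin n} (h : (parts p).Has z w) (hz : (parts q).bottom < z) : p < q := by
  have hz' := hz.trans_le (Part.has_iff.1 h).1.2
  by_contra hpq
  rcases (not_lt.1 hpq).eq_or_lt with rfl | hlt
  · exact lt_irrefl _ hz'
  · rcases ho q p hlt with h' | h'
    · exact hz'.ne h'.1
    · exact lt_asymm hz' h'

theorem index_lt_of_lt_left (ho : ∀ p q, p < q → (parts p).Before (parts q)) {p q : Fin m}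
    {w : Fin n} (h : (parts p).Has (parts q).bottom w) (hw : w < (parts q).left) : p < q := by
  have hw' := (Part.has_iff.1 h).2.1.trans_lt hw
  have hb := (Part.has_iff.1 h).1.2
  by_contra hpq
  rcases (not_lt.1 hpq).eq_or_lt with rfl | hlt
  · exact lt_irrefl _ hw'
  · rcases ho q p hlt with h' | h'
    · exact lt_asymm hw' h'.2
    · exact h'.not_ge hb

/-- The part `B` is a union of blocks of the partition `P`. -/
def Part.Saturated (B : Part n) (P : Setoid (Fin n)) : Prop :=
  ∀ x y x' y', B.Has x y → P x x' → P y y' → B.Has x' y'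

/-- The part `B` is a block of the partition `P`. -/
def Part.IsCell (B : Part n) (P : Setoid (Fin n)) : Prop :=
  ∃ u v, ∀ x y, B.Has x y ↔ P u x ∧ P v y

theorem Part.Saturated.mono {B : Part n} {P P' : Setoid (Fin n)} (h : B.Saturated P)
    (hle : P' ≤ P) : B.Saturated P' := fun x y x' y' hB hx hy => h x y x' y' hB (hle hx) (hle hy)

theorem Part.IsCell.saturated {B : Part n} {P : Setoid (Fin n)} (h : B.IsCell P) :
    B.Saturated P := by
  obtain ⟨u, v, h⟩ := h
  intro x y x' y' hB hx hy
  rw [h] at *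
  exact ⟨P.trans hB.1 hx, P.trans hB.2 hy⟩

theorem Part.IsCell.has_iff {B : Part n} {P : Setoid (Fin n)} (h : B.IsCell P) {x y : Fin n}
    (hxy : B.Has x y) (z w : Fin n) : B.Has z w ↔ P x z ∧ P y w := by
  obtain ⟨u, v, h⟩ := h
  rw [h] at *
  exact ⟨fun h' => ⟨P.trans (P.symm hxy.1) h'.1, P.trans (P.symm hxy.2) h'.2⟩,
    fun h' => ⟨P.trans hxy.1 h'.1, P.trans hxy.2 h'.2⟩⟩

theorem cellSide_rows {B : Part n} {P : Setoid (Fin n)} (h : B.Saturated P) {x y : Fin n}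
    (hB : B.Has x y) : cellSide P B.rows x = cls P x := by
  ext z
  simp only [cellSide, Finset.mem_filter, mem_cls, and_iff_right_iff_imp]
  exact fun hz => (h x y z y hB hz (P.refl y)).1

theorem cellSide_cols {B : Part n} {P : Setoid (Fin n)} (h : B.Saturated P) {x y : Fin n}
    (hB : B.Has x y) : cellSide P B.cols y = cls P y := by
  ext z
  simp only [cellSide, Finset.mem_filter, mem_cls, and_iff_right_iff_imp]
  exact fun hz => (h x y x z hB (P.refl x) hz).2

variable [Zero k]

/-- The block of `M` at the place `(x, y)` of the partition `P` is the scalar matrix `λ I`. -/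
def ScalarBlock (M : Matrix (Fin n) (Fin n) k) (P : Setoid (Fin n)) (lam : k) (x y : Fin n) :
    Prop :=
  cd P x = cd P y ∧ ∀ z w, P x z → P y w → M z w = if pl P z = pl P w then lam else 0

theorem isScalarMatrix_cell_iff {B : Part n} {P : Setoid (Fin n)} (h : B.Saturated P)
    {M : Matrix (Fin n) (Fin n) k} {lam : k} {x y : Fin n} (hB : B.Has x y) :
    IsScalarMatrix lam (cell M B P x y) ↔ ScalarBlock M P lam x y := by
  rw [cell, isScalarMatrix_sub_iff, cellSide_rows h hB, cellSide_cols h hB]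
  refine and_congr_right fun _ => ⟨fun H z w hz hw => ?_, fun H z hz w hw => ?_⟩
  · rw [pl_eq_rk hz, pl_eq_rk hw]
    exact H z (mem_cls.2 hz) w (mem_cls.2 hw)
  · rw [mem_cls] at hz hw
    rw [← pl_eq_rk hz, ← pl_eq_rk hw]
    exact H z w hz hw

/-- The block of `M` at the place `(x, y)` of the partition `P` is zero or scalar. -/
def GoodBlock (M : Matrix (Fin n) (Fin n) k) (P : Setoid (Fin n)) (x y : Fin n) : Prop :=
  (∀ z w, P x z → P y w → M z w = 0) ∨ ∃ lam, ScalarBlock M P lam x y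

theorem cell_good_iff {B : Part n} {P : Setoid (Fin n)} (h : B.Saturated P)
    {M : Matrix (Fin n) (Fin n) k} {x y : Fin n} (hB : B.Has x y) :
    (cell M B P x y = 0 ∨ ∃ lam, IsScalarMatrix lam (cell M B P x y)) ↔ GoodBlock M P x y := by
  refine or_congr ?_ (exists_congr fun lam => isScalarMatrix_cell_iff h hB)
  rw [cell, sub_eq_zero_iff, cellSide_rows h hB, cellSide_cols h hB]
  simp only [mem_cls]
  exact ⟨fun H z w hz hw => H z hz w hw, fun H z hz w hw => H z w hz hw⟩

theorem GoodBlock.scalar {P : Setoid (Fin n)} {M : Matrix (Fin n) (Fin n) k} {x y : Fin n}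
    (h : GoodBlock M P x y) (hne : M x y ≠ 0) : pl P x = pl P y ∧ ScalarBlock M P (M x y) x y := by
  rcases h with h | ⟨lam, h1, h2⟩
  · exact absurd (h x y (P.refl x) (P.refl y)) hne
  · have := h2 x y (P.refl x) (P.refl y)
    split_ifs at this with hp
    · exact ⟨hp, this ▸ ⟨h1, h2⟩⟩
    · exact absurd this hne

end Parts

/-! ### Commutation with zero and scalar cells -/

section Compat

variable {k : Type*} [Field k] {n : ℕ} {P : Setoid (Fin n)} {M : Matrix (Fin n) (Fin n) k}

theorem compat_ones {B : Part n} (hs : B.Saturated P) (hg : ∀ x y, B.Has x y → GoodBlock M P x y) :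
    Compat P fun x y => B.Has x y ∧ M x y = 1 := by
  rintro x y ⟨hB, hM⟩
  obtain ⟨hp, h1, h2⟩ := (hg x y hB).scalar (by rw [hM]; exact one_ne_zero)
  refine ⟨h1, hp, fun x' y' hx hy hp' => ⟨hs _ _ _ _ hB hx hy, ?_⟩⟩
  rw [h2 x' y' hx hy, if_pos hp', hM]

/-- On a cell `λ I` each product has one surviving term: `λ` times an entry of the diagonal block of
`S` on the row side, respectively on the column side. The hypothesis `hSM` identifies the two
entries. -/
theorem comm_of_goodBlock {B : Part n} (hg : ∀ x y, B.Has x y → GoodBlock M P x y)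
    (hs : B.Saturated P) {S : Matrix (Fin n) (Fin n) k} (hS : ∀ x y, ¬ P x y → S x y = 0)
    (hSM : ∀ x x' y y', B.Has x x' → B.Has y y' → M x x' ≠ 0 → M y y' ≠ 0 →
      pl P x = pl P x' → pl P y = pl P y' → P x y → P x' y' → S x y = S x' y') {x y : Fin n}
    (hB : B.Has x y) :
    (S * M) x y = (M * S) x y := by
  rw [Matrix.mul_apply, Matrix.mul_apply]
  have zero : (∀ z w, P x z → P y w → M z w = 0) →
      ∑ z, S x z * M z y = ∑ z, M x z * S z y := by
    intro h
    rw [Finset.sum_eq_zero, Finset.sum_eq_zero]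
    · intro z _
      by_cases hz : P z y
      · rw [h x z (P.refl x) (P.symm hz), zero_mul]
      · rw [hS z y hz, mul_zero]
    · intro z _
      by_cases hz : P x z
      · rw [h z y hz (P.refl y), mul_zero]
      · rw [hS x z hz, zero_mul]
  rcases hg x y hB with h | ⟨lam, h1, h2⟩
  · exact zero h
  · by_cases hlam : lam = 0
    · exact zero fun z w hz hw => by rw [h2 z w hz hw, hlam, ite_self]
    -- The row `z` meets the column `y`, and the column `w` meets the row `x`, on the diagonal of
    -- the cell.
    · obtain ⟨z, hz, hzy⟩ := exists_pl_eq (P := P) (x := x) (a := pl P y) (h1 ▸ pl_lt_cd P y)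
      obtain ⟨w, hw, hwx⟩ := exists_pl_eq (P := P) (x := y) (a := pl P x) (h1 ▸ pl_lt_cd P x)
      have hMz : M z y = lam := by rw [h2 z y hz (P.refl y), if_pos hzy]
      have hMw : M x w = lam := by rw [h2 x w (P.refl x) hw, if_pos hwx.symm]
      rw [Finset.sum_eq_single z, Finset.sum_eq_single w, hMz, hMw, mul_comm,
        hSM x w z y (hs x y x w hB (P.refl x) hw) (hs x y z y hB hz (P.refl y))
          (by rwa [hMw]) (by rwa [hMz]) hwx.symm hzy hz (P.symm hw)]
      · intro v _ hv
        by_cases hPv : P y v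
        · rw [h2 x v (P.refl x) hPv, if_neg, zero_mul]
          exact fun h => hv (pl_inj (P.trans (P.symm hPv) hw) (h.symm.trans hwx.symm))
        · rw [hS v y fun h => hPv (P.symm h), mul_zero]
      · simp
      · intro v _ hv
        by_cases hPv : P x v
        · rw [h2 v y hPv (P.refl y), if_neg, mul_zero]
          exact fun h => hv (pl_inj (P.trans (P.symm hPv) hz) (h.trans hzy.symm))
        · rw [hS x v hPv, zero_mul]
      · simp

/-- Left multiplication by `T` is injective on the finite-dimensional space `Λ`, hence surjective,
so `1` is attained. -/
theorem inv_mem_of_isUnit {Λ : Subalgebra k (Matrix (Fin n) (Fin n) k)}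
    {T : Matrix (Fin n) (Fin n) k} (hT : T ∈ Λ) (hu : IsUnit T) : T⁻¹ ∈ Λ := by
  have hdet := (Matrix.isUnit_iff_isUnit_det T).1 hu
  let f : Λ →ₗ[k] Λ := LinearMap.mulLeft k (⟨T, hT⟩ : Λ)
  have hf : Function.Injective f := by
    intro A B hAB
    have : T * A = T * B := congrArg Subtype.val hAB
    exact Subtype.ext (hu.mul_left_cancel this)
  obtain ⟨S, hS⟩ := LinearMap.injective_iff_surjective.1 hf 1
  have hS' : T * S = 1 := congrArg Subtype.val hS
  rw [Matrix.inv_eq_right_inv hS']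
  exact S.2

end Compat

end Belitskii

namespace Belitskii

/-! ### Stages of the reduction -/

section Stage

variable {k : Type*} [Field k] {n t m : ℕ} {b : Fin n → Fin t} {rel : Setoid (Fin t)}
  {Λ Λ' : Subalgebra k (Matrix (Fin n) (Fin n) k)} {M : Matrix (Fin n) (Fin n) k}
  {parts : Fin m → Part n} {q : ℕ} {P P' : Setoid (Fin n)}

/-- The version of `IsSubdivision` for the first `q` parts, where `q ≤ m`. -/
structure IsSubdivisionBelow (b : Fin n → Fin t) (rel : Setoid (Fin t))
    (M : Matrix (Fin n) (Fin n) k) (parts : Fin m → Part n) (q : ℕ) (P : Setoid (Fin n)) :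
    Prop where
  convex : Convex P
  refines : ∀ x y, P x y → b x = b y
  alike : ∀ x x' y y', b x = b x' → b y = b y' → placeRel b rel x y → placeRel b rel x' y' →
    (P x x' ↔ P y y')
  cells : ∀ p : Fin m, p.val < q → ∀ x y, (parts p).Has x y →
    cell M (parts p) P x y = 0 ∨ ∃ lam : k, IsScalarMatrix lam (cell M (parts p) P x y)

theorem isSubdivision_iff {q : Fin m} :
    IsSubdivision b rel M parts q P ↔ IsSubdivisionBelow b rel M parts q.val P := by
  constructor
  · rintro ⟨h1, h2, h3, h4⟩
    exact ⟨h1, h2, fun x x' y y' hx hy h h' => h3 x x' y y' hx hy h.1 h.2 h'.2, h4⟩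
  · rintro ⟨h1, h2, h3, h4⟩
    exact ⟨h1, h2, fun x x' y y' hx hy h h' h'' =>
      h3 x x' y y' hx hy ⟨h, h'⟩ ⟨hx ▸ hy ▸ h, h''⟩, h4⟩

theorem IsSubdivisionBelow.mono (h : IsSubdivisionBelow b rel M parts q P) {q' : ℕ}
    (hq : q' ≤ q) : IsSubdivisionBelow b rel M parts q' P :=
  ⟨h.convex, h.refines, h.alike, fun p hp => h.cells p (hp.trans_le hq)⟩

/-- Pairs of indices related directly: they have the same number in equivalent strips, or meet in
an entry `1` of one of the first `q` parts. -/
def LinkStep (b : Fin n → Fin t) (rel : Setoid (Fin t)) (M : Matrix (Fin n) (Fin n) k)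
    (parts : Fin m → Part n) (q : ℕ) (x y : Fin n) : Prop :=
  placeRel b rel x y ∨ ∃ p : Fin m, p.val < q ∧ (parts p).Has x y ∧ M x y = 1

/-- The equivalence relation generated by `LinkStep`. -/
def links (b : Fin n → Fin t) (rel : Setoid (Fin t)) (M : Matrix (Fin n) (Fin n) k)
    (parts : Fin m → Part n) (q : ℕ) : Setoid (Fin n) :=
  Relation.EqvGen.setoid (LinkStep b rel M parts q)

theorem links_iff {x y : Fin n} :
    links b rel M parts q x y ↔ Relation.EqvGen (LinkStep b rel M parts q) x y := Iff.rfl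

theorem links_zero : links b rel M parts 0 = placeRel b rel := by
  ext x y
  rw [links_iff]
  constructor
  · intro h
    induction h with
    | rel x y h =>
      rcases h with h | ⟨p, hp, -⟩
      · exact h
      · exact absurd hp (Nat.not_lt_zero _)
    | refl x => exact (placeRel b rel).refl x
    | symm x y _ ih => exact (placeRel b rel).symm ih
    | trans x y z _ _ ih ih' => exact (placeRel b rel).trans ih ih'
  · exact fun h => .rel _ _ (Or.inl h)

theorem links_mono {q' : ℕ} (hq : q ≤ q') {x y : Fin n} (h : links b rel M parts q x y) :
    links b rel M parts q' x y :=
  Relation.EqvGen.mono (fun _ _ h => h.imp_right fun ⟨p, hp, h'⟩ => ⟨p, hp.trans_le hq, h'⟩) _ _ h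

theorem links_succ {q : Fin m} {x y : Fin n} :
    links b rel M parts (q + 1) x y ↔ Relation.EqvGen (fun x y => links b rel M parts q x y ∨
      ((parts q).Has x y ∧ M x y = 1)) x y := by
  constructor
  · refine Relation.EqvGen.mono (fun x y h => ?_) _ _
    rcases h with h | ⟨p, hp, h⟩
    · exact Or.inl (.rel _ _ (Or.inl h))
    · rcases (Nat.lt_succ_iff.1 hp).lt_or_eq with hlt | heq
      · exact Or.inl (.rel _ _ (Or.inr ⟨p, hlt, h⟩))
      · exact Or.inr (Fin.ext heq ▸ h)
  · intro h
    induction h with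
    | rel x y h =>
      rcases h with h | h
      · exact links_mono (Nat.le_succ _) h
      · exact .rel _ _ (Or.inr ⟨q, Nat.lt_succ_self _, h⟩)
    | refl x => exact (links b rel M parts _).refl x
    | symm x y _ ih => exact (links b rel M parts _).symm ih
    | trans x y z _ _ ih ih' => exact (links b rel M parts _).trans ih ih'

/-- The situation after the reduction of the first `q` parts of `M`: `Λ'` consists of the
matrices of `Λ` that commute with `M` at the first `q` parts, and `P` is the coarsest
subdivision of the strips for which these parts are divided into cells `0` and `λ I`. -/
structure Stage (b : Fin n → Fin t) (rel : Setoid (Fin t))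
    (Λ : Subalgebra k (Matrix (Fin n) (Fin n) k)) (M : Matrix (Fin n) (Fin n) k)
    (parts : Fin m → Part n) (q : ℕ) (P : Setoid (Fin n))
    (Λ' : Subalgebra k (Matrix (Fin n) (Fin n) k)) : Prop where
  mem_iff : ∀ S, S ∈ Λ' ↔ S ∈ Λ ∧
    ∀ p : Fin m, p.val < q → ∀ x y, (parts p).Has x y → (S * M) x y = (M * S) x y
  block : IsBlockAlgebra P (links b rel M parts q) Λ'
  subdiv : IsSubdivisionBelow b rel M parts q P
  coarsest : ∀ P', IsSubdivisionBelow b rel M parts q P' → P' ≤ P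
  saturated : ∀ p : Fin m, p.val < q → (parts p).Saturated P
  link_of_ne : ∀ p : Fin m, p.val < q → ∀ x y, (parts p).Has x y → M x y ≠ 0 →
    links b rel M parts q x y
  left_closed : ∀ p : Fin m, p.val < q → ∀ x y w, (parts p).Has x y → w < y →
    ∃ p' ≤ p, (parts p').Has x w
  mem_of_fixes : ∀ T ∈ Λ, IsUnit T → (∀ p : Fin m, p.val < q → ∀ x y, (parts p).Has x y →
    (T⁻¹ * M * T) x y = M x y) → T ∈ Λ'

theorem compat_placeRel (h : Compat (Setoid.ker b) (placeRel b rel))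
    (hP : IsSubdivisionBelow b rel M parts q P) : Compat P (placeRel b rel) := by
  intro x y hxy
  have hiso := class_iso (P := P) (x := x) (y := y) (placeRel b rel) ?_ ?_ ?_
  · refine ⟨hiso.1, (hiso.2 x y (P.refl x) (P.refl y)).2 hxy, fun x' y' hx hy hp => ?_⟩
    exact (hiso.2 x' y' hx hy).1 hp
  · intro x' hx
    obtain ⟨y', hy, -, hR⟩ := h.exists hxy (show Setoid.ker b x x' from hP.refines _ _ hx)
    exact ⟨y', (hP.alike x x' y y' (hP.refines _ _ hx) hy hxy hR).1 hx, hR⟩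
  · intro y' hy
    obtain ⟨x', hx, -, hR⟩ := h.exists ((placeRel b rel).symm hxy)
      (show Setoid.ker b y y' from hP.refines _ _ hy)
    have hR := (placeRel b rel).symm hR
    exact ⟨x', (hP.alike x x' y y' hx (hP.refines _ _ hy) hxy hR).2 hy, hR⟩
  · intro z z' w w' hz hz' hw hw' hR hR'
    have hbz : Setoid.ker b z z' := (hP.refines _ _ hz).symm.trans (hP.refines _ _ hz')
    have hbw : Setoid.ker b w w' := (hP.refines _ _ hw).symm.trans (hP.refines _ _ hw')
    rw [← pl_lt_pl_iff hbz, ← pl_lt_pl_iff hbw, pl_ker, pl_ker, pl_ker, pl_ker, hR.2, hR'.2]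

theorem IsSubdivisionBelow.goodBlock (h : IsSubdivisionBelow b rel M parts q P) {p : Fin m}
    (hp : p.val < q) (hs : (parts p).Saturated P) {x y : Fin n} (hB : (parts p).Has x y) :
    GoodBlock M P x y :=
  (cell_good_iff hs hB).1 (h.cells p hp x y hB)

theorem compat_links (h : Compat (Setoid.ker b) (placeRel b rel))
    (hP : IsSubdivisionBelow b rel M parts q P)
    (hs : ∀ p : Fin m, p.val < q → (parts p).Saturated P) :
    Compat P (links b rel M parts q) := by
  refine Compat.eqvGen ?_
  rintro x y (hxy | ⟨p, hp, hxy⟩)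
  · obtain ⟨h1, h2, h3⟩ := compat_placeRel h hP x y hxy
    exact ⟨h1, h2, fun x' y' hx hy hp => Or.inl (h3 x' y' hx hy hp)⟩
  · obtain ⟨h1, h2, h3⟩ := compat_ones (hs p hp) (fun x y => hP.goodBlock hp (hs p hp)) x y hxy
    exact ⟨h1, h2, fun x' y' hx hy hp' => Or.inr ⟨p, hp, h3 x' y' hx hy hp'⟩⟩

/-- The source of members of the stage algebras: it yields both the fullness at the next stage and
the maximality of its subdivision. -/
theorem mem_of_block_diag (hΛ : IsBlockAlgebra (Setoid.ker b) (placeRel b rel) Λ)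
    (hP : IsSubdivisionBelow b rel M parts q P)
    (hs : ∀ p : Fin m, p.val < q → (parts p).Saturated P)
    {S : Matrix (Fin n) (Fin n) k} (hS : ∀ x y, ¬ P x y → S x y = 0)
    (h₁ : ∀ x x' y y', placeRel b rel x x' → placeRel b rel y y' → P x y → P x' y' →
      S x y = S x' y')
    (h₂ : ∀ p : Fin m, p.val < q → ∀ x x' y y', (parts p).Has x x' → (parts p).Has y y' →
      M x x' ≠ 0 → M y y' ≠ 0 → pl P x = pl P x' → pl P y = pl P y' → P x y → P x' y' →
      S x y = S x' y') :
    S ∈ Λ ∧ ∀ p : Fin m, p.val < q → ∀ x y, (parts p).Has x y → (S * M) x y = (M * S) x y := by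
  refine ⟨hΛ.full S (fun x y hxy => hS x y fun h => hxy (hP.refines _ _ h)) ?_, ?_⟩
  · intro x x' y y' hx hy hxy hxy'
    have := hP.alike x y x' y' hxy hxy' hx hy
    by_cases h : P x y
    · exact h₁ x x' y y' hx hy h (this.1 h)
    · rw [hS x y h, hS x' y' fun h' => h (this.2 h')]
  · intro p hp x y hB
    exact comm_of_goodBlock (fun x y => hP.goodBlock hp (hs p hp)) (hs p hp) hS (h₂ p hp) hB

theorem stage_zero (hΛ : IsReducedAlgebra b rel Λ) :
    Stage b rel Λ M parts 0 (Setoid.ker b) Λ := by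
  have h := hΛ.isBlockAlgebra
  refine ⟨fun S => ⟨fun hS => ⟨hS, fun p hp => absurd hp (Nat.not_lt_zero _)⟩, fun hS => hS.1⟩,
    by rwa [links_zero], ⟨h.convex, fun _ _ hxy => hxy, fun x x' y y' hx hy _ _ => ?_,
      fun p hp => absurd hp (Nat.not_lt_zero _)⟩, fun P' hP' x y hxy => hP'.refines x y hxy,
    fun p hp => absurd hp (Nat.not_lt_zero _), fun p hp => absurd hp (Nat.not_lt_zero _),
    fun p hp => absurd hp (Nat.not_lt_zero _), fun T hT _ _ => hT⟩
  exact ⟨fun _ => hy, fun _ => hx⟩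

namespace Stage

/-- Triangularity leaves only rows from the class of `x` or below `x`. In the column `y` these rows
lie in the part itself or, once below its last row, in earlier parts. -/
theorem left_mul_apply (h : Stage b rel Λ M parts q P Λ')
    (hp : ∀ x y, ∃! q, (parts q).Has x y) (ho : ∀ p q, p < q → (parts p).Before (parts q))
    {p : Fin m} (hs : (parts p).Saturated P) {S N N' : Matrix (Fin n) (Fin n) k} (hS : S ∈ Λ')
    (hN : ∀ p' ≤ p, ∀ x y, (parts p').Has x y → N x y = N' x y) {x y : Fin n}
    (hB : (parts p).Has x y) : (S * N) x y = (S * N') x y := by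
  rw [Matrix.mul_apply, Matrix.mul_apply]
  refine Finset.sum_congr rfl fun z _ => ?_
  by_cases hz : P x z
  · rw [hN p le_rfl z y (hs x y z y hB hz (P.refl y))]
  · rcases lt_trichotomy x z with hlt | rfl | hlt
    · obtain ⟨p', hp', -⟩ := hp z y
      rw [hN p' ?_ z y hp']
      rcases lt_or_ge (parts p).bottom z with hbz | hbz
      · exact (index_lt_of_bottom_lt ho hp' hbz).le
      · refine ((hp z y).unique hp' ?_).le
        rw [Part.has_iff] at hB ⊢
        exact ⟨⟨hB.1.1.trans hlt.le, hbz⟩, hB.2⟩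
    · exact absurd (P.refl x) hz
    · rw [h.block.tri S hS x z hlt hz, zero_mul, zero_mul]

/-- The analogue for columns. The order of the parts controls what lies to the left only in the last
row of a part; `hl` supplies this for its other rows. -/
theorem right_mul_apply (h : Stage b rel Λ M parts q P Λ') {p : Fin m}
    (hs : (parts p).Saturated P)
    (hl : ∀ x y w, (parts p).Has x y → w < y → ∃ p' ≤ p, (parts p').Has x w)
    {S N N' : Matrix (Fin n) (Fin n) k} (hS : S ∈ Λ')
    (hN : ∀ p' ≤ p, ∀ x y, (parts p').Has x y → N x y = N' x y) {x y : Fin n}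
    (hB : (parts p).Has x y) : (N * S) x y = (N' * S) x y := by
  rw [Matrix.mul_apply, Matrix.mul_apply]
  refine Finset.sum_congr rfl fun w _ => ?_
  by_cases hw : P w y
  · rw [hN p le_rfl x w (hs x y x w hB (P.refl x) (P.symm hw))]
  · rcases lt_trichotomy w y with hlt | rfl | hlt
    · obtain ⟨p', hp', hB'⟩ := hl x y w hB hlt
      rw [hN p' hp' x w hB']
    · exact absurd (P.refl w) hw
    · rw [h.block.tri S hS w y hlt hw, mul_zero, mul_zero]

/-- On the first `q` parts `M * T` may be replaced by `T * M`, and multiplication by `T⁻¹` sees only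
these parts. -/
theorem fixes (h : Stage b rel Λ M parts q P Λ')
    (hp : ∀ x y, ∃! q, (parts q).Has x y) (ho : ∀ p q, p < q → (parts p).Before (parts q))
    {T : Matrix (Fin n) (Fin n) k} (hT : T ∈ Λ') (hu : IsUnit T) {p : Fin m} (hpq : p.val < q)
    {x y : Fin n} (hB : (parts p).Has x y) : (T⁻¹ * M * T) x y = M x y := by
  have hdet := (Matrix.isUnit_iff_isUnit_det T).1 hu
  rw [mul_assoc, h.left_mul_apply hp ho (h.saturated p hpq) (inv_mem_of_isUnit hT hu)
    (N' := T * M) (fun p' hp' x y hB' => ?_) hB, ← mul_assoc, Matrix.nonsing_inv_mul T hdet,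
    one_mul]
  exact (((h.mem_iff T).1 hT).2 p' (lt_of_le_of_lt hp' hpq) x y hB').symm

/-- In the last row of the part, the entries left of it belong to earlier parts by the order. These
parts are saturated, and all rows of the cell form one class, so the same holds in every row. -/
theorem cell_left_closed (h : Stage b rel Λ M parts q P Λ')
    (hp : ∀ x y, ∃! q, (parts q).Has x y) (ho : ∀ p q, p < q → (parts p).Before (parts q))
    {Q : Fin m} (hQ : Q.val = q) (hB : (parts Q).IsCell P) {x y w : Fin n}
    (hxy : (parts Q).Has x y) (hw : w < y) : ∃ p ≤ Q, (parts p).Has x w := by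
  by_cases hyw : P y w
  · exact ⟨Q, le_rfl, (hB.has_iff hxy x w).2 ⟨P.refl x, hyw⟩⟩
  · obtain ⟨p, hpw, -⟩ := hp (parts Q).bottom w
    have hlt : p < Q := by
      refine index_lt_of_lt_left ho hpw ?_
      have := (hB.has_iff hxy _ _).1 (parts Q).has_bottom_left
      exact h.subdiv.convex.lt_of_lt (fun h => hyw (P.symm h)) hw (P.refl w) this.2
    have := (hB.has_iff hxy _ _).1 (parts Q).has_bottom_left
    exact ⟨p, hlt.le, h.saturated p (by rw [← hQ]; exact hlt) _ _ _ _ hpw (P.symm this.1)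
      (P.refl w)⟩

/-- Only products need an argument: in `S * T * M` one replaces `T * M` by `M * T` and then `S * M`
by `M * S`, and both replacements involve only parts up to `Q`. -/
theorem exists_subalgebra (h : Stage b rel Λ M parts q P Λ')
    (hp : ∀ x y, ∃! q, (parts q).Has x y) (ho : ∀ p q, p < q → (parts p).Before (parts q))
    {Q : Fin m} (hQ : Q.val = q) (hB : (parts Q).IsCell P) :
    ∃ Λ'' : Subalgebra k (Matrix (Fin n) (Fin n) k), ∀ S, S ∈ Λ'' ↔ S ∈ Λ' ∧
      ∀ x y, (parts Q).Has x y → (S * M) x y = (M * S) x y := by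
  have hcomm : ∀ S ∈ Λ', (∀ x y, (parts Q).Has x y → (S * M) x y = (M * S) x y) →
      ∀ p ≤ Q, ∀ x y, (parts p).Has x y → (S * M) x y = (M * S) x y := by
    intro S hS hSQ p hpQ
    rcases hpQ.lt_or_eq with hlt | rfl
    · exact ((h.mem_iff S).1 hS).2 p (by rw [← hQ]; exact hlt)
    · exact hSQ
  refine ⟨{ carrier := {S | S ∈ Λ' ∧ ∀ x y, (parts Q).Has x y → (S * M) x y = (M * S) x y}
            mul_mem' := ?_
            add_mem' := ?_
            algebraMap_mem' := ?_ }, fun S => Iff.rfl⟩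
  · rintro S T ⟨hS, hS'⟩ ⟨hT, hT'⟩
    refine ⟨Λ'.mul_mem hS hT, fun x y hxy => ?_⟩
    rw [mul_assoc, h.left_mul_apply hp ho hB.saturated hS (hcomm T hT hT') hxy, ← mul_assoc,
      h.right_mul_apply hB.saturated (fun x y w => h.cell_left_closed hp ho hQ hB) hT
        (hcomm S hS hS') hxy, mul_assoc]
  · rintro S T ⟨hS, hS'⟩ ⟨hT, hT'⟩
    refine ⟨Λ'.add_mem hS hT, fun x y hxy => ?_⟩
    rw [add_mul, mul_add, Matrix.add_apply, Matrix.add_apply, hS' x y hxy, hT' x y hxy]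
  · intro r
    refine ⟨Λ'.algebraMap_mem r, fun x y _ => ?_⟩
    rw [Algebra.commutes]

end Stage

end Stage

end Belitskii

namespace Belitskii

/-! ### From one stage to the next -/

section StageSucc

variable {k : Type*} [Field k] {n t m : ℕ} {b : Fin n → Fin t} {rel : Setoid (Fin t)}
  {Λ Λ' : Subalgebra k (Matrix (Fin n) (Fin n) k)} {M : Matrix (Fin n) (Fin n) k}
  {parts : Fin m → Part n} {P P' : Setoid (Fin n)}

/-- By `hinv` the refinement cuts related classes at corresponding places, so their order
isomorphism restricts to the pieces. -/
theorem compat_refine {E : Setoid (Fin n)} (h : Compat P E) (hle : P' ≤ P)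
    (hinv : ∀ x y x' y', E x y → E x' y' → P x x' → P y y' → P' x x' → P' y y') {x y : Fin n}
    (hxy : E x y) :
    cd P' x = cd P' y ∧ ∀ z w, P' x z → P' y w → (pl P' z = pl P' w ↔ E z w) := by
  refine class_iso E ?_ ?_ ?_
  · intro x' hx
    obtain ⟨y', hy, -, hR⟩ := h.exists hxy (hle hx)
    exact ⟨y', hinv x y x' y' hxy hR (hle hx) hy hx, hR⟩
  · intro y' hy
    obtain ⟨x', hx, -, hR⟩ := h.exists (E.symm hxy) (hle hy)
    exact ⟨x', hinv y x y' x' (E.symm hxy) hR (hle hy) hx hy, E.symm hR⟩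
  · intro z z' w w' hz hz' hw hw' hR hR'
    rw [← pl_lt_pl_iff (P.trans (P.symm (hle hz)) (hle hz')),
      ← pl_lt_pl_iff (P.trans (P.symm (hle hw)) (hle hw')), (h _ _ hR).2.1, (h _ _ hR').2.1]

/-- A nonzero entry of a finer cell relates its row to its column, so both sides are cut alike and
the cell is a diagonal piece of `λ I`. -/
theorem goodBlock_refine {E : Setoid (Fin n)} (h : Compat P E) (hle : P' ≤ P)
    (hinv : ∀ x y x' y', E x y → E x' y' → P x x' → P y y' → P' x x' → P' y y') {B : Part n}
    (hs : B.Saturated P) (hg : ∀ x y, B.Has x y → GoodBlock M P x y)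
    (hE : ∀ x y, B.Has x y → M x y ≠ 0 → E x y) {x y : Fin n} (hB : B.Has x y) :
    GoodBlock M P' x y := by
  by_cases h0 : ∀ z w, P' x z → P' y w → M z w = 0
  · exact Or.inl h0
  · push Not at h0
    obtain ⟨z, w, hz, hw, hne⟩ := h0
    have hzw := hs _ _ _ _ hB (hle hz) (hle hw)
    obtain ⟨hp, hsc⟩ := (hg z w hzw).scalar hne
    have hlink := hE z w hzw hne
    have hiso := compat_refine h hle hinv hlink
    refine Or.inr ⟨M z w, ?_, fun z' w' hz' hw' => ?_⟩
    · rw [cd_eq hz, cd_eq hw, hiso.1]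
    · have hz'' := P'.trans (P'.symm hz) hz'
      have hw'' := P'.trans (P'.symm hw) hw'
      rw [hsc.2 z' w' (hle hz'') (hle hw'')]
      refine if_congr ?_ rfl rfl
      rw [hiso.2 z' w' hz'' hw'']
      exact ⟨fun h' => (h z w hlink).2.2 z' w' (hle hz'') (hle hw'') h', fun h' => (h _ _ h').2.1⟩

/-- Reduces the passage to facts about the single part `Q`: what commutation with it forces is
`htri` and `hdiag`. Everything in the opposite direction is automatic, since block-diagonal matrices
with the required ties commute with zero and scalar cells. -/
theorem Stage.succ {Q : Fin m} (h : Stage b rel Λ M parts Q P Λ')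
    (hΛ : IsReducedAlgebra b rel Λ)
    (hp : ∀ x y, ∃! q, (parts q).Has x y) (ho : ∀ p q, p < q → (parts p).Before (parts q))
    (hB : (parts Q).IsCell P) (hle : P' ≤ P) (hconv : Convex P')
    (hinv : ∀ x y x' y', links b rel M parts Q x y → links b rel M parts Q x' y' →
      P x x' → P y y' → P' x x' → P' y y')
    (hgood : ∀ x y, (parts Q).Has x y → GoodBlock M P' x y)
    (hne : ∀ x y, (parts Q).Has x y → M x y ≠ 0 → links b rel M parts (Q + 1) x y)
    (htri : ∀ S ∈ Λ', (∀ x y, (parts Q).Has x y → (S * M) x y = (M * S) x y) →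
      ∀ x y, y < x → P x y → ¬ P' x y → S x y = 0)
    (hdiag : ∀ S ∈ Λ', (∀ x y, (parts Q).Has x y → (S * M) x y = (M * S) x y) →
      ∀ x x' y y', (parts Q).Has x x' → M x x' = 1 → (parts Q).Has y y' → M y y' = 1 →
        P' x y → P' x' y' → S x y = S x' y') :
    ∃ Λ'', Stage b rel Λ M parts (Q + 1) P' Λ'' := by
  obtain ⟨Λ'', hΛ''⟩ := h.exists_subalgebra hp ho rfl hB
  have h0 := hΛ.isBlockAlgebra
  have hcase : ∀ {C : Fin m → Prop}, (∀ p : Fin m, p.val < Q → C p) → C Q →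
      ∀ p : Fin m, p.val < Q + 1 → C p := by
    intro C h1 h2 p hpQ
    rcases (Nat.lt_succ_iff.1 hpQ).lt_or_eq with hlt | heq
    · exact h1 p hlt
    · exact (Fin.ext heq : p = Q) ▸ h2
  have hsat : ∀ p : Fin m, p.val < Q + 1 → (parts p).Saturated P :=
    hcase h.saturated hB.saturated
  have hmem : ∀ S, S ∈ Λ'' ↔ S ∈ Λ ∧
      ∀ p : Fin m, p.val < Q + 1 → ∀ x y, (parts p).Has x y → (S * M) x y = (M * S) x y := by
    intro S
    rw [hΛ'', h.mem_iff]
    constructor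
    · rintro ⟨⟨h1, h2⟩, h3⟩
      exact ⟨h1, hcase h2 h3⟩
    · rintro ⟨h1, h2⟩
      exact ⟨⟨h1, fun p hpQ => h2 p (hpQ.trans (Nat.lt_succ_self _))⟩, h2 Q (Nat.lt_succ_self _)⟩
  have hlink : ∀ p : Fin m, p.val < Q + 1 → ∀ x y, (parts p).Has x y → M x y ≠ 0 →
      links b rel M parts (Q + 1) x y :=
    hcase (fun p hpQ x y hxy hM => links_mono (Nat.le_succ _) (h.link_of_ne p hpQ x y hxy hM)) hne
  have hgood' : ∀ p : Fin m, p.val < Q + 1 → ∀ x y, (parts p).Has x y → GoodBlock M P' x y :=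
    hcase (fun p hpQ x y hxy => goodBlock_refine h.block.compat hle hinv (h.saturated p hpQ)
      (fun x y hxy => h.subdiv.goodBlock hpQ (h.saturated p hpQ) hxy)
      (h.link_of_ne p hpQ) hxy) hgood
  have hsub : IsSubdivisionBelow b rel M parts (Q + 1) P' := by
    refine ⟨hconv, fun x y hxy => h.subdiv.refines x y (hle hxy), ?_, ?_⟩
    · intro x x' y y' hx hy hxy hxy'
      have hal := h.subdiv.alike x x' y y' hx hy hxy hxy'
      have l1 : links b rel M parts Q x y := .rel _ _ (Or.inl hxy)
      have l2 : links b rel M parts Q x' y' := .rel _ _ (Or.inl hxy')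
      exact ⟨fun hP => hinv x y x' y' l1 l2 (hle hP) (hal.1 (hle hP)) hP,
        fun hP => hinv y x y' x' (Setoid.symm' _ l1) (Setoid.symm' _ l2) (hle hP) (hal.2 (hle hP)) hP⟩
    · intro p hpQ x y hxy
      exact (cell_good_iff ((hsat p hpQ).mono hle) hxy).2 (hgood' p hpQ x y hxy)
  have hcompat := compat_links h0.compat hsub fun p hpQ => (hsat p hpQ).mono hle
  have hdiag' : ∀ S ∈ Λ'', ∀ x x', links b rel M parts (Q + 1) x x' → ∀ y y',
      P' x y → P' x' y' → pl P' y = pl P' y' → S x y = S x' y' := by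
    intro S hS x x' hx
    have hS' := (hΛ'' S).1 hS
    rw [links_succ] at hx
    induction hx with
    | rel x x' hx =>
      intro y y' hxy hxy' hpl
      rcases hx with hx | hx
      · exact h.block.diag S hS'.1 x x' y y' hx
          (((compat_refine h.block.compat hle hinv hx).2 y y' hxy hxy').1 hpl) (hle hxy) (hle hxy')
      · have hy := (compat_ones (hB.saturated.mono hle) hgood x x' hx).2.2 y y' hxy hxy' hpl
        exact hdiag S hS'.1 hS'.2 x x' y y' hx.1 hx.2 hy.1 hy.2 hxy hxy'
    | refl x =>
      intro y y' hxy hxy' hpl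
      rw [pl_inj (P'.trans (P'.symm hxy) hxy') hpl]
    | symm x x' _ ih => exact fun y y' hxy hxy' hpl => (ih y' y hxy' hxy hpl.symm).symm
    | trans x z x' hxz _ ih ih' =>
      intro y y' hxy hxy' hpl
      -- The equality of entries passes through the matching position in the class of the
      -- intermediate index.
      obtain ⟨w, hzw, hw⟩ := exists_pl_eq (P := P') (x := z) (a := pl P' y)
        (by rw [← (hcompat x z (links_succ.2 hxz)).1, cd_eq hxy]; exact pl_lt_cd P' y)
      rw [ih y w hxy hzw hw.symm, ih' w y' hzw hxy' (hw.trans hpl)]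
  refine ⟨Λ'', hmem, ⟨hconv, hcompat, ?_, ?_, ?_⟩, hsub, ?_, fun p hpQ => (hsat p hpQ).mono hle,
    hlink, ?_, ?_⟩
  · intro S hS x y hxy hn
    have hS' := (hΛ'' S).1 hS
    by_cases hP : P x y
    · exact htri S hS'.1 hS'.2 x y hxy hP hn
    · exact h.block.tri S hS'.1 x y hxy hP
  · intro S hS x x' y y' hx hy hxy hxy'
    exact hdiag' S hS x x' hx y y' hxy hxy' (hcompat y y' hy).2.1
  · intro S hS hS'
    refine (hmem S).2 (mem_of_block_diag h0 hsub (fun p hpQ => (hsat p hpQ).mono hle) hS ?_ ?_)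
    · intro x x' y y' hx hy
      exact hS' x x' y y' (.rel _ _ (Or.inl hx)) (.rel _ _ (Or.inl hy))
    · intro p hpQ x x' y y' hx hy hMx hMy _ _
      exact hS' x x' y y' (hlink p hpQ x x' hx hMx) (hlink p hpQ y y' hy hMy)
  · intro P₂ hP₂
    have hle₂ : P₂ ≤ P := h.coarsest P₂ (hP₂.mono (Nat.le_succ _))
    -- Any admissible subdivision `P₂` has its `placeUnit` matrices in the new algebra, so joining
    -- indices separated by `P'` would contradict `htri`.
    have key : ∀ x y, P₂ x y → y < x → P' x y := by
      intro x y hxy hlt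
      by_contra hn
      have hU : placeUnit k P₂ (pl P₂ x) (pl P₂ y) ∈ Λ'' := by
        refine (hmem _).2 (mem_of_block_diag h0 hP₂ (fun p hpQ => (hsat p hpQ).mono hle₂)
          (fun z w hzw => by simp [placeUnit, hzw]) ?_ ?_)
        · intro z z' w w' hz hw hzw hzw'
          have hc := compat_placeRel h0.compat hP₂
          simp only [placeUnit, hzw, hzw', (hc z z' hz).2.1, (hc w w' hw).2.1]
        · intro p _ z z' w w' _ _ _ _ hz hw hzw hzw'
          simp only [placeUnit, hzw, hzw', hz, hw]
      have hU' := (hΛ'' _).1 hU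
      have := htri _ hU'.1 hU'.2 x y hlt (hle₂ hxy) hn
      simp [placeUnit, hxy] at this
    intro x y hxy
    rcases lt_trichotomy x y with h1 | h1 | h1
    · exact P'.symm (key y x (P₂.symm hxy) h1)
    · exact h1 ▸ P'.refl x
    · exact key x y hxy h1
  · exact hcase h.left_closed fun x y w hxy hw => h.cell_left_closed hp ho rfl hB hxy hw
  · intro T hT hu hfix
    have hT' := h.mem_of_fixes T hT hu fun p hpQ => hfix p (hpQ.trans (Nat.lt_succ_self _))
    have hdet := (Matrix.isUnit_iff_isUnit_det T).1 hu
    refine (hΛ'' T).2 ⟨hT', fun x y hxy => ?_⟩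
    rw [h.left_mul_apply hp ho hB.saturated hT' (N' := T⁻¹ * M * T)
      (fun p hpQ x y hB' => (hfix p (Nat.lt_succ_of_le hpQ) x y hB').symm) hxy, ← mul_assoc,
      ← mul_assoc, Matrix.mul_nonsing_inv T hdet, one_mul]

/-! ### Strips and links at a stage -/

namespace Stage

variable {Q : Fin m}

/-- The supremum is attained: `P` is itself admissible and lies above all admissible subdivisions.
-/
theorem strips_eq (h : Stage b rel Λ M parts Q P Λ') : strips b rel M parts Q = P := by
  apply le_antisymm
  · exact sSup_le fun P' hP' => h.coarsest P' (isSubdivision_iff.1 hP')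
  · exact le_sSup (isSubdivision_iff.2 h.subdiv)

theorem linked_of_links (h : Stage b rel Λ M parts Q P Λ') {x y : Fin n}
    (hxy : links b rel M parts Q x y) : Linked b rel M parts Q x y := by
  rw [links_iff] at hxy
  induction hxy with
  | rel x y hxy =>
    rcases hxy with hxy | ⟨p, hp, hxy, hM⟩
    · exact .equiv x y hxy.1 hxy.2
    · refine .cell p x y hp hxy ?_
      rw [h.strips_eq, isScalarMatrix_cell_iff (h.saturated p hp) hxy, ← hM]
      exact ((h.subdiv.goodBlock hp (h.saturated p hp) hxy).scalar
        (by rw [hM]; exact one_ne_zero)).2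
  | refl x => exact .same x x ((strips b rel M parts Q).refl x)
  | symm x y _ ih => exact .symm x y ih
  | trans x y z _ _ ih ih' => exact .trans x y z ih ih'

/-- Links between entries are order isomorphisms of classes, so in a chain all moves inside strips
can be collected at the beginning. -/
theorem linked_iff (h : Stage b rel Λ M parts Q P Λ') {x y : Fin n} :
    Linked b rel M parts Q x y ↔ ∃ z, P x z ∧ links b rel M parts Q z y := by
  constructor
  · intro hxy
    induction hxy with
    | same x y hxy =>
      rw [h.strips_eq] at hxy
      exact ⟨y, hxy, Setoid.refl' _ y⟩
    | equiv x y h1 h2 => exact ⟨x, P.refl x, .rel _ _ (Or.inl ⟨h1, h2⟩)⟩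
    | cell p x y hp hxy hs =>
      rw [h.strips_eq, isScalarMatrix_cell_iff (h.saturated p hp) hxy] at hs
      obtain ⟨z, hz, hzy⟩ := exists_pl_eq (P := P) (x := x) (a := pl P y)
        (by rw [hs.1]; exact pl_lt_cd P y)
      refine ⟨z, hz, .rel _ _ (Or.inr ⟨p, hp, h.saturated p hp _ _ _ _ hxy hz (P.refl y), ?_⟩)⟩
      rw [hs.2 z y hz (P.refl y), if_pos hzy]
    | symm x y _ ih =>
      obtain ⟨z, hz, hzy⟩ := ih
      obtain ⟨w, hw, -, hzw⟩ := h.block.compat.exists hzy (P.symm hz)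
      exact ⟨w, hw, Setoid.symm' _ hzw⟩
    | trans x y z _ _ ih ih' =>
      obtain ⟨v, hv, hvy⟩ := ih
      obtain ⟨w, hw, hwz⟩ := ih'
      obtain ⟨u, hu, -, huw⟩ := h.block.compat.exists (Setoid.symm' _ hvy) hw
      exact ⟨u, P.trans hv hu, Setoid.trans' _ (Setoid.symm' _ huw) hwz⟩
  · rintro ⟨z, hz, hzy⟩
    exact .trans x z y (.same x z (h.strips_eq.symm ▸ hz)) (h.linked_of_links hzy)

/-- The matrix is upper triangular with ones on the diagonal. -/
theorem isUnit_one_add (h : Stage b rel Λ M parts Q P Λ') {R : Matrix (Fin n) (Fin n) k}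
    (hR : R ∈ Λ') (hR0 : ∀ x y, P x y → R x y = 0) : IsUnit (1 + R) := by
  rw [Matrix.isUnit_iff_isUnit_det, Matrix.det_of_isUpperTriangular]
  · simp [hR0 _ _ (P.refl _)]
  · intro x y hxy
    have hlt : y < x := hxy
    have : R x y = 0 := by
      by_cases hP : P x y
      · exact hR0 x y hP
      · exact h.block.tri R hR x y hlt hP
    simp [this, hlt.ne']

theorem conj_apply_eq_iff (h : Stage b rel Λ M parts Q P Λ')
    (hp : ∀ x y, ∃! q, (parts q).Has x y) (ho : ∀ p q, p < q → (parts p).Before (parts q))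
    (hB : (parts Q).IsCell P) {T : Matrix (Fin n) (Fin n) k} (hT : T ∈ Λ') (hu : IsUnit T) :
    (∀ x y, (parts Q).Has x y → (T⁻¹ * M * T) x y = M x y) ↔
      ∀ x y, (parts Q).Has x y → (T * M) x y = (M * T) x y := by
  have hdet := (Matrix.isUnit_iff_isUnit_det T).1 hu
  constructor
  · intro hfix x y hxy
    rw [h.left_mul_apply hp ho hB.saturated hT (N' := T⁻¹ * M * T) (fun p hpQ x y hB' => ?_) hxy,
      ← mul_assoc, ← mul_assoc, Matrix.mul_nonsing_inv T hdet, one_mul]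
    rcases hpQ.lt_or_eq with hlt | rfl
    · exact (h.fixes hp ho hT hu hlt hB').symm
    · exact (hfix x y hB').symm
  · intro hcomm x y hxy
    rw [mul_assoc, h.left_mul_apply hp ho hB.saturated (inv_mem_of_isUnit hT hu)
      (N' := T * M) (fun p hpQ x y hB' => ?_) hxy, ← mul_assoc, Matrix.nonsing_inv_mul T hdet,
      one_mul]
    rcases hpQ.lt_or_eq with hlt | rfl
    · exact (((h.mem_iff T).1 hT).2 p hlt x y hB').symm
    · exact (hcomm x y hB').symm

/-- Some addition to the part `Q` is nonzero. -/
theorem canBeChanged_iff (h : Stage b rel Λ M parts Q P Λ')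
    (hp : ∀ x y, ∃! q, (parts q).Has x y) (ho : ∀ p q, p < q → (parts p).Before (parts q))
    (hB : (parts Q).IsCell P) :
    CanBeChanged b rel Λ M parts Q ↔ ∃ R ∈ Λ', (∀ x y, P x y → R x y = 0) ∧
      ¬ ∀ x y, (parts Q).Has x y → (R * M) x y = (M * R) x y := by
  have hadd : ∀ R : Matrix (Fin n) (Fin n) k,
      (∀ x y, (parts Q).Has x y → ((1 + R) * M) x y = (M * (1 + R)) x y) ↔
      ∀ x y, (parts Q).Has x y → (R * M) x y = (M * R) x y := by
    intro R
    simp [add_mul, mul_add]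
  rw [CanBeChanged, h.strips_eq]
  constructor
  · rintro ⟨S, hS, hu, hdiag, hfix, hne⟩
    have hS' : S ∈ Λ' := h.mem_of_fixes S hS hu fun p hpQ => Part.of_eq_iff.1 (hfix p hpQ)
    refine ⟨S - 1, Λ'.sub_mem hS' Λ'.one_mem, fun x y hxy => ?_, fun hcomm => hne ?_⟩
    · rw [Matrix.sub_apply, hdiag x y hxy, Matrix.one_apply, sub_self]
    · rw [← hadd, add_sub_cancel] at hcomm
      exact Part.of_eq_iff.2 ((h.conj_apply_eq_iff hp ho hB hS' hu).2 hcomm)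
  · rintro ⟨R, hR, hR0, hne⟩
    have hu := h.isUnit_one_add hR hR0
    have hT : 1 + R ∈ Λ' := Λ'.add_mem Λ'.one_mem hR
    refine ⟨1 + R, ((h.mem_iff _).1 hT).1, hu, fun x y hxy => ?_, fun p hpQ => ?_, fun heq => ?_⟩
    · rw [Matrix.add_apply, hR0 x y hxy, add_zero, Matrix.one_apply]
    · exact Part.of_eq_iff.2 fun x y hxy => h.fixes hp ho hT hu hpQ hxy
    · rw [Part.of_eq_iff, h.conj_apply_eq_iff hp ho hB hT hu, hadd] at heq
      exact hne heq

end Stage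

end StageSucc

end Belitskii

namespace Belitskii

/-! ### The cutting of strips by a reduced part -/

section Pattern

variable {k : Type*} [Field k]

/-- The shape of a reduced part `A` of size `h × w`. The colors `cu` and `cv` describe the
subdivision of its horizontal and vertical strips that is induced by the reduction of `A`; these
strips are linked if `linked` holds. -/
structure IsPattern {C : Type*} (linked : Prop) (h w : ℕ) (A : ℕ → ℕ → k) (cu cv : ℕ → C) :
    Prop where
  color_eq : linked → ∀ a < h, cu a = cv a
  convex_u : ∀ a b c, a ≤ b → b ≤ c → c < h → cu a = cu c → cu a = cu b
  convex_v : ∀ a b c, a ≤ b → b ≤ c → c < w → cv a = cv c → cv a = cv b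
  scalar : linked → ∀ i, ∃ μ : k, ∀ a < h, ∀ c < w, cu a = i → cv c = i →
    A a c = if a = c then μ else 0
  zero_or_one : ∀ a < h, ∀ c < w, ¬ (linked ∧ cu a = cv c) → A a c = 0 ∨ A a c = 1
  exists_right : ∀ a < h, ∀ c < w, ¬ (linked ∧ cu a = cv c) → A a c = 1 →
    ∀ a' < h, cu a = cu a' → ∃ c' < w, cv c = cv c' ∧ A a' c' = 1
  exists_left : ∀ a < h, ∀ c < w, ¬ (linked ∧ cu a = cv c) → A a c = 1 →
    ∀ c' < w, cv c = cv c' → ∃ a' < h, cu a = cu a' ∧ A a' c' = 1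
  lt_iff : ∀ a < h, ∀ c < w, ∀ a' < h, ∀ c' < w, ¬ (linked ∧ cu a = cv c) → cu a = cu a' →
    cv c = cv c' → A a c = 1 → A a' c' = 1 → (a < a' ↔ c < c')
  commute : ∀ X Y : ℕ → ℕ → k, (linked → ∀ a < h, ∀ c < h, X a c = Y a c) →
    (∀ a < h, ∀ c < w, ∑ z ∈ Finset.range h, X a z * A z c = ∑ z ∈ Finset.range w, A a z * Y z c) →
    (∀ a < h, ∀ c < a, cu a ≠ cu c → X a c = 0) ∧ (∀ a < w, ∀ c < a, cv a ≠ cv c → Y a c = 0) ∧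
    ∀ a < h, ∀ c < w, ∀ a' < h, ∀ c' < w, ¬ (linked ∧ cu a = cv c) → cu a = cu a' →
      cv c = cv c' → A a c = 1 → A a' c' = 1 → X a a' = Y c c'

variable {n t m : ℕ} {b : Fin n → Fin t} {rel : Setoid (Fin t)}
  {Λ Λ' : Subalgebra k (Matrix (Fin n) (Fin n) k)} {M : Matrix (Fin n) (Fin n) k}
  {parts : Fin m → Part n} {P : Setoid (Fin n)} {Q : Fin m}

theorem sum_cls (x : Fin n) (f : Fin n → k) (g : ℕ → k) (h : ∀ z, P x z → f z = g (pl P z)) :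
    ∑ z ∈ cls P x, f z = ∑ a ∈ Finset.range (cd P x), g a := by
  refine Finset.sum_bij (fun z _ => pl P z) (fun z hz => ?_) (fun z hz w hw h => ?_)
    (fun a ha => ?_) (fun z hz => h z (mem_cls.1 hz))
  · rw [mem_cls] at hz
    rw [Finset.mem_range, cd_eq hz]
    exact pl_lt_cd P z
  · rw [mem_cls] at hz hw
    exact pl_inj (P.trans (P.symm hz) hw) h
  · obtain ⟨z, hz, rfl⟩ := exists_pl_eq (Finset.mem_range.1 ha)
    exact ⟨z, mem_cls.2 hz, rfl⟩

theorem sum_eq_sum_cls (x : Fin n) (f : Fin n → k) (h : ∀ z, ¬ P x z → f z = 0) :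
    ∑ z, f z = ∑ z ∈ cls P x, f z := by
  symm
  refine Finset.sum_subset (Finset.subset_univ _) fun z _ hz => h z ?_
  rwa [mem_cls] at hz

theorem subEntry_cls (S : Matrix (Fin n) (Fin n) k) {u x y : Fin n} (hx : P u x) (hy : P u y) :
    subEntry S (cls P u) (cls P u) (pl P x) (pl P y) = S x y := by
  rw [pl_eq_rk hx, pl_eq_rk hy, subEntry_rk S (mem_cls.2 hx) (mem_cls.2 hy)]

/-- If the blocks of `M` before the part `Q` do not give additions to this part, then every
matrix that commutes with `M` at this part has intertwining diagonal blocks. -/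
theorem Stage.intertwine (h : Stage b rel Λ M parts Q P Λ') (hB : (parts Q).IsCell P)
    (hadd : ∀ R ∈ Λ', (∀ x y, P x y → R x y = 0) → ∀ x y, (parts Q).Has x y →
      (R * M) x y = (M * R) x y)
    {A : ℕ → ℕ → k} (hA : ∀ x y, (parts Q).Has x y → M x y = A (pl P x) (pl P y))
    {S : Matrix (Fin n) (Fin n) k} (hS : S ∈ Λ')
    (hSM : ∀ x y, (parts Q).Has x y → (S * M) x y = (M * S) x y) {u v : Fin n}
    (huv : (parts Q).Has u v) :
    ∀ a < cd P u, ∀ c < cd P v,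
      ∑ z ∈ Finset.range (cd P u), subEntry S (cls P u) (cls P u) a z * A z c =
      ∑ z ∈ Finset.range (cd P v), A a z * subEntry S (cls P v) (cls P v) z c := by
  intro a ha c hc
  obtain ⟨x, hx, rfl⟩ := exists_pl_eq ha
  obtain ⟨y, hy, rfl⟩ := exists_pl_eq hc
  have hxy : (parts Q).Has x y := (hB.has_iff huv x y).2 ⟨hx, hy⟩
  -- By `hadd` the part of `S` off the diagonal blocks contributes equally to both products, so the
  -- diagonal blocks alone must intertwine.
  have hR := hadd (S - blockDiag P S) (Λ'.sub_mem hS (h.block.blockDiag_mem hS))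
    (fun x y hxy => by simp [blockDiag, hxy]) x y hxy
  rw [sub_mul, mul_sub, Matrix.sub_apply, Matrix.sub_apply, hSM x y hxy] at hR
  have hD := sub_right_injective hR
  rw [Matrix.mul_apply, Matrix.mul_apply, sum_eq_sum_cls (P := P) u,
    sum_eq_sum_cls (P := P) v] at hD
  · rw [← sum_cls (P := P) u _ _ fun z hz => ?_, hD, sum_cls (P := P) v _ _ fun z hz => ?_]
    · have hzy : P z y := P.trans (P.symm hz) hy
      rw [hA x z ((hB.has_iff huv _ _).2 ⟨hx, hz⟩), subEntry_cls S hz hy]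
      simp [blockDiag, hzy]
    · have hxz : P x z := P.trans (P.symm hx) hz
      rw [← hA z y ((hB.has_iff huv _ _).2 ⟨hz, hy⟩), subEntry_cls S hx hz]
      simp [blockDiag, hxz]
  · intro z hz
    have : ¬ P z y := fun h => hz (P.trans hy (P.symm h))
    simp [blockDiag, this]
  · intro z hz
    have : ¬ P x z := fun h => hz (P.trans hx h)
    simp [blockDiag, this]

theorem Stage.links_of_linked (h : Stage b rel Λ M parts Q P Λ') (hB : (parts Q).IsCell P)
    (hl : Linked b rel M parts Q (parts Q).top (parts Q).left) {x y : Fin n}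
    (hxy : (parts Q).Has x y) (hpl : pl P x = pl P y) : links b rel M parts Q x y := by
  obtain ⟨z, hz, hzv⟩ := h.linked_iff.1 hl
  have := (hB.has_iff (parts Q).has_top_left x y).1 hxy
  exact (h.block.compat z _ hzv).2.2 x y (P.trans (P.symm hz) this.1) this.2 hpl

open Classical in
/-- The color of the entry `x`, if its strip is linked with the horizontal strip of `u` or the
vertical strip of `v`. -/
noncomputable def color {C : Type*} (P E : Setoid (Fin n)) (u v : Fin n) (cu cv : ℕ → C)
    (x : Fin n) : Option C :=
  if ∃ z, P u z ∧ E z x then some (cu (pl P x)) else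
    if ∃ z, P v z ∧ E z x then some (cv (pl P x)) else none

section Color

variable {C : Type*} {E : Setoid (Fin n)} {u v x : Fin n} {cu cv : ℕ → C}

theorem color_left (h : ∃ z, P u z ∧ E z x) : color P E u v cu cv x = some (cu (pl P x)) := if_pos h

theorem color_right (h : ¬ ∃ z, P u z ∧ E z x) (h' : ∃ z, P v z ∧ E z x) :
    color P E u v cu cv x = some (cv (pl P x)) := by rw [color, if_neg h, if_pos h']

theorem color_none (h : ¬ ∃ z, P u z ∧ E z x) (h' : ¬ ∃ z, P v z ∧ E z x) :
    color P E u v cu cv x = none := by rw [color, if_neg h, if_neg h']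

end Color

/-- The colors of rows and columns of the part are transported along the links to all classes linked
with them, and `P` is cut by the resulting coloring. It is invariant under links by construction,
and the clauses of `IsPattern` supply the remaining hypotheses of `Stage.succ`. -/
theorem Stage.succ_of_pattern (h : Stage b rel Λ M parts Q P Λ') (hΛ : IsReducedAlgebra b rel Λ)
    (hp : ∀ x y, ∃! q, (parts q).Has x y) (ho : ∀ p q, p < q → (parts p).Before (parts q))
    (hB : (parts Q).IsCell P)
    (hadd : ∀ R ∈ Λ', (∀ x y, P x y → R x y = 0) → ∀ x y, (parts Q).Has x y →
      (R * M) x y = (M * R) x y)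
    {C : Type*} {A : ℕ → ℕ → k} {cu cv : ℕ → C}
    (hpat : IsPattern (Linked b rel M parts Q (parts Q).top (parts Q).left)
      (cd P (parts Q).top) (cd P (parts Q).left) A cu cv)
    (hA : ∀ x y, (parts Q).Has x y → M x y = A (pl P x) (pl P y)) :
    ∃ P' Λ'', Stage b rel Λ M parts (Q + 1) P' Λ'' := by
  set u := (parts Q).top with hu
  set v := (parts Q).left with hv
  set E := links b rel M parts Q with hE
  have hEc : Compat P E := h.block.compat
  have huv : (parts Q).Has u v := (parts Q).has_top_left
  have hhas : ∀ x y, (parts Q).Has x y ↔ P u x ∧ P v y := hB.has_iff huv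
  have hclass : ∀ {w x y : Fin n}, P x y → (∃ z, P w z ∧ E z x) → ∃ z, P w z ∧ E z y ∧ True := by
    rintro w x y hxy ⟨z, hz, hzx⟩
    obtain ⟨z', hz', -, hyz⟩ := hEc.exists (E.symm hzx) hxy
    exact ⟨z', P.trans hz hz', E.symm hyz, trivial⟩
  have hclass_iff : ∀ {w x y : Fin n}, P x y → ((∃ z, P w z ∧ E z x) ↔ ∃ z, P w z ∧ E z y) := by
    intro w x y hxy
    constructor
    · intro hx
      obtain ⟨z, hz, hzy, -⟩ := hclass hxy hx
      exact ⟨z, hz, hzy⟩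
    · intro hy
      obtain ⟨z, hz, hzy, -⟩ := hclass (P.symm hxy) hy
      exact ⟨z, hz, hzy⟩
  have hcd : ∀ {w x : Fin n}, (∃ z, P w z ∧ E z x) → cd P x = cd P w := by
    rintro w x ⟨z, hz, hzx⟩
    rw [cd_eq hz, (hEc z x hzx).1]
  set col := color P E u v cu cv with hcol
  have hcolE : ∀ x y, E x y → col x = col y := by
    intro x y hxy
    have h1 : ∀ w, (∃ z, P w z ∧ E z x) ↔ ∃ z, P w z ∧ E z y := fun w =>
      ⟨fun ⟨z, hz, hzx⟩ => ⟨z, hz, E.trans hzx hxy⟩,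
        fun ⟨z, hz, hzy⟩ => ⟨z, hz, E.trans hzy (E.symm hxy)⟩⟩
    by_cases hu' : ∃ z, P u z ∧ E z x
    · rw [hcol, color_left hu', color_left ((h1 u).1 hu'), (hEc x y hxy).2.1]
    · have hu'' := fun h => hu' ((h1 u).2 h)
      by_cases hv' : ∃ z, P v z ∧ E z x
      · rw [hcol, color_right hu' hv', color_right hu'' ((h1 v).1 hv'), (hEc x y hxy).2.1]
      · rw [hcol, color_none hu' hv', color_none hu'' fun h => hv' ((h1 v).2 h)]
  have hcolu : ∀ x, P u x → col x = some (cu (pl P x)) := fun x hx => if_pos ⟨x, hx, E.refl x⟩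
  -- In the linked case `color` gives precedence to the row colors; `color_eq` makes this harmless.
  have hcolv : ∀ y, P v y → col y = some (cv (pl P y)) := by
    intro y hy
    by_cases hl : ∃ z, P u z ∧ E z y
    · rw [hcol, color, if_pos hl, hpat.color_eq]
      · obtain ⟨z, hz, hzy⟩ := hclass (P.symm hy) hl
        exact h.linked_iff.2 ⟨z, hz, hzy.1⟩
      · rw [← hcd hl]
        exact pl_lt_cd P y
    · rw [hcol, color, if_neg hl, if_pos ⟨y, hy, E.refl y⟩]
  have hltu : ∀ {x}, P u x → pl P x < cd P u := fun hx => by rw [cd_eq hx]; exact pl_lt_cd P _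
  have hltv : ∀ {x}, P v x → pl P x < cd P v := fun hx => by rw [cd_eq hx]; exact pl_lt_cd P _
  have hsame : ∀ {x y}, (parts Q).Has x y → M x y ≠ 0 →
      Linked b rel M parts Q u v ∧ cu (pl P x) = cv (pl P y) → E x y := by
    intro x y hxy hM hd
    have hxy' := (hhas x y).1 hxy
    refine h.links_of_linked hB hd.1 hxy ?_
    obtain ⟨μ, hμ⟩ := hpat.scalar hd.1 (cu (pl P x))
    have := hμ _ (hltu hxy'.1) _ (hltv hxy'.2) rfl hd.2.symm
    by_contra hn
    rw [if_neg hn, ← hA x y hxy] at this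
    exact hM this
  have hcommute : ∀ S ∈ Λ', (∀ x y, (parts Q).Has x y → (S * M) x y = (M * S) x y) → _ :=
    fun S hS hSM => hpat.commute (subEntry S (cls P u) (cls P u)) (subEntry S (cls P v) (cls P v))
      (fun hl a ha c hc => by
        obtain ⟨x, hx, rfl⟩ := exists_pl_eq ha
        obtain ⟨y, hy, rfl⟩ := exists_pl_eq hc
        obtain ⟨z, hz, hzv⟩ := h.linked_iff.1 hl
        obtain ⟨x', hx', hpx, hEx⟩ := hEc.exists hzv (P.trans (P.symm hz) hx)
        obtain ⟨y', hy', hpy, hEy⟩ := hEc.exists hzv (P.trans (P.symm hz) hy)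
        rw [subEntry_cls S hx hy, hpx, hpy, subEntry_cls S hx' hy']
        exact h.block.diag S hS x x' y y' hEx hEy (P.trans (P.symm hx) hy)
          (P.trans (P.symm hx') hy'))
      (h.intertwine hB hadd hA hS hSM huv)
  refine ⟨P ⊓ Setoid.ker col, h.succ hΛ hp ho hB inf_le_left ?_ ?_ ?_ ?_ ?_ ?_⟩
  · rintro x y z hxy hyz ⟨hxz, hc⟩
    have hxy' : P x y := h.subdiv.convex x y z hxy hyz hxz
    have hyz' : P y z := P.trans (P.symm hxy') hxz
    have hle : ∀ {x y}, x ≤ y → P x y → pl P x ≤ pl P y := by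
      intro x y hxy hP
      by_contra hlt
      exact hxy.not_gt ((pl_lt_pl_iff (P.symm hP)).1 (not_le.1 hlt))
    refine ⟨hxy', ?_⟩
    have hc : col x = col z := hc
    show col x = col y
    by_cases h1 : ∃ z, P u z ∧ E z x
    · rw [hcol, color_left h1, color_left ((hclass_iff hxz).1 h1), Option.some_inj] at hc
      rw [hcol, color_left h1, color_left ((hclass_iff hxy').1 h1), Option.some_inj]
      refine hpat.convex_u _ _ _ (hle hxy hxy') (hle hyz hyz') ?_ hc
      rw [← hcd ((hclass_iff hxz).1 h1)]
      exact pl_lt_cd P z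
    · have h1y := fun h => h1 ((hclass_iff hxy').2 h)
      have h1z := fun h => h1 ((hclass_iff hxz).2 h)
      by_cases h2 : ∃ z, P v z ∧ E z x
      · rw [hcol, color_right h1 h2, color_right h1z ((hclass_iff hxz).1 h2), Option.some_inj] at hc
        rw [hcol, color_right h1 h2, color_right h1y ((hclass_iff hxy').1 h2), Option.some_inj]
        refine hpat.convex_v _ _ _ (hle hxy hxy') (hle hyz hyz') ?_ hc
        rw [← hcd ((hclass_iff hxz).1 h2)]
        exact pl_lt_cd P z
      · rw [hcol, color_none h1 h2, color_none h1y fun h => h2 ((hclass_iff hxy').2 h)]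
  · rintro x y x' y' hxy hxy' _ hyy ⟨-, hxx⟩
    refine ⟨hyy, ?_⟩
    have hxx : col x = col x' := hxx
    show col y = col y'
    rw [← hcolE x y hxy, ← hcolE x' y' hxy', hxx]
  · intro x y hxy
    by_cases h0 : ∀ z w, (P ⊓ Setoid.ker col) x z → (P ⊓ Setoid.ker col) y w → M z w = 0
    · exact Or.inl h0
    · push Not at h0
      obtain ⟨z, w, hz, hw, hne⟩ := h0
      have hxy' := (hhas x y).1 hxy
      have huz : P u z := P.trans hxy'.1 hz.1
      have hvw : P v w := P.trans hxy'.2 hw.1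
      have hzw := (hhas z w).2 ⟨huz, hvw⟩
      have hcu : ∀ {z'}, (P ⊓ Setoid.ker col) z z' → cu (pl P z) = cu (pl P z') := by
        intro z' hz'
        have h1 : col z = col z' := hz'.2
        rwa [hcolu z huz, hcolu z' (P.trans huz hz'.1), Option.some_inj] at h1
      have hcv : ∀ {w'}, (P ⊓ Setoid.ker col) w w' → cv (pl P w) = cv (pl P w') := by
        intro w' hw'
        have h1 : col w = col w' := hw'.2
        rwa [hcolv w hvw, hcolv w' (P.trans hvw hw'.1), Option.some_inj] at h1
      -- The nonzero entry at `(z, w)` serves as a base point of its cell.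
      suffices hs : ∃ lam, ScalarBlock M (P ⊓ Setoid.ker col) lam z w by
        obtain ⟨lam, h1, h2⟩ := hs
        refine Or.inr ⟨lam, by rw [cd_eq hz, cd_eq hw, h1], fun z' w' hz' hw' => ?_⟩
        exact h2 z' w' (Setoid.trans' _ (Setoid.symm' _ hz) hz')
          (Setoid.trans' _ (Setoid.symm' _ hw) hw')
      -- Cells of equal color in the linked case are scalar by the pattern. All other cells consist
      -- of zeros and ones, and there the ones are shown to match positions.
      by_cases hd : Linked b rel M parts Q u v ∧ cu (pl P z) = cv (pl P w)
      · have hEzw := hsame hzw hne hd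
        obtain ⟨μ, hμ⟩ := hpat.scalar hd.1 (cu (pl P z))
        have hiso := compat_refine hEc (P' := P ⊓ Setoid.ker col) inf_le_left
          (fun x y x' y' hxy hxy' _ hyy hxx => ⟨hyy, by
            have hxx : col x = col x' := hxx.2
            show col y = col y'
            rw [← hcolE x y hxy, ← hcolE x' y' hxy', hxx]⟩) hEzw
        refine ⟨μ, hiso.1, fun z' w' hz' hw' => ?_⟩
        have huz' := P.trans huz hz'.1
        have hvw' := P.trans hvw hw'.1
        rw [hA z' w' ((hhas z' w').2 ⟨huz', hvw'⟩),
          hμ _ (hltu huz') _ (hltv hvw') (hcu hz').symm ((hcv hw').symm.trans hd.2.symm)]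
        refine if_congr ?_ rfl rfl
        rw [hiso.2 z' w' hz' hw']
        exact ⟨fun hp => (hEc z w hEzw).2.2 z' w' hz'.1 hw'.1 hp, fun hE => (hEc _ _ hE).2.1⟩
      · have h01 : ∀ z' w', (P ⊓ Setoid.ker col) z z' → (P ⊓ Setoid.ker col) w w' →
            M z' w' = 0 ∨ M z' w' = 1 := by
          intro z' w' hz' hw'
          have huz' := P.trans huz hz'.1
          have hvw' := P.trans hvw hw'.1
          rw [hA z' w' ((hhas z' w').2 ⟨huz', hvw'⟩)]
          refine hpat.zero_or_one _ (hltu huz') _ (hltv hvw') fun hd' => hd ⟨hd'.1, ?_⟩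
          rw [hcu hz', hcv hw', hd'.2]
        have hone : A (pl P z) (pl P w) = 1 := by
          rw [← hA z w hzw]
          exact (h01 z w (Setoid.refl' _ _) (Setoid.refl' _ _)).resolve_left hne
        have hiso := class_iso (P := P ⊓ Setoid.ker col) (x := z) (y := w)
          (fun z' w' => M z' w' = 1) ?_ ?_ ?_
        · refine ⟨1, hiso.1, fun z' w' hz' hw' => ?_⟩
          split_ifs with hpl
          · exact (hiso.2 z' w' hz' hw').1 hpl
          · exact (h01 z' w' hz' hw').resolve_right fun h1 => hpl ((hiso.2 z' w' hz' hw').2 h1)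
        · intro z' hz'
          have huz' := P.trans huz hz'.1
          obtain ⟨c', hc', hcc, hAc⟩ := hpat.exists_right _ (hltu huz) _ (hltv hvw) hd hone _
            (hltu huz') (hcu hz')
          obtain ⟨w', hw', rfl⟩ := exists_pl_eq hc'
          refine ⟨w', ⟨P.trans (P.symm hvw) hw', ?_⟩, ?_⟩
          · show col w = col w'
            rw [hcolv w hvw, hcolv w' hw', hcc]
          · rw [hA z' w' ((hhas z' w').2 ⟨huz', hw'⟩), hAc]
        · intro w' hw'
          have hvw' := P.trans hvw hw'.1
          obtain ⟨a', ha', hca, hAa⟩ := hpat.exists_left _ (hltu huz) _ (hltv hvw) hd hone _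
            (hltv hvw') (hcv hw')
          obtain ⟨z', hz', rfl⟩ := exists_pl_eq ha'
          refine ⟨z', ⟨P.trans (P.symm huz) hz', ?_⟩, ?_⟩
          · show col z = col z'
            rw [hcolu z huz, hcolu z' hz', hca]
          · rw [hA z' w' ((hhas z' w').2 ⟨hz', hvw'⟩), hAa]
        · intro z₁ z₂ w₁ w₂ hz₁ hz₂ hw₁ hw₂ h1 h2
          have huz₁ := P.trans huz hz₁.1
          have huz₂ := P.trans huz hz₂.1
          have hvw₁ := P.trans hvw hw₁.1
          have hvw₂ := P.trans hvw hw₂.1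
          rw [hA z₁ w₁ ((hhas _ _).2 ⟨huz₁, hvw₁⟩)] at h1
          rw [hA z₂ w₂ ((hhas _ _).2 ⟨huz₂, hvw₂⟩)] at h2
          rw [← pl_lt_pl_iff (P.trans (P.symm hz₁.1) hz₂.1),
            ← pl_lt_pl_iff (P.trans (P.symm hw₁.1) hw₂.1)]
          refine hpat.lt_iff _ (hltu huz₁) _ (hltv hvw₁) _ (hltu huz₂) _ (hltv hvw₂)
            (fun hd' => hd ⟨hd'.1, ?_⟩) ((hcu hz₁).symm.trans (hcu hz₂))
            ((hcv hw₁).symm.trans (hcv hw₂)) h1 h2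
          rw [hcu hz₁, hcv hw₁, hd'.2]
  · intro x y hxy hne
    by_cases hd : Linked b rel M parts Q u v ∧ cu (pl P x) = cv (pl P y)
    · exact links_mono (Nat.le_succ _) (hsame hxy hne hd)
    · have hxy' := (hhas x y).1 hxy
      refine .rel _ _ (Or.inr ⟨Q, Nat.lt_succ_self _, hxy, ?_⟩)
      rw [hA x y hxy] at hne ⊢
      exact (hpat.zero_or_one _ (hltu hxy'.1) _ (hltv hxy'.2) hd).resolve_left hne
  · intro S hS hSM x y hlt hP hn
    have hne : col x ≠ col y := fun hc => hn ⟨hP, hc⟩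
    obtain ⟨hX, hY, -⟩ := hcommute S hS hSM
    -- An entry in a class linked with that of `w` equals the corresponding entry in the class of
    -- `w`, where `commute` applies.
    have transfer : ∀ w, (∃ z, P w z ∧ E z x) → ∃ x' y', P w x' ∧ P w y' ∧ S x y = S x' y' ∧
        pl P y' < pl P x' ∧ col x' ≠ col y' := by
      rintro w ⟨x', hx', hEx⟩
      obtain ⟨y', hy', hpy, hEy⟩ := hEc.exists (E.symm hEx) hP
      refine ⟨x', y', hx', P.trans hx' hy', h.block.diag S hS x x' y y' (E.symm hEx) hEy hP hy', ?_,
        ?_⟩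
      · rw [← hpy, (hEc _ _ hEx).2.1]
        exact (pl_lt_pl_iff (P.symm hP)).2 hlt
      · rwa [hcolE _ _ hEx, ← hcolE _ _ hEy]
    by_cases h1 : ∃ z, P u z ∧ E z x
    · obtain ⟨x', y', hx', hy', hSxy, hlt', hc⟩ := transfer u h1
      rw [hSxy, ← subEntry_cls S hx' hy']
      refine hX _ (hltu hx') _ hlt' fun hcc => hc ?_
      rw [hcolu x' hx', hcolu y' hy', hcc]
    · by_cases h2 : ∃ z, P v z ∧ E z x
      · obtain ⟨x', y', hx', hy', hSxy, hlt', hc⟩ := transfer v h2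
        rw [hSxy, ← subEntry_cls S hx' hy']
        refine hY _ (hltv hx') _ hlt' fun hcc => hc ?_
        rw [hcolv x' hx', hcolv y' hy', hcc]
      · exfalso
        apply hne
        rw [hcol, color_none h1 h2, color_none (fun h => h1 ((hclass_iff hP).2 h))
          fun h => h2 ((hclass_iff hP).2 h)]
  · intro S hS hSM x x' y y' hx hMx hy hMy hxy hxy'
    obtain ⟨-, -, hF⟩ := hcommute S hS hSM
    have hx' := (hhas x x').1 hx
    have hy' := (hhas y y').1 hy
    have hcu : cu (pl P x) = cu (pl P y) := by
      have h1 : col x = col y := hxy.2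
      rwa [hcolu x hx'.1, hcolu y hy'.1, Option.some_inj] at h1
    have hcv : cv (pl P x') = cv (pl P y') := by
      have h1 : col x' = col y' := hxy'.2
      rwa [hcolv x' hx'.2, hcolv y' hy'.2, Option.some_inj] at h1
    by_cases hd : Linked b rel M parts Q u v ∧ cu (pl P x) = cv (pl P x')
    · have e1 := hsame hx (by rw [hMx]; exact one_ne_zero) hd
      have e2 := hsame hy (by rw [hMy]; exact one_ne_zero) ⟨hd.1, by rw [← hcu, ← hcv, hd.2]⟩
      exact h.block.diag S hS x x' y y' e1 e2 hxy.1 hxy'.1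
    · rw [hA x x' hx] at hMx
      rw [hA y y' hy] at hMy
      have := hF _ (hltu hx'.1) _ (hltv hx'.2) _ (hltu hy'.1) _ (hltv hy'.2) hd hcu hcv hMx hMy
      rwa [subEntry_cls S hx'.1 hy'.1, subEntry_cls S hx'.2 hy'.2] at this

end Pattern

end Belitskii

namespace Belitskii

/-! ### Matrices intertwined by `[0 I; 0 0]` -/

section RankPattern

variable {k : Type*} [Field k]

/-- Rows are cut after the first `ρ`, columns before the last `ρ`. `X A` moves the first `ρ` columns
of `X` to the right end, and `A Y` lifts the last `ρ` rows of `Y` to the top. Comparison kills the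
lower left blocks of `X` and `Y` and equates the upper left block of `X` with the lower right block
of `Y`. -/
theorem isPattern_rank {linked : Prop} (hl : ¬ linked) {h w ρ : ℕ} (hh : ρ ≤ h) (hw : ρ ≤ w)
    {A : ℕ → ℕ → k}
    (hA : ∀ a < h, ∀ c < w, A a c = if a < ρ ∧ c = w - ρ + a then 1 else 0) :
    IsPattern linked h w A (fun a => a < ρ) (fun c => c < w - ρ) := by
  have h1 : ∀ {a c}, a < h → c < w → A a c = 1 → a < ρ ∧ c = w - ρ + a := by
    intro a c ha hc h1
    rw [hA a ha c hc] at h1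
    by_contra hn
    rw [if_neg hn] at h1
    exact zero_ne_one h1
  refine ⟨fun h => absurd h hl, ?_, ?_, fun h => absurd h hl, ?_, ?_, ?_, ?_, ?_⟩
  · intro a b c hab hbc _ hac
    simp only [eq_iff_iff] at hac ⊢
    omega
  · intro a b c hab hbc _ hac
    simp only [eq_iff_iff] at hac ⊢
    omega
  · intro a ha c hc _
    rw [hA a ha c hc]
    split_ifs
    · exact Or.inr rfl
    · exact Or.inl rfl
  · intro a ha c hc _ hac a' ha' haa
    obtain ⟨h2, h3⟩ := h1 ha hc hac
    have h2' : a' < ρ := haa.mp h2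
    refine ⟨w - ρ + a', by omega, ?_, ?_⟩
    · rw [eq_iff_iff]; omega
    · rw [hA a' ha' _ (by omega), if_pos ⟨h2', rfl⟩]
  · intro a ha c hc _ hac c' hc' hcc
    obtain ⟨h2, h3⟩ := h1 ha hc hac
    have h4 : ¬ c' < w - ρ := fun h => by have := hcc.mpr h; omega
    refine ⟨c' - (w - ρ), by omega, ?_, ?_⟩
    · rw [eq_iff_iff]; omega
    · rw [hA _ (by omega) c' hc', if_pos ⟨by omega, by omega⟩]
  · intro a ha c hc a' ha' c' hc' _ _ _ hac hac'
    have := h1 ha hc hac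
    have := h1 ha' hc' hac'
    omega
  · intro X Y _ hXY
    have hL : ∀ a < h, ∀ c < w, ∀ z < ρ, c = w - ρ + z →
        ∑ v ∈ Finset.range h, X a v * A v c = X a z := by
      intro a ha c hc z hz hcz
      rw [Finset.sum_eq_single z]
      · rw [hA z (by omega) c hc, if_pos ⟨hz, hcz⟩, mul_one]
      · intro v hv hvz
        rw [hA v (Finset.mem_range.1 hv) c hc, if_neg (by omega), mul_zero]
      · intro hz'
        exact absurd (Finset.mem_range.2 (by omega)) hz'
    have hL0 : ∀ a < h, ∀ c < w, c < w - ρ → ∑ v ∈ Finset.range h, X a v * A v c = 0 := by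
      intro a ha c hc hcw
      refine Finset.sum_eq_zero fun v hv => ?_
      rw [hA v (Finset.mem_range.1 hv) c hc, if_neg (by omega), mul_zero]
    have hR : ∀ a < ρ, ∀ c < w, ∑ v ∈ Finset.range w, A a v * Y v c = Y (w - ρ + a) c := by
      intro a ha c hc
      rw [Finset.sum_eq_single (w - ρ + a)]
      · rw [hA a (by omega) _ (by omega), if_pos ⟨ha, rfl⟩, one_mul]
      · intro v hv hva
        rw [hA a (by omega) v (Finset.mem_range.1 hv), if_neg (fun h => hva h.2), zero_mul]
      · intro hz'
        exact absurd (Finset.mem_range.2 (by omega)) hz'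
    have hR0 : ∀ a < h, ρ ≤ a → ∀ c < w, ∑ v ∈ Finset.range w, A a v * Y v c = 0 := by
      intro a ha hρ c hc
      refine Finset.sum_eq_zero fun v hv => ?_
      rw [hA a ha v (Finset.mem_range.1 hv), if_neg (by omega), zero_mul]
    refine ⟨?_, ?_, ?_⟩
    · intro a ha c hca hne
      have : c < ρ ∧ ρ ≤ a := by
        rw [ne_eq, eq_iff_iff] at hne
        omega
      rw [← hL a ha (w - ρ + c) (by omega) c this.1 rfl, hXY a ha _ (by omega),
        hR0 a ha this.2 _ (by omega)]
    · intro a ha c hca hne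
      have : c < w - ρ ∧ w - ρ ≤ a := by
        rw [ne_eq, eq_iff_iff] at hne
        omega
      have e : w - ρ + (a - (w - ρ)) = a := by omega
      have := hR (a - (w - ρ)) (by omega) c (by omega)
      rw [e] at this
      rw [← this, ← hXY _ (by omega) c (by omega), hL0 _ (by omega) c (by omega) (by omega)]
    · intro a ha c hc a' ha' c' hc' _ _ _ hac hac'
      obtain ⟨h2, h3⟩ := h1 ha hc hac
      obtain ⟨h4, h5⟩ := h1 ha' hc' hac'
      rw [h3, ← hR a h2 c' hc', ← hXY a ha c' hc', hL a ha c' hc' a' h4 h5]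

end RankPattern

/-! ### The centralizer of a Weyr matrix -/

section WeyrPattern

variable {k : Type*} [Field k]

/-- The coordinates of rows of a Weyr matrix of size `h`: the number `ii` of the eigenvalue `lam`,
the number `jj` of the diagonal block, the number `aa` of the row inside of this block, and the
number `ht` of diagonal blocks having such a row. -/
structure WeyrShape (h : ℕ) (A : ℕ → ℕ → k) (ii jj aa ht : ℕ → ℕ) (lam : ℕ → k) : Prop where
  lt_iff : ∀ x < h, ∀ y < h, x < y ↔
    ii x < ii y ∨ ii x = ii y ∧ (jj x < jj y ∨ jj x = jj y ∧ aa x < aa y)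
  jj_lt : ∀ x < h, jj x < ht x
  ht_le : ∀ x < h, ∀ y < h, ii x = ii y → aa x ≤ aa y → ht y ≤ ht x
  exists_eq : ∀ x < h, ∀ j < ht x, ∃ y < h, ii y = ii x ∧ jj y = j ∧ aa y = aa x
  lam_eq_iff : ∀ x < h, ∀ y < h, lam x = lam y ↔ ii x = ii y
  entry : ∀ x < h, ∀ y < h, A x y = if x = y then lam x else
    if ii x = ii y ∧ jj x + 1 = jj y ∧ aa x = aa y then 1 else 0

namespace WeyrShape

variable {h : ℕ} {A : ℕ → ℕ → k} {ii jj aa ht : ℕ → ℕ} {lam : ℕ → k}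

theorem eq_of_eq (H : WeyrShape h A ii jj aa ht lam) {x y : ℕ} (hx : x < h) (hy : y < h)
    (h1 : ii x = ii y) (h2 : jj x = jj y) (h3 : aa x = aa y) : x = y := by
  have e1 := H.lt_iff x hx y hy
  have e2 := H.lt_iff y hy x hx
  omega

theorem ht_eq (H : WeyrShape h A ii jj aa ht lam) {x y : ℕ} (hx : x < h) (hy : y < h)
    (h1 : ii x = ii y) (h3 : aa x = aa y) : ht x = ht y :=
  le_antisymm (H.ht_le y hy x hx h1.symm h3.symm.le) (H.ht_le x hx y hy h1 h3.le)

/-- Rows with common `ii` and `aa` form a Jordan chain of length `ht`, with `jj` as position. Column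
`c` contains `lam c` and one `1`, in the row preceding `c` in its chain, if there is one. -/
theorem sum_left (H : WeyrShape h A ii jj aa ht lam) (X : ℕ → ℕ → k) {a c : ℕ} (hc : c < h) :
    (∀ p < h, ii p = ii c → jj p + 1 = jj c → aa p = aa c →
      ∑ z ∈ Finset.range h, X a z * A z c = X a c * lam c + X a p) ∧
    (jj c = 0 → ∑ z ∈ Finset.range h, X a z * A z c = X a c * lam c) := by
  constructor
  · intro p hp h1 h2 h3
    have hne : c ≠ p := by rintro rfl; omega
    have hsub : ({c, p} : Finset ℕ) ⊆ Finset.range h := by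
      intro z hz
      simp only [Finset.mem_insert, Finset.mem_singleton] at hz
      rcases hz with rfl | rfl <;> simpa
    rw [← Finset.sum_subset hsub, Finset.sum_pair hne, H.entry c hc c hc, if_pos rfl,
      H.entry p hp c hc, if_neg hne.symm, if_pos ⟨h1, h2, h3⟩, mul_one]
    intro z hz hz'
    simp only [Finset.mem_insert, Finset.mem_singleton, not_or] at hz'
    rw [Finset.mem_range] at hz
    rw [H.entry z hz c hc, if_neg hz'.1, if_neg, mul_zero]
    rintro ⟨e1, e2, e3⟩
    exact hz'.2 (H.eq_of_eq hz hp (e1.trans h1.symm) (by omega) (e3.trans h3.symm))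
  · intro h0
    rw [Finset.sum_eq_single c]
    · rw [H.entry c hc c hc, if_pos rfl]
    · intro z hz hz'
      rw [H.entry z (Finset.mem_range.1 hz) c hc, if_neg hz', if_neg (by omega), mul_zero]
    · intro hn
      exact absurd (Finset.mem_range.2 hc) hn

theorem sum_right (H : WeyrShape h A ii jj aa ht lam) (X : ℕ → ℕ → k) {a c : ℕ} (ha : a < h) :
    (∀ s < h, ii a = ii s → jj a + 1 = jj s → aa a = aa s →
      ∑ z ∈ Finset.range h, A a z * X z c = lam a * X a c + X s c) ∧
    (jj a + 1 = ht a → ∑ z ∈ Finset.range h, A a z * X z c = lam a * X a c) := by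
  constructor
  · intro s hs h1 h2 h3
    have hne : a ≠ s := by rintro rfl; omega
    have hsub : ({a, s} : Finset ℕ) ⊆ Finset.range h := by
      intro z hz
      simp only [Finset.mem_insert, Finset.mem_singleton] at hz
      rcases hz with rfl | rfl <;> simpa
    rw [← Finset.sum_subset hsub, Finset.sum_pair hne, H.entry a ha a ha, if_pos rfl,
      H.entry a ha s hs, if_neg hne, if_pos ⟨h1, h2, h3⟩, one_mul]
    intro z hz hz'
    simp only [Finset.mem_insert, Finset.mem_singleton, not_or] at hz'
    rw [Finset.mem_range] at hz
    rw [H.entry a ha z hz, if_neg (fun e => hz'.1 e.symm), if_neg, zero_mul]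
    rintro ⟨e1, e2, e3⟩
    exact hz'.2 (H.eq_of_eq hz hs (e1.symm.trans h1) (by omega) (e3.symm.trans h3))
  · intro h0
    rw [Finset.sum_eq_single a]
    · rw [H.entry a ha a ha, if_pos rfl]
    · intro z hz hz'
      rw [Finset.mem_range] at hz
      rw [H.entry a ha z hz, if_neg (fun e => hz' e.symm), if_neg, zero_mul]
      rintro ⟨e1, e2, e3⟩
      have := H.ht_eq ha hz e1 e3
      have := H.jj_lt z hz
      omega
    · intro hn
      exact absurd (Finset.mem_range.2 ha) hn

theorem exists_pred (H : WeyrShape h A ii jj aa ht lam) {c : ℕ} (hc : c < h) :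
    jj c = 0 ∨ ∃ p < h, ii p = ii c ∧ jj p + 1 = jj c ∧ aa p = aa c := by
  by_cases h0 : jj c = 0
  · exact Or.inl h0
  · have := H.jj_lt c hc
    obtain ⟨p, hp, h1, h2, h3⟩ := H.exists_eq c hc (jj c - 1) (by omega)
    exact Or.inr ⟨p, hp, h1, by omega, h3⟩

theorem exists_succ (H : WeyrShape h A ii jj aa ht lam) {a : ℕ} (ha : a < h) :
    jj a + 1 = ht a ∨ ∃ s < h, ii a = ii s ∧ jj a + 1 = jj s ∧ aa a = aa s := by
  by_cases h0 : jj a + 1 = ht a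
  · exact Or.inl h0
  · have := H.jj_lt a ha
    obtain ⟨s, hs, h1, h2, h3⟩ := H.exists_eq a ha (jj a + 1) (by omega)
    exact Or.inr ⟨s, hs, h1.symm, h2.symm, h3.symm⟩

/-- The commutation relation expresses `(lam c - lam a) * X a c` through entries at the chain
successor of `a` and the chain predecessor of `c`. Each such move lowers `ht a - jj a + jj c`, so
induction applies. -/
theorem apply_eq_zero_of_lam_ne (H : WeyrShape h A ii jj aa ht lam) {X : ℕ → ℕ → k}
    (hX : ∀ a < h, ∀ c < h,
      ∑ z ∈ Finset.range h, X a z * A z c = ∑ z ∈ Finset.range h, A a z * X z c) :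
    ∀ N : ℕ, ∀ a < h, ∀ c < h, ht a - jj a + jj c = N →
    lam a ≠ lam c → X a c = 0 := by
  intro N
  induction N using Nat.strong_induction_on with
  | _ N ih =>
    intro a ha c hc hN hne
    have key := hX a ha c hc
    have hsub : lam c - lam a ≠ 0 := sub_ne_zero.2 hne.symm
    have hja := H.jj_lt a ha
    have hl : ∑ z ∈ Finset.range h, X a z * A z c = X a c * lam c := by
      rcases H.exists_pred hc with h0 | ⟨p, hp, h1, h2, h3⟩
      · exact (H.sum_left X hc).2 h0
      · rw [(H.sum_left X hc).1 p hp h1 h2 h3, ih (ht a - jj a + jj p) (by omega) a ha p hp rfl,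
          add_zero]
        rwa [(H.lam_eq_iff p hp c hc).2 h1]
    have hr : ∑ z ∈ Finset.range h, A a z * X z c = lam a * X a c := by
      rcases H.exists_succ ha with h0 | ⟨s, hs, h1, h2, h3⟩
      · exact (H.sum_right X ha).2 h0
      · have hht := H.ht_eq ha hs h1 h3
        have hjs := H.jj_lt s hs
        rw [(H.sum_right X ha).1 s hs h1 h2 h3, ih (ht s - jj s + jj c) (by omega) s hs c hc rfl,
          add_zero]
        rwa [← (H.lam_eq_iff a ha s hs).2 h1]
    rw [hl, hr] at key
    have : (lam c - lam a) * X a c = 0 := by linear_combination key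
    exact (mul_eq_zero.1 this).resolve_left hsub

/-- For equal eigenvalues the diagonal terms cancel, so `X` is constant along simultaneous shifts in
two chains. -/
theorem apply_succ (H : WeyrShape h A ii jj aa ht lam) {X : ℕ → ℕ → k}
    (hX : ∀ a < h, ∀ c < h,
      ∑ z ∈ Finset.range h, X a z * A z c = ∑ z ∈ Finset.range h, A a z * X z c)
    {a c a' c' : ℕ} (ha : a < h) (ha' : a' < h) (hc : c < h) (hc' : c' < h)
    (hac : ii a = ii c)
    (h1 : ii a = ii a' ∧ jj a + 1 = jj a' ∧ aa a = aa a')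
    (h2 : ii c = ii c' ∧ jj c + 1 = jj c' ∧ aa c = aa c') : X a c = X a' c' := by
  have key := hX a ha c' hc'
  rw [(H.sum_left X hc').1 c hc h2.1 h2.2.1 h2.2.2,
    (H.sum_right X ha).1 a' ha' h1.1 h1.2.1 h1.2.2,
    (H.lam_eq_iff a ha c' hc').2 (hac.trans h2.1)] at key
  linear_combination key

/-- When both indices are shifted back, `c` reaches the start of its chain first; the next relation
then equates the entry with `0`. -/
theorem apply_eq_zero_of_jj_lt (H : WeyrShape h A ii jj aa ht lam) {X : ℕ → ℕ → k}
    (hX : ∀ a < h, ∀ c < h,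
      ∑ z ∈ Finset.range h, X a z * A z c = ∑ z ∈ Finset.range h, A a z * X z c) :
    ∀ N : ℕ, ∀ a < h, ∀ c < h, jj c = N → ii a = ii c →
    jj c < jj a → X a c = 0 := by
  intro N
  induction N with
  | zero =>
    intro a ha c hc hN hac hlt
    rcases H.exists_pred ha with h0 | ⟨p, hp, h1, h2, h3⟩
    · omega
    · have key := hX p hp c hc
      rw [(H.sum_left X hc).2 hN, (H.sum_right X hp).1 a ha h1 h2 h3,
        (H.lam_eq_iff p hp c hc).2 (h1.trans hac)] at key
      linear_combination -key
  | succ N ih =>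
    intro a ha c hc hN hac hlt
    rcases H.exists_pred ha with h0 | ⟨p, hp, h1, h2, h3⟩
    · omega
    · rcases H.exists_pred hc with h0' | ⟨p', hp', h1', h2', h3'⟩
      · omega
      · rw [← apply_succ H hX hp ha hp' hc (h1.trans (hac.trans h1'.symm)) ⟨h1, h2, h3⟩
          ⟨h1', h2', h3'⟩]
        exact ih p hp p' hp' (by omega) (h1.trans (hac.trans h1'.symm)) (by omega)

/-- When both indices are shifted forward, `a` reaches the end of its chain first. -/
theorem apply_eq_zero_of_ht_lt (H : WeyrShape h A ii jj aa ht lam) {X : ℕ → ℕ → k}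
    (hX : ∀ a < h, ∀ c < h,
      ∑ z ∈ Finset.range h, X a z * A z c = ∑ z ∈ Finset.range h, A a z * X z c) :
    ∀ N : ℕ, ∀ a < h, ∀ c < h, ht a - jj a = N → ii a = ii c →
    ht a - jj a < ht c - jj c → X a c = 0 := by
  intro N
  induction N with
  | zero =>
    intro a ha c hc hN
    have := H.jj_lt a ha
    omega
  | succ N ih =>
    intro a ha c hc hN hac hlt
    rcases H.exists_succ hc with h0' | ⟨s', hs', h1', h2', h3'⟩
    · omega
    · rcases H.exists_succ ha with h0 | ⟨s, hs, h1, h2, h3⟩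
      · have key := hX a ha s' hs'
        rw [(H.sum_left X hs').1 c hc h1' h2' h3', (H.sum_right X ha).2 h0,
          (H.lam_eq_iff a ha s' hs').2 (hac.trans h1')] at key
        linear_combination key
      · rw [apply_succ H hX ha hs hc hs' hac ⟨h1, h2, h3⟩ ⟨h1', h2', h3'⟩]
        have := H.ht_eq ha hs h1 h3
        have := H.ht_eq hc hs' h1' h3'
        exact ih s hs s' hs' (by omega) (h1.symm.trans (hac.trans h1')) (by omega)

/-- The color is the eigenvalue, the diagonal block and the chain length. The length must be
included because matrices of the centralizer are triangular inside a diagonal block with respect to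
it. -/
theorem isPattern (H : WeyrShape h A ii jj aa ht lam) {linked : Prop} (hl : linked) :
    IsPattern linked h h A (fun x => (ii x, jj x, ht x)) (fun x => (ii x, jj x, ht x)) := by
  have hcolor : ∀ x y, ((ii x, jj x, ht x) = (ii y, jj y, ht y)) ↔
      ii x = ii y ∧ jj x = jj y ∧ ht x = ht y := by
    intro x y
    simp only [Prod.mk.injEq]
  have hconv : ∀ a b c, a ≤ b → b ≤ c → c < h →
      (ii a, jj a, ht a) = (ii c, jj c, ht c) → (ii a, jj a, ht a) = (ii b, jj b, ht b) := by
    intro a b c hab hbc hc hac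
    rw [hcolor] at hac ⊢
    have e1 := H.lt_iff b (by omega) a (by omega)
    have e2 := H.lt_iff c hc b (by omega)
    have h1 : ii a = ii b := by omega
    have h2 : jj a = jj b := by omega
    have h3 := H.ht_le a (by omega) b (by omega) h1 (by omega)
    have h4 := H.ht_le b (by omega) c (by omega) (by omega) (by omega)
    exact ⟨h1, h2, by omega⟩
  have hone : ∀ {a c}, a < h → c < h →
      ¬ (linked ∧ (ii a, jj a, ht a) = (ii c, jj c, ht c)) → A a c = 1 →
      ii a = ii c ∧ jj a + 1 = jj c ∧ aa a = aa c := by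
    intro a c ha hc hn h1
    have hne : a ≠ c := by rintro rfl; exact hn ⟨hl, rfl⟩
    rw [H.entry a ha c hc, if_neg hne] at h1
    by_contra hn'
    rw [if_neg hn'] at h1
    exact zero_ne_one h1
  have hstep : ∀ {a c}, a < h → c < h → ii a = ii c → jj a + 1 = jj c → aa a = aa c →
      A a c = 1 := by
    intro a c ha hc h1 h2 h3
    rw [H.entry a ha c hc, if_neg (by rintro rfl; omega), if_pos ⟨h1, h2, h3⟩]
  refine ⟨fun _ _ _ => rfl, hconv, hconv, ?_, ?_, ?_, ?_, ?_, ?_⟩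
  · intro _ i
    by_cases hi : ∃ x < h, (ii x, jj x, ht x) = i
    · obtain ⟨x, hx, rfl⟩ := hi
      refine ⟨lam x, fun a ha c hc hca hcc => ?_⟩
      rw [hcolor] at hca hcc
      rw [H.entry a ha c hc, (H.lam_eq_iff a ha x hx).2 hca.1, if_neg (by omega : ¬ (_ ∧ _ ∧ _))]
    · exact ⟨0, fun a ha c hc hca _ => absurd ⟨a, ha, hca⟩ hi⟩
  · intro a ha c hc hn
    have hne : a ≠ c := by rintro rfl; exact hn ⟨hl, rfl⟩
    rw [H.entry a ha c hc, if_neg hne]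
    split_ifs
    · exact Or.inr rfl
    · exact Or.inl rfl
  · intro a ha c hc hn h1 a' ha' haa
    obtain ⟨e1, e2, e3⟩ := hone ha hc hn h1
    rw [hcolor] at haa
    have hht := H.ht_eq ha hc e1 e3
    have hjc := H.jj_lt c hc
    obtain ⟨c', hc', f1, f2, f3⟩ := H.exists_eq a' ha' (jj a' + 1) (by omega)
    refine ⟨c', hc', ?_, hstep ha' hc' f1.symm f2.symm f3.symm⟩
    have := H.ht_eq hc' ha' f1 f3
    rw [hcolor]
    omega
  · intro a ha c hc hn h1 c' hc' hcc
    obtain ⟨e1, e2, e3⟩ := hone ha hc hn h1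
    rw [hcolor] at hcc
    have hht := H.ht_eq ha hc e1 e3
    rcases H.exists_pred hc' with f0 | ⟨a', ha', f1, f2, f3⟩
    · omega
    · refine ⟨a', ha', ?_, hstep ha' hc' f1 f2 f3⟩
      have := H.ht_eq ha' hc' f1 f3
      rw [hcolor]
      omega
  · intro a ha c hc a' ha' c' hc' hn hcu hcv h1 h2
    obtain ⟨e1, e2, e3⟩ := hone ha hc hn h1
    obtain ⟨f1, f2, f3⟩ := hone ha' hc' (by rwa [← hcu, ← hcv]) h2
    rw [hcolor] at hcu hcv
    have g1 := H.lt_iff a ha a' ha'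
    have g2 := H.lt_iff c hc c' hc'
    omega
  · intro X Y hXY hcomm
    have hX : ∀ a < h, ∀ c < h,
        ∑ z ∈ Finset.range h, X a z * A z c = ∑ z ∈ Finset.range h, A a z * X z c := by
      intro a ha c hc
      rw [hcomm a ha c hc]
      refine Finset.sum_congr rfl fun z hz => ?_
      rw [hXY hl z (Finset.mem_range.1 hz) c hc]
    have hzero : ∀ a < h, ∀ c < a, (ii a, jj a, ht a) ≠ (ii c, jj c, ht c) → X a c = 0 := by
      intro a ha c hca hne
      have hc := hca.trans ha
      rw [ne_eq, hcolor] at hne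
      by_cases hii : ii a = ii c
      · have e := (H.lt_iff c hc a ha).1 hca
        by_cases hjj : jj c < jj a
        · exact apply_eq_zero_of_jj_lt H hX _ a ha c hc rfl hii hjj
        -- Here `jj a = jj c`, so `c < a` means `aa c < aa a`; the chain of `c` is then no shorter,
        -- and strictly longer because the colors differ.
        · have := H.ht_le c hc a ha hii.symm (by omega)
          have := H.jj_lt a ha
          exact apply_eq_zero_of_ht_lt H hX _ a ha c hc rfl hii (by omega)
      · exact apply_eq_zero_of_lam_ne H hX _ a ha c hc rfl
          fun e => hii ((H.lam_eq_iff a ha c hc).1 e)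
    refine ⟨hzero, fun a ha c hca hne => ?_, ?_⟩
    · rw [← hXY hl a ha c (hca.trans ha)]
      exact hzero a ha c hca hne
    · intro a ha c hc a' ha' c' hc' hn hcu hcv h1 h2
      rw [← hXY hl c hc c' hc']
      have e := hone ha hc hn h1
      have f := hone ha' hc' (by rwa [← hcu, ← hcv]) h2
      rw [hcolor] at hcu
      exact apply_succ H hX ha hc ha' hc' hcu.1 e f

end WeyrShape

theorem weyrIndex_lt_iff {r : ℕ} {κ : Fin r → ℕ} {m : ∀ i, Fin (κ i) → ℕ} (p q : WeyrIndex κ m) :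
    p < q ↔ ((ofLex p).1 : ℕ) < (ofLex q).1 ∨ ((ofLex p).1 : ℕ) = (ofLex q).1 ∧
      (((ofLex (ofLex p).2).1 : ℕ) < (ofLex (ofLex q).2).1 ∨
       ((ofLex (ofLex p).2).1 : ℕ) = (ofLex (ofLex q).2).1 ∧
        ((ofLex (ofLex p).2).2 : ℕ) < (ofLex (ofLex q).2).2) := by
  obtain ⟨i, j, a⟩ := p
  obtain ⟨i', j', a'⟩ := q
  refine Sigma.Lex.lt_def.trans ?_
  constructor
  · rintro (h | ⟨h, h'⟩)
    · exact Or.inl h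
    · have h : i = i' := h
      subst h
      refine Or.inr ⟨rfl, ?_⟩
      rcases Sigma.Lex.lt_def.1 h' with h1 | ⟨h1, h2⟩
      · exact Or.inl h1
      · have h1 : j = j' := h1
        subst h1
        exact Or.inr ⟨rfl, h2⟩
  · rintro (h | ⟨h, h'⟩)
    · exact Or.inl h
    · have h : i = i' := Fin.ext h
      subst h
      refine Or.inr ⟨rfl, Sigma.Lex.lt_def.2 ?_⟩
      rcases h' with h1 | ⟨h1, h2⟩
      · exact Or.inl h1
      · have h1 : j = j' := Fin.ext h1
        subst h1
        exact Or.inr ⟨rfl, h2⟩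

variable [LinearOrder k]

/-- The height of a row is the number of diagonal blocks that have a row with its inner number.
These blocks are initial among the blocks of the eigenvalue because the sizes do not increase. -/
theorem IsWeyr.exists_shape {h w : ℕ} {A : Matrix (Fin h) (Fin w) k} (hA : IsWeyr A)
    {A' : ℕ → ℕ → k} (hA' : ∀ (a : Fin h) (c : Fin w), A a c = A' a c) :
    h = w ∧ ∃ ii jj aa ht lam, WeyrShape h A' ii jj aa ht lam := by
  obtain ⟨r, lam, κ, m, e, f, hlam, -, -, hm, hent⟩ := hA
  have hhw : h = w := by
    have := Fintype.card_congr (e.trans f.symm).toEquiv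
    simpa using this
  subst hhw
  -- Order isomorphisms from `Fin h` to a given order are unique.
  have hef : e = f := Subsingleton.elim _ _
  subst hef
  refine ⟨rfl, ?_⟩
  -- The block sizes are extended by `0`, so that the search for the first too small block always
  -- ends.
  let μ : ℕ → ℕ → ℕ := fun i j => if hi : i < r then
    if hj : j < κ ⟨i, hi⟩ then m ⟨i, hi⟩ ⟨j, hj⟩ else 0 else 0
  have hμ : ∀ i j j', j ≤ j' → μ i j' ≤ μ i j := by
    intro i j j' hjj
    simp only [μ]
    by_cases hi : i < r
    · simp only [hi, dif_pos]
      by_cases hj' : j' < κ ⟨i, hi⟩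
      · rw [dif_pos hj', dif_pos (hjj.trans_lt hj')]
        exact hm _ (show (⟨j, _⟩ : Fin _) ≤ ⟨j', _⟩ from hjj)
      · rw [dif_neg hj']
        exact Nat.zero_le _
    · simp [hi]
  have hH : ∀ i a, ∃ N, ∀ j, a < μ i j ↔ j < N := by
    intro i a
    have hex : ∃ j, ¬ a < μ i j := by
      by_cases hi : i < r
      · exact ⟨κ ⟨i, hi⟩, by simp [μ, hi]⟩
      · exact ⟨0, by simp [μ, hi]⟩
    classical
    refine ⟨Nat.find hex, fun j => ⟨fun hj => ?_, fun hj => ?_⟩⟩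
    · by_contra hle
      exact Nat.find_spec hex (hj.trans_le (hμ i _ _ (not_lt.1 hle)))
    · exact not_not.1 (Nat.find_min hex hj)
  choose N hN using hH
  let ii : ℕ → ℕ := fun x => if hx : x < h then ((ofLex (e ⟨x, hx⟩)).1 : ℕ) else 0
  let jj : ℕ → ℕ := fun x => if hx : x < h then ((ofLex (ofLex (e ⟨x, hx⟩)).2).1 : ℕ) else 0
  let aa : ℕ → ℕ := fun x => if hx : x < h then ((ofLex (ofLex (e ⟨x, hx⟩)).2).2 : ℕ) else 0
  let la : ℕ → k := fun x => if hx : x < h then lam (ofLex (e ⟨x, hx⟩)).1 else 0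
  have hii : ∀ x (hx : x < h), ii x = (ofLex (e ⟨x, hx⟩)).1 := fun x hx => dif_pos hx
  have hjj : ∀ x (hx : x < h), jj x = (ofLex (ofLex (e ⟨x, hx⟩)).2).1 := fun x hx => dif_pos hx
  have haa : ∀ x (hx : x < h), aa x = (ofLex (ofLex (e ⟨x, hx⟩)).2).2 := fun x hx => dif_pos hx
  have hla : ∀ x (hx : x < h), la x = lam (ofLex (e ⟨x, hx⟩)).1 := fun x hx => dif_pos hx
  have hμx : ∀ x, x < h → aa x < μ (ii x) (jj x) := by
    intro x hx
    rw [hii x hx, hjj x hx, haa x hx]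
    simp only [μ, Fin.is_lt, dif_pos, Fin.eta]
  have hlt : ∀ x < h, ∀ y < h, x < y ↔
      ii x < ii y ∨ ii x = ii y ∧ (jj x < jj y ∨ jj x = jj y ∧ aa x < aa y) := by
    intro x hx y hy
    rw [hii x hx, hii y hy, hjj x hx, hjj y hy, haa x hx, haa y hy, ← weyrIndex_lt_iff,
      e.lt_iff_lt]
    exact Iff.rfl
  refine ⟨ii, jj, aa, fun x => N (ii x) (aa x), la, hlt, ?_, ?_, ?_, ?_, ?_⟩
  · intro x hx
    exact (hN _ _ _).1 (hμx x hx)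
  · intro x hx y hy hxy haxy
    show N (ii y) (aa y) ≤ N (ii x) (aa x)
    by_contra hcon
    rw [not_le, ← hN, ← hxy] at hcon
    exact lt_irrefl _ ((hN _ _ _).1 (haxy.trans_lt hcon))
  · intro x hx j hj
    have hj := (hN _ _ _).2 hj
    have hi : ii x < r := by
      by_contra hn
      simp [μ, hn] at hj
    have hjκ : j < κ ⟨ii x, hi⟩ := by
      by_contra hn
      simp [μ, hi, hn] at hj
    have ha : aa x < m ⟨ii x, hi⟩ ⟨j, hjκ⟩ := by simpa [μ, hi, hjκ] using hj
    let p : WeyrIndex κ m := toLex ⟨⟨ii x, hi⟩, toLex ⟨⟨j, hjκ⟩, ⟨aa x, ha⟩⟩⟩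
    refine ⟨e.symm p, (e.symm p).2, ?_, ?_, ?_⟩
    · rw [hii _ (e.symm p).2, Fin.eta, e.apply_symm_apply]
      rfl
    · rw [hjj _ (e.symm p).2, Fin.eta, e.apply_symm_apply]
      rfl
    · rw [haa _ (e.symm p).2, Fin.eta, e.apply_symm_apply]
      rfl
  · intro x hx y hy
    rw [hla x hx, hla y hy, hlam.injective.eq_iff, hii x hx, hii y hy, Fin.ext_iff]
  · intro x hx y hy
    rw [← hA' ⟨x, hx⟩ ⟨y, hy⟩, hent, hla x hx, hii x hx, hii y hy, hjj x hx, hjj y hy, haa x hx,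
      haa y hy]
    exact if_congr (e.apply_eq_iff_eq.trans Fin.ext_iff) rfl
      (if_congr (and_congr Fin.ext_iff Iff.rfl) rfl rfl)

end WeyrPattern

end Belitskii

namespace Belitskii

/-! ### Zero and scalar parts as canonical forms -/

section Forms

variable {k : Type*} [Field k]

theorem isRankForm_zero {h w : ℕ} : IsRankForm (0 : Matrix (Fin h) (Fin w) k) :=
  ⟨0, Nat.zero_le _, Nat.zero_le _, fun i j => by simp⟩

theorem IsScalarMatrix.isWeyr [LinearOrder k] {h w : ℕ} {A : Matrix (Fin h) (Fin w) k} {lam : k}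
    (hA : IsScalarMatrix lam A) (hh : 0 < h) : IsWeyr A := by
  obtain ⟨rfl, hA⟩ := hA
  let κ : Fin 1 → ℕ := fun _ => 1
  let m : ∀ i, Fin (κ i) → ℕ := fun _ _ => h
  have : Fintype (WeyrIndex κ m) :=
    inferInstanceAs (Fintype (Σ i : Fin 1, Σ j : Fin (κ i), Fin (m i j)))
  have hcard : Fintype.card (WeyrIndex κ m) = h := by
    have : Fintype.card (WeyrIndex κ m) =
        Fintype.card (Σ i : Fin 1, Σ j : Fin (κ i), Fin (m i j)) := Fintype.card_congr ofLex
    rw [this]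
    simp [κ, m]
  let e : Fin h ≃o WeyrIndex κ m := Fintype.orderIsoFinOfCardEq _ hcard
  refine ⟨1, fun _ => lam, κ, m, e, e, Subsingleton.strictMono _, fun _ => Nat.one_pos,
    fun _ _ => hh, fun _ => antitone_const, fun x y => ?_⟩
  rw [hA x y]
  by_cases hxy : x = y
  · rw [if_pos (congrArg Fin.val hxy), if_pos (congrArg e hxy)]
  · rw [if_neg (fun h => hxy (Fin.ext h)), if_neg (fun h => hxy (e.injective h)), if_neg]
    rintro ⟨-, h1, -⟩
    have h2 : ((ofLex (ofLex (e y)).2).1 : ℕ) < 1 := (ofLex (ofLex (e y)).2).1.2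
    omega

end Forms

/-! ### Conditions on a part at a stage -/

section Step

variable {k : Type*} [Field k] {n t m : ℕ} {b : Fin n → Fin t} {rel : Setoid (Fin t)}
  {Λ Λ' Λ'' : Subalgebra k (Matrix (Fin n) (Fin n) k)} {M : Matrix (Fin n) (Fin n) k}
  {parts : Fin m → Part n} {mark : Fin m → Bool} {P P' : Setoid (Fin n)} {Q : Fin m} {q : ℕ}

theorem Part.IsCell.rows_eq {B : Part n} (hB : B.IsCell P) : B.rows = cls P B.top := by
  ext z
  rw [mem_cls]
  have := hB.has_iff B.has_top_left z B.left
  exact ⟨fun hz => (this.1 ⟨hz, B.has_top_left.2⟩).1, fun hz => (this.2 ⟨hz, P.refl _⟩).1⟩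

theorem Part.IsCell.cols_eq {B : Part n} (hB : B.IsCell P) : B.cols = cls P B.left := by
  ext z
  rw [mem_cls]
  have := hB.has_iff B.has_top_left B.top z
  exact ⟨fun hz => (this.1 ⟨B.has_top_left.1, hz⟩).2, fun hz => (this.2 ⟨P.refl _, hz⟩).2⟩

/-- All matrices of `Λ'` commute with `M` at a part that is fixed by `Λ'^*`. -/
theorem Stage.comm_of_fixed [Infinite k] (h : Stage b rel Λ M parts Q P Λ')
    (hp : ∀ x y, ∃! q, (parts q).Has x y) (ho : ∀ p q, p < q → (parts p).Before (parts q))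
    (hB : (parts Q).IsCell P) (hfix : ∀ T ∈ Λ', IsUnit T → ∀ x y, (parts Q).Has x y →
      (T⁻¹ * M * T) x y = M x y) {S : Matrix (Fin n) (Fin n) k} (hS : S ∈ Λ') :
    ∀ x y, (parts Q).Has x y → (S * M) x y = (M * S) x y := by
  -- The spectrum is finite and the field infinite, so `c - S` is invertible for some `c`; scalars
  -- commute with `M`, so commutation of `c - S` at the part is that of `S`.
  obtain ⟨c, hc⟩ := (Matrix.finite_spectrum (R := k) S).exists_notMem
  have hu : IsUnit (algebraMap k (Matrix (Fin n) (Fin n) k) c - S) := by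
    by_contra hn
    exact hc hn
  intro x y hxy
  have := (h.conj_apply_eq_iff hp ho hB (Λ'.sub_mem (Λ'.algebraMap_mem c) hS) hu).1
    (hfix _ (Λ'.sub_mem (Λ'.algebraMap_mem c) hS) hu) x y hxy
  rw [sub_mul, mul_sub, Matrix.sub_apply, Matrix.sub_apply, Algebra.commutes] at this
  exact sub_right_injective this

variable [LinearOrder k]

/-- The conditions that characterize the part `q` of a structured canonical matrix. -/
def PartCondition (b : Fin n → Fin t) (rel : Setoid (Fin t))
    (Λ : Subalgebra k (Matrix (Fin n) (Fin n) k)) (M : Matrix (Fin n) (Fin n) k)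
    (parts : Fin m → Part n) (mark : Fin m → Bool) (q : Fin m) : Prop :=
  (parts q).IsCell (strips b rel M parts q) ∧
  (CanBeChanged b rel Λ M parts q → mark q = true ∧ (parts q).of M = 0) ∧
  (¬ CanBeChanged b rel Λ M parts q →
    (Linked b rel M parts q (parts q).top (parts q).left →
      mark q = false ∧ IsWeyr ((parts q).of M)) ∧
    (¬ Linked b rel M parts q (parts q).top (parts q).left →
      mark q = false ∧ IsRankForm ((parts q).of M)))

/-- A part that can be changed is zero, hence cuts no strips and creates no links. Any other part
admits no additions, so `M` enters only through the relation for diagonal blocks and the patterns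
apply. -/
theorem Stage.exists_succ (h : Stage b rel Λ M parts Q P Λ') (hΛ : IsReducedAlgebra b rel Λ)
    (hp : ∀ x y, ∃! q, (parts q).Has x y) (ho : ∀ p q, p < q → (parts p).Before (parts q))
    (hc : PartCondition b rel Λ M parts mark Q) :
    ∃ P' Λ'', Stage b rel Λ M parts (Q + 1) P' Λ'' := by
  obtain ⟨hB, hc1, hc2⟩ := hc
  rw [h.strips_eq] at hB
  by_cases hch : CanBeChanged b rel Λ M parts Q
  · have h0 := Part.of_eq_zero_iff.1 (hc1 hch).2
    refine ⟨P, h.succ hΛ hp ho hB le_rfl h.subdiv.convex (fun _ _ _ _ _ _ _ h _ => h)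
      (fun x y hxy => Or.inl fun z w hz hw => h0 z w (hB.saturated x y z w hxy hz hw))
      (fun x y hxy hM => absurd (h0 x y hxy) hM) (fun _ _ _ _ _ _ hP hn => absurd hP hn)
      fun S _ _ x x' y y' hx hMx => ?_⟩
    rw [h0 x x' hx] at hMx
    exact absurd hMx zero_ne_one
  · have hadd : ∀ R ∈ Λ', (∀ x y, P x y → R x y = 0) → ∀ x y, (parts Q).Has x y →
        (R * M) x y = (M * R) x y := by
      intro R hR hR0
      by_contra hn
      exact hch ((h.canBeChanged_iff hp ho hB).2 ⟨R, hR, hR0, hn⟩)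
    have hA : ∀ x y, (parts Q).Has x y → M x y =
        subEntry M (cls P (parts Q).top) (cls P (parts Q).left) (pl P x) (pl P y) := by
      intro x y hxy
      have := (hB.has_iff (parts Q).has_top_left x y).1 hxy
      rw [pl_eq_rk this.1, pl_eq_rk this.2,
        subEntry_rk M (mem_cls.2 this.1) (mem_cls.2 this.2)]
    by_cases hl : Linked b rel M parts Q (parts Q).top (parts Q).left
    · have hW := ((hc2 hch).1 hl).2
      rw [Part.of, hB.rows_eq, hB.cols_eq] at hW
      obtain ⟨hcd, ii, jj, aa, ht, lam, hsh⟩ := hW.exists_shape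
        (A' := subEntry M (cls P (parts Q).top) (cls P (parts Q).left))
        (fun a c => by rw [subEntry, dif_pos ⟨a.2, c.2⟩])
      refine h.succ_of_pattern hΛ hp ho hB hadd ?_ hA (C := ℕ × ℕ × ℕ)
        (cu := fun x => (ii x, jj x, ht x)) (cv := fun x => (ii x, jj x, ht x))
      have := hsh.isPattern hl
      rw [show cd P (parts Q).left = cd P (parts Q).top from hcd.symm]
      exact this
    · have hR := ((hc2 hch).2 hl).2
      rw [Part.of, hB.rows_eq, hB.cols_eq] at hR
      obtain ⟨ρ, h1, h2, h3⟩ := hR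
      refine h.succ_of_pattern hΛ hp ho hB hadd (isPattern_rank hl h1 h2 ?_) hA
      intro a ha c hc
      have := h3 ⟨a, ha⟩ ⟨c, hc⟩
      rw [subEntry, dif_pos ⟨ha, hc⟩, this]

/-- Such a part commutes with the whole algebra. Commutation with the `placeUnit` matrices makes it
scalar when its strips are linked. -/
theorem Stage.partCondition_of_fixed [Infinite k] (h : Stage b rel Λ M parts Q P Λ')
    (hp : ∀ x y, ∃! q, (parts q).Has x y) (ho : ∀ p q, p < q → (parts p).Before (parts q))
    (hB : (parts Q).IsCell P) (hfix : ∀ T ∈ Λ', IsUnit T → ∀ x y, (parts Q).Has x y →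
      (T⁻¹ * M * T) x y = M x y) (hmark : mark Q = false) :
    PartCondition b rel Λ M parts mark Q := by
  classical
  have hcomm : ∀ S ∈ Λ', ∀ x y, (parts Q).Has x y → (S * M) x y = (M * S) x y :=
    fun S hS => h.comm_of_fixed hp ho hB hfix hS
  have hhas := hB.has_iff (parts Q).has_top_left
  refine ⟨by rwa [h.strips_eq], fun hch => ?_, fun _ => ⟨fun hl => ⟨hmark, ?_⟩,
    fun hl => ⟨hmark, ?_⟩⟩⟩
  · obtain ⟨R, hR, -, hne⟩ := (h.canBeChanged_iff hp ho hB).1 hch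
    exact absurd (hcomm R hR) hne
  · have h1 : ∀ x y, (parts Q).Has x y → pl P x ≠ pl P y → M x y = 0 := by
      intro x y hxy hne
      have := hcomm _ (h.block.placeUnit_mem (pl P x) (pl P x)) x y hxy
      rwa [(placeUnit_mul M _ _ x y).1 rfl x (P.refl x) rfl,
        (mul_placeUnit M _ _ x y).2 (Or.inl hne.symm)] at this
    have h2 : ∀ x y x' y', (parts Q).Has x y → (parts Q).Has x' y' → pl P x = pl P y →
        pl P x' = pl P y' → M x y = M x' y' := by
      intro x y x' y' hxy hxy' hpl hpl'
      have hx := (hB.has_iff hxy x' y').1 hxy'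
      have := hcomm _ (h.block.placeUnit_mem (pl P x) (pl P x')) x y'
        ((hB.has_iff hxy x y').2 ⟨P.refl x, hx.2⟩)
      rw [(placeUnit_mul M _ _ x y').1 rfl x' hx.1 rfl,
        (mul_placeUnit M _ _ x y').1 hpl'.symm y (P.symm hx.2) hpl.symm] at this
      exact this.symm
    obtain ⟨z, hz, hzv⟩ := h.linked_iff.1 hl
    obtain ⟨hcd, hpl, -⟩ := h.block.compat z _ hzv
    refine IsScalarMatrix.isWeyr (lam := M z (parts Q).left) ?_ ?_
    · rw [Part.of, hB.rows_eq, hB.cols_eq, isScalarMatrix_sub_iff]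
      refine ⟨by rw [← cd, ← cd, cd_eq hz, hcd], fun x hx y hy => ?_⟩
      rw [mem_cls] at hx hy
      rw [← pl_eq_rk hx, ← pl_eq_rk hy]
      have hxy := (hhas x y).2 ⟨hx, hy⟩
      split_ifs with hxy'
      · exact h2 x y z _ hxy ((hhas _ _).2 ⟨hz, P.refl _⟩) hxy' hpl
      · exact h1 x y hxy hxy'
    · exact Finset.card_pos.2 ⟨_, (parts Q).has_top_left.1⟩
  · suffices h0 : (parts Q).of M = 0 by rw [h0]; exact isRankForm_zero
    rw [Part.of_eq_zero_iff]
    intro x y hxy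
    have hx := (hhas x y).1 hxy
    -- The idempotent of all indices linked with the rows of the part. The columns are not linked
    -- with them, so commutation with `D` annihilates the part.
    let D : Matrix (Fin n) (Fin n) k := Matrix.diagonal fun z =>
      if Linked b rel M parts Q (parts Q).top z then 1 else 0
    have hD : D ∈ Λ' := by
      refine h.block.full D (fun z w hzw => ?_) (fun z z' w w' hz hw hzw hzw' => ?_)
      · exact Matrix.diagonal_apply_ne _ fun e => hzw (e ▸ P.refl z)
      · have e1 : z = w ↔ z' = w' := by
          constructor
          · rintro rfl
            exact pl_inj hzw' ((h.block.compat _ _ hz).2.1.symm.trans (h.block.compat _ _ hw).2.1)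
          · rintro rfl
            exact pl_inj hzw ((h.block.compat _ _ hz).2.1.trans (h.block.compat _ _ hw).2.1.symm)
        have e2 : Linked b rel M parts Q (parts Q).top z ↔
            Linked b rel M parts Q (parts Q).top z' :=
          ⟨fun hl => .trans _ _ _ hl (h.linked_of_links hz),
            fun hl => .trans _ _ _ hl (.symm _ _ (h.linked_of_links hz))⟩
        simp only [D, Matrix.diagonal_apply, e1, e2]
    have h1 := hcomm D hD x y hxy
    rw [Matrix.diagonal_mul, Matrix.mul_diagonal, if_pos, if_neg, one_mul, mul_zero] at h1
    · exact h1
    · intro hl'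
      exact hl (.trans _ _ _ hl' (h.linked_iff.2 ⟨_, P.symm hx.2, Setoid.refl' _ _⟩))
    · exact h.linked_iff.2 ⟨_, hx.1, Setoid.refl' _ _⟩

end Step

end Belitskii

namespace Belitskii

/-! ### Boxes -/

section Boxes

variable {n t m : ℕ} {b : Fin n → Fin t} {parts : Fin m → Part n} {mark : Fin m → Bool}
  {P : Setoid (Fin n)} {l r : Fin t} {q : ℕ}

theorem exists_isBlock (hb : Monotone b) (x y : Fin n) :
    ∃ B : Part n, B.IsBlock b (b x) (b y) := by
  have key : ∀ x : Fin n, ∃ u v : Fin n, u ≤ v ∧ ∀ z, (u ≤ z ∧ z ≤ v) ↔ b z = b x := by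
    intro x
    have hne : (strip b (b x)).Nonempty := ⟨x, mem_strip.2 rfl⟩
    refine ⟨(strip b (b x)).min' hne, (strip b (b x)).max' hne, Finset.min'_le_max' _ _,
      fun z => ⟨fun hz => ?_, fun hz => ⟨Finset.min'_le _ _ (mem_strip.2 hz),
        Finset.le_max' _ _ (mem_strip.2 hz)⟩⟩⟩
    have h1 := hb hz.1
    have h2 := hb hz.2
    rw [mem_strip.1 (Finset.min'_mem _ hne)] at h1
    rw [mem_strip.1 (Finset.max'_mem _ hne)] at h2
    exact le_antisymm h2 h1
  obtain ⟨u, v, huv, h⟩ := key x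
  obtain ⟨u', v', huv', h'⟩ := key y
  exact ⟨⟨u, v, u', v', huv, huv'⟩, fun z w => by rw [Part.has_iff]; exact and_congr (h z) (h' w)⟩

theorem Part.IsBlock.isCell {B : Part n} (hB : B.IsBlock b l r) : B.IsCell (Setoid.ker b) := by
  obtain ⟨h1, h2⟩ := (hB _ _).1 B.has_top_left
  exact ⟨B.top, B.left, fun x y => by
    rw [hB, Setoid.ker_def, Setoid.ker_def, h1, h2, eq_comm, eq_comm (a := r)]⟩

theorem Part.IsCell.isBlock {B : Part n} (hB : B.IsCell (Setoid.ker b)) {x y : Fin n}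
    (hxy : B.Has x y) : B.IsBlock b (b x) (b y) := fun z w => by
  rw [hB.has_iff hxy, Setoid.ker_def, Setoid.ker_def, eq_comm, eq_comm (a := b y)]

theorem Part.IsBlock.rows_eq {B : Part n} (hB : B.IsBlock b l r) : B.rows = strip b l := by
  rw [hB.isCell.rows_eq, cls_ker, ((hB _ _).1 B.has_top_left).1]

theorem Part.IsBlock.cols_eq {B : Part n} (hB : B.IsBlock b l r) : B.cols = strip b r := by
  rw [hB.isCell.cols_eq, cls_ker, ((hB _ _).1 B.has_top_left).2]

/-- The blocks preceding the part `q` are contained in the preceding parts. -/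
theorem index_lt_of_blockBefore (hb : Monotone b) (hp : ∀ x y, ∃! q, (parts q).Has x y)
    (ho : ∀ p q, p < q → (parts p).Before (parts q)) {q p : Fin m}
    (hB : (parts q).IsBlock b l r) (hs : ∀ p < q, (parts p).Saturated (Setoid.ker b))
    {x y : Fin n} (hxy : (parts p).Has x y) (hlt : BlockBefore (b x) (b y) l r) : p < q := by
  have hc := (hB _ _).1 (parts q).has_bottom_left
  rcases hlt with hlt | ⟨heq, hlt⟩
  · exact index_lt_of_bottom_lt ho hxy (hb.reflect_lt (hc.1.symm ▸ hlt))
  · obtain ⟨p', hp', -⟩ := hp (parts q).bottom y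
    have hpq := index_lt_of_lt_left ho hp' (hb.reflect_lt (hc.2.symm ▸ hlt))
    have := hs p' hpq _ _ x y hp' (hc.1.trans heq.symm) rfl
    exact (hp x y).unique this hxy ▸ hpq

theorem blockBefore_of_index_lt (hb : Monotone b)
    (ho : ∀ p q, p < q → (parts p).Before (parts q)) {q p : Fin m}
    (hB : (parts q).IsBlock b l r) (hpq : p < q) :
    BlockBefore (b (parts p).bottom) (b (parts p).left) l r := by
  have hc := (hB _ _).1 (parts q).has_bottom_left
  rcases ho p q hpq with ⟨heq, hlt⟩ | hlt
  · refine Or.inr ⟨heq ▸ hc.1, lt_of_le_of_ne (hc.2 ▸ hb hlt.le) fun h => ?_⟩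
    have := (hB (parts q).bottom (parts p).left).2 ⟨hc.1, h⟩
    exact (Part.has_iff.1 this).2.1.not_gt hlt
  · refine Or.inl (lt_of_le_of_ne (hc.1 ▸ hb hlt.le) fun h => ?_)
    have := (hB (parts p).bottom (parts q).left).2 ⟨h.symm, hc.2⟩
    exact (Part.has_iff.1 this).1.2.not_gt hlt

/-- The first `q` boxes. -/
def boxesBelow (parts : Fin m → Part n) (mark : Fin m → Bool) (q : ℕ) : Set (Part n × Bool) :=
  {B | ∃ p : Fin m, p.val < q ∧ (parts p, mark p) = B}

theorem boxesBelow_zero : boxesBelow parts mark 0 = ∅ :=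
  Set.eq_empty_of_forall_notMem fun _ ⟨_, h, _⟩ => Nat.not_lt_zero _ h

theorem boxesBelow_eq_range : boxesBelow parts mark m = Set.range fun q => (parts q, mark q) :=
  Set.ext fun _ => ⟨fun ⟨p, _, h⟩ => ⟨p, h⟩, fun ⟨p, h⟩ => ⟨p, p.2, h⟩⟩

theorem boxesBelow_succ {q : Fin m} :
    boxesBelow parts mark (q + 1) = boxesBelow parts mark q ∪ {(parts q, mark q)} := by
  ext B
  constructor
  · rintro ⟨p, hp, rfl⟩
    rcases (Nat.lt_succ_iff.1 hp).lt_or_eq with h | h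
    · exact Or.inl ⟨p, h, rfl⟩
    · exact Or.inr (by rw [Fin.ext h, Set.mem_singleton_iff])
  · rintro (⟨p, hp, rfl⟩ | h)
    · exact ⟨p, hp.trans (Nat.lt_succ_self _), rfl⟩
    · exact ⟨q, Nat.lt_succ_self _, (Set.mem_singleton_iff.1 h).symm⟩

/-- The first `q` boxes are unions of blocks. A block satisfying `C` therefore lies inside one of
them and is discarded, or it is one of the parts numbered from `q` to `q' - 1`. -/
theorem newBoxes_boxesBelow (hp : ∀ x y, ∃! q, (parts q).Has x y) {C : Fin t → Fin t → Prop}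
    {q' : ℕ} (hqq : q ≤ q') (hs : ∀ p : Fin m, p.val < q → (parts p).Saturated (Setoid.ker b))
    (hc : ∀ p : Fin m, q ≤ p.val → p.val < q' → (parts p).IsCell (Setoid.ker b) ∧ mark p = false)
    (h₁ : ∀ (p : Fin m) (x y), (parts p).Has x y → C (b x) (b y) → p.val < q')
    (h₂ : ∀ p : Fin m, p.val < q' → C (b (parts p).bottom) (b (parts p).left)) :
    boxesBelow parts mark q ∪ newBoxes b C (boxesBelow parts mark q) =
      boxesBelow parts mark q' := by
  apply Set.Subset.antisymm
  · rintro ⟨B, c⟩ (⟨p, hpq, h⟩ | ⟨hcf, ⟨i, j, hB, hC⟩, hn⟩)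
    · exact ⟨p, hpq.trans_le hqq, h⟩
    · obtain rfl : c = false := hcf
      obtain ⟨p, hpB, -⟩ := hp B.bottom B.left
      have hbB := (hB _ _).1 B.has_bottom_left
      have hpq' := h₁ p _ _ hpB (by rw [hbB.1, hbB.2]; exact hC)
      have hBi : B.IsCell (Setoid.ker b) := Part.IsBlock.isCell hB
      have hpq : q ≤ p.val := by
        by_contra hlt
        refine hn ⟨_, ⟨p, not_le.1 hlt, rfl⟩, fun x y hxy => ?_⟩
        have := (hBi.has_iff B.has_bottom_left x y).1 hxy
        exact hs p (not_le.1 hlt) _ _ _ _ hpB this.1 this.2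
      obtain ⟨hcell, hm⟩ := hc p hpq hpq'
      refine ⟨p, hpq', Prod.ext (Part.eq_of_has fun x y => ?_) hm⟩
      rw [hcell.has_iff hpB, hBi.has_iff B.has_bottom_left]
  · rintro _ ⟨p, hpq', rfl⟩
    by_cases hpq : p.val < q
    · exact Or.inl ⟨p, hpq, rfl⟩
    · obtain ⟨hcell, hm⟩ := hc p (not_lt.1 hpq) hpq'
      refine Or.inr ⟨hm, ⟨_, _, hcell.isBlock (parts p).has_bottom_left, h₂ p hpq'⟩, ?_⟩
      rintro ⟨_, ⟨p', hp', rfl⟩, h⟩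
      have := (hp _ _).unique (h _ _ (parts p).has_bottom_left) (parts p).has_bottom_left
      exact hpq (this ▸ hp')

/-- If the new boxes are among the parts, then the corresponding parts are blocks. -/
theorem isBlock_of_newBoxes_subset (hb : Monotone b) (hp : ∀ x y, ∃! q, (parts q).Has x y)
    {C : Fin t → Fin t → Prop}
    (hsub : newBoxes b C (boxesBelow parts mark q) ⊆ Set.range fun q => (parts q, mark q))
    {p : Fin m} (hpq : q ≤ p.val) (hC : C (b (parts p).bottom) (b (parts p).left)) :
    (parts p).IsBlock b (b (parts p).bottom) (b (parts p).left) ∧ mark p = false := by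
  obtain ⟨B, hB⟩ := exists_isBlock hb (parts p).bottom (parts p).left
  have hBp := (hB (parts p).bottom (parts p).left).2 ⟨rfl, rfl⟩
  -- The block at the lower left corner of the part `p` is in no earlier part, by disjointness. So
  -- it is a new box, hence a part, hence the part `p`.
  obtain ⟨p', hp'⟩ := hsub (a := (B, false)) ⟨rfl, ⟨_, _, hB, hC⟩, by
    rintro ⟨_, ⟨p', hp', rfl⟩, h⟩
    have := (hp _ _).unique (h _ _ hBp) (parts p).has_bottom_left
    exact hp'.not_ge (this ▸ hpq)⟩
  obtain ⟨rfl, hm⟩ := Prod.mk.injEq _ _ _ _ ▸ hp'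
  obtain rfl := (hp _ _).unique hBp (parts p).has_bottom_left
  exact ⟨hB, hm⟩

end Boxes

/-! ### One step of the algorithm -/

section OneStep

variable {k : Type*} [Field k] {n t t' m : ℕ} {b : Fin n → Fin t} {rel : Setoid (Fin t)}
  {Λ Λ' : Subalgebra k (Matrix (Fin n) (Fin n) k)} {M N : Matrix (Fin n) (Fin n) k}
  {parts : Fin m → Part n} {mark : Fin m → Bool} {P : Setoid (Fin n)} {Q : Fin m} {q : ℕ}
  {c : Fin n → Fin t'} {rel' : Setoid (Fin t')} {l r : Fin t'}

/-- The two sums are the entries of `M * R` and `R * M`, where `R` is `S` without its diagonal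
blocks; terms below the diagonal vanish. -/
theorem noAdditions_iff (hΛ : IsReducedAlgebra b rel Λ) {l r : Fin t} :
    NoAdditions Λ b M l r ↔ ∀ R ∈ Λ, (∀ x y, b x = b y → R x y = 0) →
      ∀ x y, b x = l → b y = r → (R * M) x y = (M * R) x y := by
  have hA := hΛ.isBlockAlgebra
  have htri : ∀ S ∈ Λ, ∀ x y, b y < b x → S x y = 0 := fun S hS x y hxy =>
    hA.tri S hS x y (hΛ.1.reflect_lt hxy) fun h => hxy.ne' h
  have key : ∀ S ∈ Λ, ∀ R : Matrix (Fin n) (Fin n) k, (∀ x y, b x = b y → R x y = 0) →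
      (∀ x y, b x ≠ b y → R x y = S x y) → ∀ x y, b x = l → b y = r →
      ((∑ z, if b z < r then M x z * S z y else 0) = ∑ z, if l < b z then S x z * M z y else 0) =
        ((M * R) x y = (R * M) x y) := by
    rintro S hS R h0 h1 x y rfl rfl
    rw [Matrix.mul_apply, Matrix.mul_apply]
    congr 1 <;> refine Finset.sum_congr rfl fun z _ => ?_
    · rcases lt_trichotomy (b z) (b y) with h | h | h
      · rw [if_pos h, h1 _ _ h.ne]
      · rw [if_neg h.not_lt, h0 _ _ h, mul_zero]
      · rw [if_neg h.not_gt, h1 _ _ h.ne', htri S hS z y h, mul_zero]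
    · rcases lt_trichotomy (b x) (b z) with h | h | h
      · rw [if_pos h, h1 _ _ h.ne]
      · rw [if_neg h.not_lt, h0 _ _ h, zero_mul]
      · rw [if_neg h.not_gt, h1 _ _ h.ne', htri S hS x z h, zero_mul]
  constructor
  · intro h R hR hR0 x y hx hy
    exact ((key R hR R hR0 (fun _ _ _ => rfl) x y hx hy).mp (h R hR x y hx hy)).symm
  · intro h S hS x y hx hy
    have hd : ∀ x y, b x = b y → (S - blockDiag (Setoid.ker b) S) x y = 0 := fun x y hxy => by
      rw [Matrix.sub_apply, blockDiag, if_pos (Setoid.ker_def.2 hxy), sub_self]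
    rw [key S hS _ hd (fun x y hxy => by
      rw [Matrix.sub_apply, blockDiag, if_neg (mt Setoid.ker_def.1 hxy), sub_zero]) x y hx hy]
    exact (h _ (Λ.sub_mem hS (hA.blockDiag_mem hS)) hd x y hx hy).symm

/-- The sums involve only blocks to the left of or below `(l, r)`, all of which precede it. -/
theorem noAdditions_congr {l r : Fin t}
    (h : ∀ x y, BlockBefore (b x) (b y) l r → M x y = N x y) :
    NoAdditions Λ b M l r ↔ NoAdditions Λ b N l r := by
  refine forall₂_congr fun S _ => forall₂_congr fun x y => forall₂_congr fun hx hy => ?_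
  refine Eq.congr (Finset.sum_congr rfl fun z _ => ?_) (Finset.sum_congr rfl fun z _ => ?_)
  · split_ifs with hz
    · rw [h x z (Or.inr ⟨hx, hz⟩)]
    · rfl
  · split_ifs with hz
    · rw [h z y (Or.inl hz)]
    · rfl

theorem Stage.ker_eq (h : Stage b rel Λ M parts q P Λ') (hΛ' : IsReducedAlgebra c rel' Λ') :
    Setoid.ker c = P := hΛ'.isBlockAlgebra.eq_partition h.block

theorem Stage.noAdditions_iff (h : Stage b rel Λ M parts Q P Λ')
    (hΛ' : IsReducedAlgebra c rel' Λ')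
    (hp : ∀ x y, ∃! q, (parts q).Has x y) (ho : ∀ p q, p < q → (parts p).Before (parts q))
    (hB : (parts Q).IsBlock c l r) :
    NoAdditions Λ' c M l r ↔ ¬ CanBeChanged b rel Λ M parts Q := by
  obtain rfl := h.ker_eq hΛ'
  rw [h.canBeChanged_iff hp ho hB.isCell, Belitskii.noAdditions_iff hΛ']
  push Not
  refine forall₂_congr fun R _ => forall_congr' fun _ => ?_
  simp only [hB _ _, and_imp]

theorem Stage.rel_iff (h : Stage b rel Λ M parts Q P Λ')
    (hΛ' : IsReducedAlgebra c rel' Λ') (hB : (parts Q).IsBlock c l r) :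
    rel' l r ↔ Linked b rel M parts Q (parts Q).top (parts Q).left := by
  obtain rfl := h.ker_eq hΛ'
  have hE : placeRel c rel' = links b rel M parts Q := hΛ'.isBlockAlgebra.eq_rel h.block
  obtain ⟨h1, h2⟩ := (hB _ _).1 (parts Q).has_top_left
  rw [h.linked_iff, ← hE]
  constructor
  · intro hl
    obtain ⟨z, hz, hzp⟩ := exists_pl_eq (P := Setoid.ker c) (x := (parts Q).top)
      (a := pl (Setoid.ker c) (parts Q).left) (by
        refine (pl_lt_cd _ _).trans_eq ?_
        rw [cd, cd, cls_ker, cls_ker, h1, h2, hΛ'.2.1 l r hl])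
    rw [pl_ker, pl_ker] at hzp
    exact ⟨z, hz, placeRel_iff.2 ⟨by rwa [h2, ← (show c _ = c z from hz), h1], hzp⟩⟩
  · rintro ⟨z, hz, hzl⟩
    have := (placeRel_iff.1 hzl).1
    rwa [h2, ← (show c _ = c z from hz), h1] at this

variable [LinearOrder k]

theorem Stage.partCondition_iff (h : Stage b rel Λ M parts Q P Λ')
    (hΛ' : IsReducedAlgebra c rel' Λ')
    (hp : ∀ x y, ∃! q, (parts q).Has x y) (ho : ∀ p q, p < q → (parts p).Before (parts q))
    (hB : (parts Q).IsBlock c l r) :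
    PartCondition b rel Λ M parts mark Q ↔
      (¬ NoAdditions Λ' c M l r ∧ mark Q = true ∧ sub M (strip c l) (strip c r) = 0) ∨
      (NoAdditions Λ' c M l r ∧ ¬ rel' l r ∧ mark Q = false ∧
        IsRankForm (sub M (strip c l) (strip c r))) ∨
      (NoAdditions Λ' c M l r ∧ rel' l r ∧ mark Q = false ∧
        IsWeyr (sub M (strip c l) (strip c r))) := by
  have hcell : (parts Q).IsCell (strips b rel M parts Q) := by
    rw [h.strips_eq, ← h.ker_eq hΛ']
    exact hB.isCell
  rw [PartCondition, h.noAdditions_iff hΛ' hp ho hB, h.rel_iff hΛ' hB, ← hB.rows_eq, ← hB.cols_eq,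
    ← Part.of]
  tauto

end OneStep

end Belitskii

namespace Belitskii

/-! ### Runs of the algorithm -/

section Runs

theorem inv_mul_mul_mul {k : Type*} [Field k] {n : ℕ} {M S T : Matrix (Fin n) (Fin n) k} :
    (S * T)⁻¹ * M * (S * T) = T⁻¹ * (S⁻¹ * M * S) * T := by
  rw [Matrix.mul_inv_rev]
  simp only [mul_assoc]

variable {k : Type*} [Field k] {n t t' m : ℕ} {b : Fin n → Fin t}
  {rel : Setoid (Fin t)} {Λ Λ' Λ'' : Subalgebra k (Matrix (Fin n) (Fin n) k)}
  {M N : Matrix (Fin n) (Fin n) k} {parts : Fin m → Part n} {mark : Fin m → Bool}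
  {P : Setoid (Fin n)} {Q : Fin m} {q : ℕ} {boxes done : Set (Part n × Bool)}

/-- `S⁻¹ * N * S` is the conjugate of `M` by `T⁻¹ * S`, a unit of the stage algebra, and such units
fix the first `q` parts of `M`. -/
theorem Stage.conj_apply (h : Stage b rel Λ M parts q P Λ')
    (hp : ∀ x y, ∃! q, (parts q).Has x y) (ho : ∀ p q, p < q → (parts p).Before (parts q))
    {T S : Matrix (Fin n) (Fin n) k} (hT : T ∈ Λ') (hu : IsUnit T) (hM : M = T⁻¹ * N * T)
    (hS : S ∈ Λ') (hSu : IsUnit S) {p : Fin m} (hpq : p.val < q) {x y : Fin n}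
    (hxy : (parts p).Has x y) : (S⁻¹ * N * S) x y = M x y := by
  have hdet := (Matrix.isUnit_iff_isUnit_det T).1 hu
  have hTS : T * (T⁻¹ * S) = S := by rw [← mul_assoc, Matrix.mul_nonsing_inv T hdet, one_mul]
  have := h.fixes hp ho (Λ'.mul_mem (inv_mem_of_isUnit hT hu) hS)
    ((Matrix.isUnit_nonsing_inv_iff.2 hu).mul hSu) hpq hxy
  rwa [hM, ← inv_mul_mul_mul, hTS, ← hM] at this

variable [LinearOrder k]

theorem Run.exists_conj (h : Run Λ done N M boxes) :
    done ⊆ boxes ∧ ∃ T ∈ Λ, IsUnit T ∧ M = T⁻¹ * N * T := by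
  induction h with
  | finish Λ done M t b rel hΛ hM =>
    exact ⟨Set.subset_union_left, 1, Λ.one_mem, isUnit_one, by simp⟩
  | step Λ Λ' done boxes M M' Minf t b rel l r B mark hΛ hlr hB hM' hΛ' hrun ih =>
    obtain ⟨hd, T, hT, hu, rfl⟩ := ih
    obtain ⟨S, hS, hSu, rfl, -⟩ := hM'
    exact ⟨(Set.subset_union_left.trans Set.subset_union_left).trans hd, S * T,
      Λ.mul_mem hS ((hΛ' T).1 hT).1, hSu.mul hu, inv_mul_mul_mul.symm⟩

/-- The algorithm leaves `M` unchanged if all its parts satisfy the conditions. -/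
theorem Stage.run [Infinite k] (hΛ : IsReducedAlgebra b rel Λ)
    (hp : ∀ x y, ∃! q, (parts q).Has x y) (ho : ∀ p q, p < q → (parts p).Before (parts q))
    (hc : ∀ p, PartCondition b rel Λ M parts mark p) (d : ℕ) :
    ∀ {q : ℕ} {P : Setoid (Fin n)} {Λ' : Subalgebra k (Matrix (Fin n) (Fin n) k)} {q₀ : ℕ},
      Stage b rel Λ M parts q P Λ' → q + d = m → q₀ ≤ q →
      (∀ p : Fin m, q₀ ≤ p.val → p.val < q → (parts p).IsCell P ∧ mark p = false) →
      Run Λ' (boxesBelow parts mark q₀) M M (Set.range fun q => (parts q, mark q)) := by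
  -- Here `q₀` counts the recorded boxes and `q` the treated parts; the parts between them are
  -- stable blocks waiting to be collected by `newBoxes`.
  induction d with
  | zero =>
    intro q P Λ' q₀ h hqm h₀ hcell
    obtain rfl : q = m := hqm
    have hΛ' := h.block.isReducedAlgebra
    have hrun := Run.finish Λ' (boxesBelow parts mark q₀) M _ _ _ hΛ' fun i j S hS hu x y _ _ => by
      obtain ⟨p, hxy, -⟩ := hp x y
      exact h.fixes hp ho hS hu p.2 hxy
    rwa [newBoxes_boxesBelow hp h₀
      (fun p hpq => by rw [ker_first]; exact h.saturated p (hpq.trans_le h₀))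
      (fun p h1 h2 => by rw [ker_first]; exact hcell p h1 h2) (fun p _ _ _ _ => p.2)
      (fun _ _ => trivial), boxesBelow_eq_range] at hrun
  | succ d ih =>
    intro q P Λ' q₀ h hqd h₀ hcell
    obtain ⟨Q, rfl⟩ : ∃ Q : Fin m, Q.val = q := ⟨⟨q, by omega⟩, rfl⟩
    have hB : (parts Q).IsCell P := h.strips_eq ▸ (hc Q).1
    obtain ⟨P₁, Λ₁, h₁⟩ := h.exists_succ hΛ hp ho (hc Q)
    have hmem : ∀ S, S ∈ Λ₁ ↔ S ∈ Λ' ∧ ∀ x y, (parts Q).Has x y → (S * M) x y = (M * S) x y := by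
      intro S
      rw [h₁.mem_iff, h.mem_iff, and_assoc]
      refine and_congr_right fun _ => ⟨fun H => ⟨fun p hpQ => H p (hpQ.trans (Nat.lt_succ_self _)),
        H Q (Nat.lt_succ_self _)⟩, fun H p hpQ => ?_⟩
      rcases (Nat.lt_succ_iff.1 hpQ).lt_or_eq with hlt | heq
      · exact H.1 p hlt
      · exact (Fin.ext heq : p = Q) ▸ H.2
    -- A fixed part changes neither the algebra nor the strips, so the algorithm passes over it.
    -- Otherwise the part is the first nonstable block.
    by_cases hfix : ∀ T ∈ Λ', IsUnit T → ∀ x y, (parts Q).Has x y → (T⁻¹ * M * T) x y = M x y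
    · have hcomm := fun S hS => h.comm_of_fixed hp ho hB hfix (S := S) hS
      obtain rfl : Λ₁ = Λ' := SetLike.ext fun S =>
        ⟨fun hS => ((hmem S).1 hS).1, fun hS => (hmem S).2 ⟨hS, hcomm S hS⟩⟩
      obtain rfl := h.block.eq_partition h₁.block
      have hch : ¬ CanBeChanged b rel Λ M parts Q := by
        rw [h.canBeChanged_iff hp ho hB]
        rintro ⟨R, hR, -, hne⟩
        exact hne (hcomm R hR)
      have hm : mark Q = false := by
        by_cases hl : Linked b rel M parts Q (parts Q).top (parts Q).left
        · exact (((hc Q).2.2 hch).1 hl).1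
        · exact (((hc Q).2.2 hch).2 hl).1
      refine ih h₁ (by omega) (by omega) fun p hp₀ hpQ => ?_
      rcases (Nat.lt_succ_iff.1 hpQ).lt_or_eq with hlt | heq
      · exact hcell p hp₀ hlt
      · exact (Fin.ext heq : p = Q) ▸ ⟨hB, hm⟩
    · have hΛ' := h.block.isReducedAlgebra
      have hBl : (parts Q).IsBlock (first P) (first P (parts Q).top) (first P (parts Q).left) :=
        Part.IsCell.isBlock (ker_first (P := P).symm ▸ hB) (parts Q).has_top_left
      have hs : ∀ p < Q, (parts p).Saturated (Setoid.ker (first P)) := fun p hpQ => by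
        rw [ker_first]
        exact h.saturated p hpQ
      -- The part already has the required form, so the identity serves as the transformation.
      refine Run.step Λ' Λ₁ _ _ M M M _ _ _ _ _ (parts Q) (mark Q) hΛ' ⟨?_, ?_⟩ hBl
        ⟨1, Λ'.one_mem, isUnit_one, by simp, ?_⟩ (fun S => ?_) ?_
      · intro hst
        exact hfix fun T hT hu x y hxy => hst T hT hu x y ((hBl x y).1 hxy).1 ((hBl x y).1 hxy).2
      · rintro i j hij S hS hu x y rfl rfl
        obtain ⟨p, hxy, -⟩ := hp x y
        exact h.fixes hp ho hS hu (index_lt_of_blockBefore hΛ'.1 hp ho hBl hs hxy hij) hxy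
      · have := (h.partCondition_iff hΛ' hp ho hBl).1 (hc Q)
        refine this.imp_left fun H => ⟨H.1, H.2.1, fun x y _ => Matrix.one_apply, H.2.2⟩
      · rw [hmem]
        refine and_congr_right fun _ => forall₂_congr fun x y => ?_
        rw [hBl, and_imp]
      · rw [newBoxes_boxesBelow (C := fun i j => BlockBefore i j _ _) hp h₀ (fun p hpq => hs p (hpq.trans_le h₀))
          (fun p h1 h2 => by rw [ker_first]; exact hcell p h1 h2)
          (fun p x y hxy hC => index_lt_of_blockBefore hΛ'.1 hp ho hBl hs hxy hC)
          (fun p hpQ => blockBefore_of_index_lt hΛ'.1 ho hBl (Fin.lt_def.2 hpQ)), ← boxesBelow_succ]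
        exact ih h₁ (by omega) le_rfl fun p h1 h2 => absurd h1 (by omega)

/-- Fixed parts commute with the whole algebra, so passing over them leaves the algebra, and with it
the partition, unchanged. -/
theorem Stage.advance [Infinite k] (h : Stage b rel Λ M parts q P Λ')
    (hΛ : IsReducedAlgebra b rel Λ)
    (hp : ∀ x y, ∃! q, (parts q).Has x y) (ho : ∀ p q, p < q → (parts p).Before (parts q))
    {q' : ℕ} (hqq : q ≤ q') (hq' : q' ≤ m)
    (hcell : ∀ p : Fin m, q ≤ p.val → p.val < q' → (parts p).IsCell P ∧ mark p = false)
    (hfix : ∀ p : Fin m, q ≤ p.val → p.val < q' → ∀ T ∈ Λ', IsUnit T → ∀ x y, (parts p).Has x y →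
      (T⁻¹ * M * T) x y = M x y)
    (hc : ∀ p : Fin m, p.val < q → PartCondition b rel Λ M parts mark p) :
    Stage b rel Λ M parts q' P Λ' ∧
      ∀ p : Fin m, p.val < q' → PartCondition b rel Λ M parts mark p := by
  induction q', hqq using Nat.le_induction with
  | base => exact ⟨h, hc⟩
  | succ q' hqq ih =>
    obtain ⟨h', hc'⟩ := ih (by omega) (fun p h1 h2 => hcell p h1 (by omega))
      (fun p h1 h2 => hfix p h1 (by omega))
    obtain ⟨Q, rfl⟩ : ∃ Q : Fin m, Q.val = q' := ⟨⟨q', hq'⟩, rfl⟩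
    obtain ⟨hB, hm⟩ := hcell Q hqq (Nat.lt_succ_self _)
    have hfQ := hfix Q hqq (Nat.lt_succ_self _)
    have hcQ := h'.partCondition_of_fixed hp ho hB hfQ hm
    refine ⟨?_, fun p hpQ => ?_⟩
    · obtain ⟨P₁, Λ₁, h₁⟩ := h'.exists_succ hΛ hp ho hcQ
      have hΛ₁ : Λ₁ = Λ' := SetLike.ext fun S => by
        rw [h₁.mem_iff, h'.mem_iff]
        refine and_congr_right fun hS => ⟨fun H p hpQ => H p (hpQ.trans (Nat.lt_succ_self _)),
          fun H p hpQ => ?_⟩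
        rcases (Nat.lt_succ_iff.1 hpQ).lt_or_eq with hlt | heq
        · exact H p hlt
        · exact (Fin.ext heq : p = Q) ▸
            h'.comm_of_fixed hp ho hB hfQ ((h'.mem_iff S).2 ⟨hS, H⟩)
      subst hΛ₁
      obtain rfl := h'.block.eq_partition h₁.block
      exact h₁
    · rcases (Nat.lt_succ_iff.1 hpQ).lt_or_eq with hlt | heq
      · exact hc' p hlt
      · exact (Fin.ext heq : p = Q) ▸ hcQ

/-- The parts of a structured canonical matrix satisfy the conditions. -/
theorem Run.partCondition [Infinite k] (hΛ : IsReducedAlgebra b rel Λ)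
    (hp : ∀ x y, ∃! q, (parts q).Has x y) (ho : ∀ p q, p < q → (parts p).Before (parts q))
    (hrun : Run Λ' done N M boxes) (hboxes : boxes = Set.range fun q => (parts q, mark q))
    (hq : q ≤ m) (h : Stage b rel Λ M parts q P Λ') (hdone : done = boxesBelow parts mark q)
    (hc : ∀ p : Fin m, p.val < q → PartCondition b rel Λ M parts mark p) (p : Fin m) :
    PartCondition b rel Λ M parts mark p := by
  induction hrun generalizing q P p with
  | finish Λ' done M t' c rel' hΛ' hM =>
    subst hdone
    obtain rfl := h.ker_eq hΛ'
    have hblock := fun (p : Fin m) (hpq : q ≤ p.val) => isBlock_of_newBoxes_subset hΛ'.1 hp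
      (hboxes ▸ Set.subset_union_right) hpq trivial
    exact (h.advance hΛ hp ho hq le_rfl
      (fun p hpq _ => ⟨Part.IsBlock.isCell (hblock p hpq).1, (hblock p hpq).2⟩)
      (fun p hpq _ T hT hu x y _ => hM _ _ T hT hu x y rfl rfl) hc).2 p p.2
  | step Λ' Λ₁ done boxes N N' M t' c rel' l r B mk hΛ' hlr hBl hN' hΛ₁ hrun ih =>
    subst hdone hboxes
    obtain rfl := h.ker_eq hΛ'
    obtain ⟨hsub, T', hT', hu', hMT'⟩ := hrun.exists_conj
    obtain ⟨S, hS, hSu, hSN, hred⟩ := hN'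
    have hT'Λ := ((hΛ₁ T').1 hT').1
    have hMT : M = (S * T')⁻¹ * N * (S * T') := by rw [hMT', hSN, inv_mul_mul_mul]
    have hT := Λ'.mul_mem hS hT'Λ
    have hu := hSu.mul hu'
    obtain ⟨Q, hQ⟩ := hsub (Or.inr rfl)
    obtain ⟨rfl, rfl⟩ := Prod.mk.injEq _ _ _ _ ▸ hQ
    -- Blocks inside the first `q` parts are stable, so the first nonstable block is not among them.
    have hqQ : q ≤ Q.val := by
      by_contra hlt
      refine hlr.1 fun U hU hUu x y hx hy => ?_
      have hxy := (hBl x y).2 ⟨hx, hy⟩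
      have h1 := h.conj_apply hp ho hT hu hMT Λ'.one_mem isUnit_one (not_le.1 hlt) hxy
      rw [h.conj_apply hp ho hT hu hMT hU hUu (not_le.1 hlt) hxy, ← h1]
      simp
    have hblock : ∀ p : Fin m, q ≤ p.val → p < Q → (parts p).IsBlock c (c (parts p).bottom)
        (c (parts p).left) ∧ mark p = false := fun p hpq hpQ =>
      isBlock_of_newBoxes_subset hΛ'.1 hp
        (Set.subset_union_right.trans (Set.subset_union_left.trans hsub)) hpq
        (blockBefore_of_index_lt hΛ'.1 ho hBl hpQ)
    have hcell : ∀ p : Fin m, q ≤ p.val → p.val < Q.val →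
        (parts p).IsCell (Setoid.ker c) ∧ mark p = false := fun p hpq hpQ =>
      ⟨(hblock p hpq hpQ).1.isCell, (hblock p hpq hpQ).2⟩
    obtain ⟨h', hc'⟩ := h.advance hΛ hp ho hqQ Q.2.le hcell (fun p hpq hpQ U hU hUu x y hxy => by
      have hst : ∀ V ∈ Λ', IsUnit V → (V⁻¹ * N * V) x y = N x y := fun V hV hVu =>
        hlr.2 _ _ (blockBefore_of_index_lt hΛ'.1 ho hBl hpQ) V hV hVu x y
          (((hblock p hpq hpQ).1 x y).1 hxy).1 (((hblock p hpq hpQ).1 x y).1 hxy).2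
      rw [hMT, ← inv_mul_mul_mul, hst _ (Λ'.mul_mem hT hU) (hu.mul hUu), hst _ hT hu]) hc
    have hs : ∀ p < Q, (parts p).Saturated (Setoid.ker c) := fun p hpQ => h'.saturated p hpQ
    have hN'M : ∀ p < Q, ∀ x y, (parts p).Has x y → N' x y = M x y := fun p hpQ x y hxy => by
      rw [hSN]
      exact h'.conj_apply hp ho hT hu hMT hS hSu hpQ hxy
    have hNM : ∀ p < Q, ∀ x y, (parts p).Has x y → N x y = M x y := fun p hpQ x y hxy => by
      have := h'.conj_apply hp ho hT hu hMT Λ'.one_mem isUnit_one hpQ hxy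
      simpa using this
    have hdet' := (Matrix.isUnit_iff_isUnit_det T').1 hu'
    have hTM : T' * M = N' * T' := by
      rw [hMT', ← mul_assoc, ← mul_assoc, Matrix.mul_nonsing_inv T' hdet', one_mul]
    -- At `Q` itself `T'` lies in the next algebra, so `T' * N'` agrees there with `N' * T' = T' *
    -- M`. Cancelling `T'` uses only parts up to `Q`.
    have hN'MQ : ∀ p ≤ Q, ∀ x y, (parts p).Has x y → N' x y = M x y := by
      intro p hpQ x y hxy
      rcases hpQ.lt_or_eq with hlt | rfl
      · exact hN'M p hlt x y hxy
      · have e : ∀ A : Matrix (Fin n) (Fin n) k, A = T'⁻¹ * (T' * A) := fun A => by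
          rw [← mul_assoc, Matrix.nonsing_inv_mul T' hdet', one_mul]
        rw [e N', e M]
        refine h'.left_mul_apply hp ho hBl.isCell.saturated (inv_mem_of_isUnit hT'Λ hu')
          (fun p' hp' z w hzw => ?_) hxy
        rcases hp'.lt_or_eq with hlt | rfl
        · exact h'.left_mul_apply hp ho (hs p' hlt) hT'Λ
            (fun p'' hp'' => hN'M p'' (hp''.trans_lt hlt)) hzw
        · rw [hTM]
          exact ((hΛ₁ T').1 hT').2 z w ((hBl z w).1 hzw).1 ((hBl z w).1 hzw).2
    have hcQ : PartCondition b rel Λ M parts mark Q := by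
      have hsubM : sub M (strip c l) (strip c r) = sub N' (strip c l) (strip c r) :=
        (sub_eq_iff _ _).2 fun x hx y hy =>
          (hN'MQ Q le_rfl x y ((hBl x y).2 ⟨mem_strip.1 hx, mem_strip.1 hy⟩)).symm
      rw [h'.partCondition_iff hΛ' hp ho hBl, hsubM, ← noAdditions_congr fun x y hxy => by
        obtain ⟨p, hpxy, -⟩ := hp x y
        exact hNM p (index_lt_of_blockBefore hΛ'.1 hp ho hBl hs hpxy hxy) x y hpxy]
      exact hred.imp_left fun H => ⟨H.1, H.2.1, H.2.2.2⟩
    obtain ⟨P₁, Λ₂, h₁⟩ := h'.exists_succ hΛ hp ho hcQ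
    have hcs : ∀ p : Fin m, p.val < Q.val + 1 → PartCondition b rel Λ M parts mark p := by
      intro p hpQ
      rcases (Nat.lt_succ_iff.1 hpQ).lt_or_eq with hlt | heq
      · exact hc' p hlt
      · exact (Fin.ext heq : p = Q) ▸ hcQ
    -- The algorithm tests commutation with `N'`, the stage with `M`; these matrices agree on all
    -- parts up to `Q`, and nothing else enters.
    obtain rfl : Λ₁ = Λ₂ := SetLike.ext fun U => by
      have key : U ∈ Λ' → ((∀ x y, c x = l → c y = r → (U * N') x y = (N' * U) x y) ↔
          ∀ x y, (parts Q).Has x y → (U * M) x y = (M * U) x y) := fun hU => by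
        refine forall₂_congr fun x y => ?_
        rw [← and_imp, ← hBl x y]
        refine forall_congr' fun hxy => ?_
        rw [h'.left_mul_apply hp ho hBl.isCell.saturated hU hN'MQ hxy,
          h'.right_mul_apply hBl.isCell.saturated
            (fun x y w => h'.cell_left_closed hp ho rfl hBl.isCell) hU hN'MQ hxy]
      rw [hΛ₁, h₁.mem_iff]
      constructor
      · rintro ⟨hU, H⟩
        refine ⟨((h'.mem_iff U).1 hU).1, fun p hpQ => ?_⟩
        rcases (Nat.lt_succ_iff.1 hpQ).lt_or_eq with hlt | heq
        · exact ((h'.mem_iff U).1 hU).2 p hlt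
        · exact (Fin.ext heq : p = Q) ▸ (key hU).1 H
      · rintro ⟨hU, H⟩
        have hU' := (h'.mem_iff U).2 ⟨hU, fun p hpQ => H p (hpQ.trans (Nat.lt_succ_self _))⟩
        exact ⟨hU', (key hU').2 (H Q (Nat.lt_succ_self _))⟩
    refine ih rfl (q := Q.val + 1) Q.2 h₁ ?_ hcs p
    rw [newBoxes_boxesBelow (C := fun i j => BlockBefore i j l r) hp hqQ
      (fun p hpq => hs p (hpq.trans_le hqQ)) hcell
      (fun p x y hxy hC => index_lt_of_blockBefore hΛ'.1 hp ho hBl hs hxy hC)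
      (fun p hpQ => blockBefore_of_index_lt hΛ'.1 ho hBl (Fin.lt_def.2 hpQ)), ← boxesBelow_succ]

end Runs

end Belitskii

theorem theorem1p4 {k : Type*} [Field k] [IsAlgClosed k] [LinearOrder k] {n t m : ℕ}
    (b : Fin n → Fin t) (rel : Setoid (Fin t)) (Λ : Subalgebra k (Matrix (Fin n) (Fin n) k))
    (hΛ : Belitskii.IsReducedAlgebra b rel Λ)
    (M : Matrix (Fin n) (Fin n) k)
    (parts : Fin m → Belitskii.Part n) (mark : Fin m → Bool)
    (hpartition : ∀ x y, ∃! q, (parts q).Has x y)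
    (horder : ∀ p q, p < q → (parts p).Before (parts q))
    (hform : ∀ q, (mark q = true ∧ (parts q).of M = 0) ∨
      (mark q = false ∧
        (Belitskii.IsRankForm ((parts q).of M) ∨ Belitskii.IsWeyr ((parts q).of M)))) :
    Belitskii.IsStructuredCanonical Λ M parts mark ↔
      ∀ q,
        (∃ u v, ∀ x y, (parts q).Has x y ↔
          Belitskii.strips b rel M parts q u x ∧ Belitskii.strips b rel M parts q v y) ∧
        (Belitskii.CanBeChanged b rel Λ M parts q → mark q = true ∧ (parts q).of M = 0) ∧
        (¬ Belitskii.CanBeChanged b rel Λ M parts q →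
          (Belitskii.Linked b rel M parts q (parts q).top (parts q).left →
            mark q = false ∧ Belitskii.IsWeyr ((parts q).of M)) ∧
          (¬ Belitskii.Linked b rel M parts q (parts q).top (parts q).left →
            mark q = false ∧ Belitskii.IsRankForm ((parts q).of M))) := by
  constructor
  · rintro ⟨N, hrun⟩ q
    exact hrun.partCondition hΛ hpartition horder rfl (Nat.zero_le m)
      (Belitskii.stage_zero hΛ) Belitskii.boxesBelow_zero.symm
      (fun p hp => absurd hp (Nat.not_lt_zero _)) q
  · intro hc
    -- A matrix satisfying the conditions is its own canonical form.
    refine ⟨M, ?_⟩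
    rw [← Belitskii.boxesBelow_zero (parts := parts) (mark := mark)]
    exact Belitskii.Stage.run hΛ hpartition horder hc m (Belitskii.stage_zero hΛ) (Nat.zero_add m)
      le_rfl fun p _ hp => absurd hp (Nat.not_lt_zero _)
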